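/- Let $A$ be a (multiplicative, possibly infinite) abelian group and $R$ a commutative ring with unit. For a finite group $\Gamma$ let $\mathcal M(\Gamma)$ be the set of pairs $(D,\phi)$ with $D\le\Gamma$ and $\phi\in D^*:=\mathrm{Hom}(D,A)$; $\Gamma$ acts on it by ${}^{\gamma}(D,\phi)=({}^\gamma D,{}^\gamma\phi)$. An $A$-fibered $(G,H)$-biset $U$ is a $G\times H\times A$-set that is free over $A$ and has finitely many $A$-orbits, with right $H$-action $uh=(1,h^{-1})u$; for $u\in U$, $(G\times H)_u$ is the stabilizer of the $A$-orbit of $u$, and $\phi_u\in (G\times H)_u^*$ is given by $(g,h)u=\phi_u(g,h)u$. The group $B^A(G,H)$ is the Grothendieck group of these bisets under disjoint union, and $\left[\frac{G\times H}{D,\phi}\right]$ is the class of $(G\times H\times A)/\{(d,\phi(d)^{-1}) : d\in D\}$. The category $\mathcal C^A$ has the finite groups as objects, $\mathrm{Hom}(H,G)=B^A_R(G,H)=R\otimes_{\mathbb Z}B^A(G,H)$, and composition induced by the tensor product $U\otimes_{AH}V$ (the $A$-free $H\times A$-orbits on $U\times V$). For $D\le G\times H$ let $p_1(D),p_2(D)$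 be its projections, $k_1(D)=\{g:(g,1)\in D\}$, $k_2(D)=\{h:(1,h)\in D\}$, and for $\phi\in D^*$ let $\phi_1(g)=\phi(g,1)$ on $k_1(D)$ and $\phi_2(h)=\phi(1,h)^{-1}$ on $k_2(D)$. For $E\le H\times K$ let $D*E=\{(g,k):\exists h,\ (g,h)\in D,\ (h,k)\in E\}$, and if $\phi_2=\psi_1$ on $k_2(D)\cap k_1(E)$ let $(\phi*\psi)(g,k)=\phi(g,h)\psi(h,k)$, $(D,\phi)*(E,\psi)=(D*E,\phi*\psi)$. For subgroups $L\le H$, $K\le G$ put $D*L=\{g:\exists l\in L,\ (g,l)\in D\}$ and $K*D=\{h:\exists k\in K,\ (k,h)\in D\}$. Let $\mathcal G$ be a class of finite groups, $\Sigma_{\mathcal G}(G)=\{H\le G: H\in\mathcal G\}$, and let $\mathcal S(G,H)\subseteq\mathcal M(G\times H)$ for $G,H\in\mathcal G$. Assume for all $G,H,K\in\mathcal G$: (i) $(\Delta(G),1)\in\mathcal S(G,G)$; (ii) $\mathcal S(G,H)$ is closed under $G\times H$-conjugation; (iii) if $(D,\phi)\in\mathcal S(G,H)$, $(E,\psi)\in\mathcal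 S(H,K)$ and $\phi_2=\psi_1$ on $k_2(D)\cap k_1(E)$, then $(D,\phi)*(E,\psi)\in\mathcal S(G,K)$; (vii) if $(D,\phi)\in\mathcal S(G,H)$, then $p_2(D)\in\mathcal G$, and for all $L\in\Sigma_{\mathcal G}(p_2(D))$ one has $D*L\in\mathcal G$ and $(D,\phi)*(\Delta(L),1)\in\mathcal S(D*L,L)$; (viii) if $(D,\phi)\in\mathcal S(G,H)$, then $p_1(D)\in\mathcal G$, and for all $L\in\Sigma_{\mathcal G}(p_1(D))$ one has $L*D\in\mathcal G$ and $(\Delta(L),1)*(D,\phi)\in\mathcal S(L,L*D)$; ($k_2$) $k_2(D)=\{1\}$ for all $(D,\phi)\in\mathcal S(G,H)$; ($\cap$) $\mathcal G$ is closed under intersections: if $G\in\mathcal G$ and $K,L\in\Sigma_{\mathcal G}(G)$, then $K\cap L\in\mathcal G$. Let $\mathcal D=\mathcal C^A(\mathcal G,\mathcal S)$ be the subcategory of $\mathcal C^A$ with object class $\mathcal G$ in which the morphisms $H\to G$ are the $R$-combinations of the classes $\left[\frac{G\times H}{D,\phi}\right]$, $(D,\phi)\in\mathcal S(G,H)$.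 Let $\mathcal S^+(G,H)$ be the set of $(D,\phi)\in\mathcal M(G\times H)$ with $p_1(D),p_2(D)\in\mathcal G$ and $(D,\phi)\in\mathcal S(p_1(D),p_2(D))$, and $\mathcal D^+=\mathcal C^A(\mathcal G,\mathcal S^+)$. Let $\mathcal F_{\mathcal D,R}$ be the category of $R$-linear functors from $\mathcal D$ to $R$-modules, and likewise $\mathcal F_{\mathcal D^+,R}$. For $G\in\mathcal G$ let $\mathcal M'(G)=\{(K,\lambda): K\in\Sigma_{\mathcal G}(G),\ \lambda\in K^*\}$. For $F\in\mathcal F_{\mathcal D,R}$ let $F^+(G)$ be the $R$-module of all $(x_{(K,\lambda)})\in\bigoplus_{(K,\lambda)\in\mathcal M'(G)}F(K)$ with ${}^g x_{(K,\lambda)}=x_{({}^gK,{}^g\lambda)}$ for all $g\in G$ and $(K,\lambda)\in\mathcal M'(G)$, where ${}^g x$ is the image of $x$ under $F$ of the conjugation isomorphism $K\to{}^gK$. For $G,H\in\mathcal G$, an $A$-fibered $(G,H)$-biset $U$ with all stabilizing pairs $((G\times H)_u,\phi_u)$ in $\mathcal S^+(G,H)$, and $x\in F^+(H)$, define $F^+([U])(x)=(y_{(K,\alpha)})$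 by $$y_{(K,\alpha)}=\sum_{u,\mu}F\left(\left[\frac{K\times K^u}{(\Delta(K),1)*((G\times H)_u,\phi_u)}\right]\right)\left(x_{(K^u,\mu)}\right),\qquad K^u=K*(G\times H)_u,$$ where $u$ runs over a set of representatives of the $(A,H)$-orbits of $U$ with $K\le p_1((G\times H)_u)$, and $\mu$ over the elements of $(K^u)^*$ with $\phi_{u,2}=\mu$ on $k_2((G\times H)_u)\cap K^u$ and $\phi_u*\mu=\alpha$, i.e. $\phi_u(k,h)\mu(h)=\alpha(k)$ for all $k\in K$, $h\in K^u$ with $(k,h)\in(G\times H)_u$. **Theorem.** These constructions are well defined (in particular independent of the chosen representatives and dependent only on $[U]$) and define an $R$-linear functor $-^+:\mathcal F_{\mathcal D,R}\to\mathcal F_{\mathcal D^+,R}$, which sends a morphism $\eta:F\to F'$ to the morphism $\eta^+$ with $\eta^+_G\big((x_{(K,\lambda)})\big)=(\eta_K(x_{(K,\lambda)}))$. -/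

import Mathlib

open CategoryTheory
open scoped TensorProduct DirectSum

universe u w r

namespace FiberedBiset

noncomputable section

/-! ## Finite groups whose underlying sets are subsets of a fixed universe of elements

Working inside a type `V` of elements makes "subgroup" literal: a subgroup of `G` is again
a finite group in `V`, with a smaller underlying set and the restricted multiplication. -/

/-- A finite group whose elements are taken from `V`. -/
structure FinGrp (V : Type u) where
  carrier : Set V
  [group : Group carrier]
  [finite : Finite carrier]

attribute [instance] FinGrp.group FinGrp.finite

namespace FinGrp

variable {V : Type u}

instance : CoeSort (FinGrp V) (Type u) := ⟨fun G => G.carrier⟩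

/-- `K ≤ G`: the set `K` is contained in `G` and the multiplication of `K` is the restriction
of that of `G`, i.e. `K` is a subgroup of `G`. -/
instance : LE (FinGrp V) :=
  ⟨fun K G => ∃ h : K.carrier ⊆ G.carrier,
    ∀ x y : K, Set.inclusion h (x * y) = Set.inclusion h x * Set.inclusion h y⟩

instance : PartialOrder (FinGrp V) where
  le := (· ≤ ·)
  le_refl G := ⟨subset_rfl, fun _ _ => rfl⟩
  le_trans K L G h₁ h₂ := by
    obtain ⟨a, ha⟩ := h₁
    obtain ⟨b, hb⟩ := h₂
    refine ⟨a.trans b, fun x y => ?_⟩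
    have := congrArg (Set.inclusion b) (ha x y)
    rw [hb] at this
    exact this
  le_antisymm K G h₁ h₂ := by
    obtain ⟨a, ha⟩ := h₁
    obtain ⟨b, hb⟩ := h₂
    obtain ⟨k, gk, fk⟩ := K
    obtain ⟨g, gg, fg⟩ := G
    obtain rfl : k = g := Set.Subset.antisymm a b
    congr 1
    ext x y
    exact congrArg Subtype.val (ha x y)

lemma le_mk {K G : FinGrp V} (h : K.carrier ⊆ G.carrier)
    (h' : ∀ x y : K, Set.inclusion h (x * y) = Set.inclusion h x * Set.inclusion h y) : K ≤ G :=
  ⟨h, h'⟩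

/-- The inclusion homomorphism of a subgroup. -/
def incl {K G : FinGrp V} (h : K ≤ G) : K →* G :=
  MonoidHom.mk' (Set.inclusion h.1) h.2

@[simp] lemma coe_incl {K G : FinGrp V} (h : K ≤ G) (x : K) : ((incl h x : G) : V) = x := rfl

lemma incl_injective {K G : FinGrp V} (h : K ≤ G) : Function.Injective (incl h) :=
  Set.inclusion_injective h.1

/-- A subgroup `P` of `G`, as a finite group in `V`. -/
def sub (G : FinGrp V) (P : Subgroup G) : FinGrp V where
  carrier := Subtype.val '' (P : Set G)
  group := Equiv.group (β := P)
    { toFun := fun x => ⟨⟨x.1, by obtain ⟨y, _, hy⟩ := x.2; exact hy ▸ y.2⟩, by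
        obtain ⟨x, y, hy, rfl⟩ := x; exact hy⟩
      invFun := fun y => ⟨y.1.1, y.1, y.2, rfl⟩
      left_inv := fun _ => rfl
      right_inv := fun _ => rfl }

lemma sub_le (G : FinGrp V) (P : Subgroup G) : G.sub P ≤ G :=
  ⟨by rintro _ ⟨y, _, rfl⟩; exact y.2, fun _ _ => rfl⟩

lemma mem_sub {G : FinGrp V} {P : Subgroup G} (x : G) : (x : V) ∈ (G.sub P).carrier ↔ x ∈ P :=
  ⟨by rintro ⟨y, hy, h⟩; rwa [← Subtype.ext h], fun h => ⟨x, h, rfl⟩⟩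

lemma incl_sub_mem {G : FinGrp V} {P : Subgroup G} (x : G.sub P) : incl (sub_le G P) x ∈ P :=
  (mem_sub _).1 x.2

lemma le_sub {K G : FinGrp V} {P : Subgroup G} (hK : K ≤ G) (h : ∀ k : K, incl hK k ∈ P) :
    K ≤ G.sub P :=
  ⟨fun x hx => (mem_sub (incl hK ⟨x, hx⟩)).2 (h ⟨x, hx⟩), fun x y => by
    apply incl_injective (sub_le G P)
    rw [map_mul]
    exact hK.2 x y⟩

lemma mem_of_le_sub {K G : FinGrp V} {P : Subgroup G} (h : K ≤ G.sub P) (hK : K ≤ G) (k : K) :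
    incl hK k ∈ P := (mem_sub _).1 (h.1 k.2)

lemma eq_sub {K G : FinGrp V} {P : Subgroup G} (hK : K ≤ G) (h : ∀ k : K, incl hK k ∈ P)
    (h' : ∀ x ∈ P, (x : V) ∈ K.carrier) : G.sub P = K := by
  refine le_antisymm (le_mk ?_ fun x y => ?_) (le_sub hK h)
  · rintro _ ⟨y, hy, rfl⟩
    exact h' y hy
  · apply incl_injective hK
    rw [map_mul]
    rfl

/-- The intersection of two subgroups of `G`. -/
def inter {K L G : FinGrp V} (hK : K ≤ G) (hL : L ≤ G) : FinGrp V :=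
  G.sub ((incl hK).range ⊓ (incl hL).range)

/-- The conjugate `ᵍK = gKg⁻¹` of a subgroup `K` of `G`. -/
def conj {K G : FinGrp V} (hK : K ≤ G) (g : G) : FinGrp V :=
  G.sub ((incl hK).range.map (MulAut.conj g).toMonoidHom)

lemma conj_le {K G : FinGrp V} (hK : K ≤ G) (g : G) : conj hK g ≤ G := sub_le _ _

lemma conj_aux {K G : FinGrp V} (hK : K ≤ G) (g : G) (x : conj hK g) :
    ((g⁻¹ * incl (conj_le hK g) x * g : G) : V) ∈ K.carrier := by
  obtain ⟨_, ⟨k, rfl⟩, hk⟩ := incl_sub_mem x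
  have : incl (conj_le hK g) x = g * incl hK k * g⁻¹ := hk.symm
  rw [this]
  have : g⁻¹ * (g * incl hK k * g⁻¹) * g = incl hK k := by group
  rw [this]
  exact k.2

/-- The isomorphism `ᵍK → K`, `x ↦ g⁻¹xg`. -/
def conjInv {K G : FinGrp V} (hK : K ≤ G) (g : G) : conj hK g →* K :=
  MonoidHom.mk' (fun x => ⟨(g⁻¹ * incl (conj_le hK g) x * g : G), conj_aux hK g x⟩) (by
    intro x y
    apply incl_injective hK
    rw [map_mul (incl hK)]
    change g⁻¹ * incl (conj_le hK g) (x * y) * g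
      = (g⁻¹ * incl (conj_le hK g) x * g) * (g⁻¹ * incl (conj_le hK g) y * g)
    rw [map_mul (incl (conj_le hK g))]
    group)

lemma incl_conjInv {K G : FinGrp V} (hK : K ≤ G) (g : G) (x : conj hK g) :
    incl hK (conjInv hK g x) = g⁻¹ * incl (conj_le hK g) x * g := rfl

lemma mem_conj {K G : FinGrp V} (hK : K ≤ G) (g : G) (k : K) :
    ((g * incl hK k * g⁻¹ : G) : V) ∈ (conj hK g).carrier :=
  (mem_sub _).2 ⟨_, ⟨k, rfl⟩, rfl⟩

end FinGrp

/-! ## Pairs `(D, φ)` with `D ≤ Γ` and `φ ∈ Hom(D, A)` -/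

/-- The set `ℳ(Γ)` of pairs `(D, φ)` with `D` a subgroup of `Γ` and `φ : D → A` a homomorphism. -/
structure MPair (Γ A : Type u) [Group Γ] [CommGroup A] where
  D : Subgroup Γ
  φ : D →* A

namespace MPair

variable {A : Type u} [CommGroup A]

lemma ext' {Γ : Type u} [Group Γ] {p q : MPair Γ A} (h : ∀ x, x ∈ p.D ↔ x ∈ q.D)
    (h' : ∀ x (hp : x ∈ p.D) (hq : x ∈ q.D), p.φ ⟨x, hp⟩ = q.φ ⟨x, hq⟩) : p = q := by
  obtain ⟨D, φ⟩ := p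
  obtain ⟨E, ψ⟩ := q
  obtain rfl : D = E := Subgroup.ext h
  congr 1
  ext x
  exact h' x.1 x.2 x.2

/-- The preimage of a pair under a group homomorphism. -/
def comap {Γ Γ' : Type u} [Group Γ] [Group Γ'] (f : Γ' →* Γ) (p : MPair Γ A) : MPair Γ' A where
  D := p.D.comap f
  φ := p.φ.comp (f.subgroupComap p.D)

/-- The conjugate pair `ᵞ(D, φ)`: `ᵞD = γDγ⁻¹` and `ᵞφ(γdγ⁻¹) = φ(d)`. -/
def conj {Γ : Type u} [Group Γ] (γ : Γ) (p : MPair Γ A) : MPair Γ A :=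
  p.comap (MulAut.conj γ⁻¹).toMonoidHom

variable {G H K : Type u} [Group G] [Group H] [Group K]

/-- For a homomorphism `f`, the pair consisting of the graph `{(x, f x)}` and the trivial
homomorphism. -/
def graph (f : G →* H) : MPair (G × H) A := ⟨f.graph, 1⟩

/-- The pair `(Δ(G), 1)`. -/
def diag (G : Type u) [Group G] : MPair (G × G) A := graph (MonoidHom.id G)

/-- `k₁(D) = {g ∣ (g, 1) ∈ D}`. -/
def k₁ (D : Subgroup (G × H)) : Subgroup G := D.comap (MonoidHom.inl G H)

/-- `k₂(D) = {h ∣ (1, h) ∈ D}`. -/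
def k₂ (D : Subgroup (G × H)) : Subgroup H := D.comap (MonoidHom.inr G H)

/-- `φ₁ : k₁(D) → A`, `g ↦ φ(g, 1)`. -/
def φ₁ (p : MPair (G × H) A) : k₁ p.D →* A := p.φ.comp ((MonoidHom.inl G H).subgroupComap p.D)

/-- `φ₂ : k₂(D) → A`, `h ↦ φ(1, h)⁻¹`. -/
def φ₂ (p : MPair (G × H) A) : k₂ p.D →* A :=
  (p.φ.comp ((MonoidHom.inr G H).subgroupComap p.D))⁻¹

/-- The condition `φ₂ = ψ₁` on `k₂(U) ∩ k₁(V)` under which `φ * ψ` is defined. -/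
def Compat (p : MPair (G × H) A) (q : MPair (H × K) A) : Prop :=
  ∀ (h : H) (h₂ : h ∈ k₂ p.D) (h₁ : h ∈ k₁ q.D), p.φ₂ ⟨h, h₂⟩ = q.φ₁ ⟨h, h₁⟩

/-- `U * V = {(g, k) ∣ ∃ h, (g, h) ∈ U, (h, k) ∈ V}`. -/
def starD (U : Subgroup (G × H)) (V : Subgroup (H × K)) : Subgroup (G × K) where
  carrier := {x | ∃ h, (x.1, h) ∈ U ∧ (h, x.2) ∈ V}
  one_mem' := ⟨1, U.one_mem, V.one_mem⟩
  mul_mem' := by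
    rintro x y ⟨h, h₁, h₂⟩ ⟨h', h₁', h₂'⟩
    exact ⟨h * h', U.mul_mem h₁ h₁', V.mul_mem h₂ h₂'⟩
  inv_mem' := by
    rintro x ⟨h, h₁, h₂⟩
    exact ⟨h⁻¹, U.inv_mem h₁, V.inv_mem h₂⟩

lemma star_indep {p : MPair (G × H) A} {q : MPair (H × K) A} (c : Compat p q) {g : G} {k : K}
    {h h' : H} (h₁ : (g, h) ∈ p.D) (h₂ : (h, k) ∈ q.D) (h₁' : (g, h') ∈ p.D)
    (h₂' : (h', k) ∈ q.D) :
    p.φ ⟨_, h₁⟩ * q.φ ⟨_, h₂⟩ = p.φ ⟨_, h₁'⟩ * q.φ ⟨_, h₂'⟩ := by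
  have e₁ : ((1 : G), h'⁻¹ * h) ∈ p.D := by
    simpa using p.D.mul_mem (p.D.inv_mem h₁') h₁
  have e₂ : (h'⁻¹ * h, (1 : K)) ∈ q.D := by
    simpa using q.D.mul_mem (q.D.inv_mem h₂') h₂
  have := c (h'⁻¹ * h) e₁ e₂
  have this : (p.φ ⟨_, e₁⟩)⁻¹ = q.φ ⟨_, e₂⟩ := this
  have f₁ : p.φ ⟨_, h₁⟩ = p.φ ⟨_, h₁'⟩ * p.φ ⟨_, e₁⟩ := by
    rw [← map_mul]; congr 1; ext <;> simp
  have f₂ : q.φ ⟨_, h₂⟩ = q.φ ⟨_, h₂'⟩ * q.φ ⟨_, e₂⟩ := by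
    rw [← map_mul]; congr 1; ext <;> simp
  rw [f₁, f₂, ← this]
  rw [mul_assoc, mul_comm (q.φ _) _, mul_inv_cancel_left]

/-- The product `(U, φ) * (V, ψ) = (U * V, φ * ψ)` with `(φ * ψ)(g, k) = φ(g, h) ψ(h, k)`
for any `h` such that `(g, h) ∈ U` and `(h, k) ∈ V`. -/
def star (p : MPair (G × H) A) (q : MPair (H × K) A) (c : Compat p q) : MPair (G × K) A where
  D := starD p.D q.D
  φ := MonoidHom.mk'
    (fun x => p.φ ⟨(x.1.1, x.2.choose), x.2.choose_spec.1⟩ *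
      q.φ ⟨(x.2.choose, x.1.2), x.2.choose_spec.2⟩) (by
    intro x y
    have := star_indep c (x * y).2.choose_spec.1 (x * y).2.choose_spec.2
      (p.D.mul_mem x.2.choose_spec.1 y.2.choose_spec.1)
      (q.D.mul_mem x.2.choose_spec.2 y.2.choose_spec.2)
    rw [this]
    have f₁ := map_mul p.φ ⟨_, x.2.choose_spec.1⟩ ⟨_, y.2.choose_spec.1⟩
    have f₂ := map_mul q.φ ⟨_, x.2.choose_spec.2⟩ ⟨_, y.2.choose_spec.2⟩
    rw [mul_mul_mul_comm, ← f₁, ← f₂]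
    rfl)

lemma star_apply {p : MPair (G × H) A} {q : MPair (H × K) A} (c : Compat p q) {g : G} {k : K}
    {h : H} (h₁ : (g, h) ∈ p.D) (h₂ : (h, k) ∈ q.D) (hx : (g, k) ∈ (star p q c).D) :
    (star p q c).φ ⟨(g, k), hx⟩ = p.φ ⟨_, h₁⟩ * q.φ ⟨_, h₂⟩ :=
  star_indep c _ _ _ _

end MPair

namespace MPair

variable {V A : Type u} [CommGroup A] {G H K L : FinGrp V}

open FinGrp

/-- For `K ≤ G` and `L ≤ H`, the pair `(D ∩ (K × L), φ|)`, regarded as an element of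
`ℳ(K × L)`. If `D ≤ K × L` this is `(D, φ)` itself. -/
def res (hK : K ≤ G) (hL : L ≤ H) (p : MPair (G × H) A) : MPair (K × L) A :=
  p.comap ((incl hK).prodMap (incl hL))

/-- The first projection `p₁(D)` of `D ≤ G × H`, as a finite group. -/
def p₁ (D : Subgroup (G × H)) : FinGrp V := G.sub (D.map (MonoidHom.fst G H))

/-- The second projection `p₂(D)` of `D ≤ G × H`, as a finite group. -/
def p₂ (D : Subgroup (G × H)) : FinGrp V := H.sub (D.map (MonoidHom.snd G H))

lemma p₁_le (D : Subgroup (G × H)) : p₁ D ≤ G := sub_le _ _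

lemma p₂_le (D : Subgroup (G × H)) : p₂ D ≤ H := sub_le _ _

/-- `K * D = {h ∈ H ∣ ∃ k ∈ K, (k, h) ∈ D}` for `K ≤ G` and `D ≤ G × H`. -/
def lstar (hK : K ≤ G) (D : Subgroup (G × H)) : FinGrp V :=
  H.sub ((D.comap ((incl hK).prodMap (MonoidHom.id H))).map (MonoidHom.snd K H))

/-- `D * L = {g ∈ G ∣ ∃ l ∈ L, (g, l) ∈ D}` for `L ≤ H` and `D ≤ G × H`. -/
def rstar (D : Subgroup (G × H)) (hL : L ≤ H) : FinGrp V :=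
  G.sub ((D.comap ((MonoidHom.id G).prodMap (incl hL))).map (MonoidHom.fst G L))

lemma lstar_le (hK : K ≤ G) (D : Subgroup (G × H)) : lstar hK D ≤ H := sub_le _ _

lemma rstar_le (D : Subgroup (G × H)) (hL : L ≤ H) : rstar D hL ≤ G := sub_le _ _

/-- `(Δ(K), 1)` as an element of `ℳ(K × G)`, for `K ≤ G`. -/
def diagL (hK : K ≤ G) : MPair (K × G) A := graph (incl hK)

/-- `(Δ(L), 1)` as an element of `ℳ(H × L)`, for `L ≤ H`. -/
def diagR (hL : L ≤ H) : MPair (H × L) A :=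
  ⟨(diagL (A := A) hL).D.comap (MulEquiv.prodComm : H × L ≃* L × H).toMonoidHom, 1⟩

lemma compat_diagL (hK : K ≤ G) (p : MPair (G × H) A) : Compat (diagL hK) p := by
  intro g h₂ h₁
  have e : g = 1 := (map_one (incl hK)).symm.trans h₂ |>.symm
  subst e
  exact (map_one _).trans (map_one p.φ₁).symm

lemma compat_diagR (hL : L ≤ H) (p : MPair (G × H) A) : Compat p (diagR hL) := by
  intro g h₂ h₁
  have e : (1 : H) = g := (map_one (incl hL)).symm.trans h₁
  subst e
  exact (map_one p.φ₂).trans (map_one _).symm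

end MPair

/-! ## The data `(𝒢, 𝒮)` and the axioms -/

/-- A class `𝒢` of finite groups and sets `𝒮(G, H) ⊆ ℳ(G × H)`; only the values for
`G, H ∈ 𝒢` are ever used. -/
structure Datum (V A : Type u) [CommGroup A] where
  𝒢 : Set (FinGrp V)
  S : ∀ G H : FinGrp V, Set (MPair (G × H) A)

namespace Datum

open FinGrp MPair

variable {V A : Type u} [CommGroup A]

/-- The Axioms (i), (ii) and (iii). -/
structure AxiomsItoIII (X : Datum V A) : Prop where
  diag_mem : ∀ G ∈ X.𝒢, diag (A := A) G ∈ X.S G G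
  conj_mem : ∀ G ∈ X.𝒢, ∀ H ∈ X.𝒢, ∀ p ∈ X.S G H, ∀ x : G × H, p.conj x ∈ X.S G H
  star_mem : ∀ G ∈ X.𝒢, ∀ H ∈ X.𝒢, ∀ K ∈ X.𝒢, ∀ p ∈ X.S G H, ∀ q ∈ X.S H K,
    ∀ c : Compat p q, star p q c ∈ X.S G K

/-- Axiom (vii): `p₂(D) ∈ 𝒢`, and for every subgroup `L ∈ 𝒢` of `p₂(D)` one has `D * L ∈ 𝒢` and
`(D, φ) * (Δ(L), 1) ∈ 𝒮(D * L, L)`. -/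
def AxiomVII (X : Datum V A) : Prop :=
  ∀ G ∈ X.𝒢, ∀ H ∈ X.𝒢, ∀ p ∈ X.S G H, p₂ p.D ∈ X.𝒢 ∧
    ∀ L ∈ X.𝒢, ∀ hL : L ≤ p₂ p.D,
      rstar p.D (hL.trans (p₂_le p.D)) ∈ X.𝒢 ∧
      (star p (diagR (hL.trans (p₂_le p.D))) (compat_diagR _ p)).res
        (rstar_le p.D (hL.trans (p₂_le p.D))) le_rfl ∈ X.S (rstar p.D (hL.trans (p₂_le p.D))) L

/-- Axiom (viii): `p₁(D) ∈ 𝒢`, and for every subgroup `K ∈ 𝒢` of `p₁(D)` one has `K * D ∈ 𝒢` and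
`(Δ(K), 1) * (D, φ) ∈ 𝒮(K, K * D)`. -/
def AxiomVIII (X : Datum V A) : Prop :=
  ∀ G ∈ X.𝒢, ∀ H ∈ X.𝒢, ∀ p ∈ X.S G H, p₁ p.D ∈ X.𝒢 ∧
    ∀ K ∈ X.𝒢, ∀ hK : K ≤ p₁ p.D,
      lstar (hK.trans (p₁_le p.D)) p.D ∈ X.𝒢 ∧
      (star (diagL (hK.trans (p₁_le p.D))) p (compat_diagL _ p)).res le_rfl
        (lstar_le (hK.trans (p₁_le p.D)) p.D) ∈ X.S K (lstar (hK.trans (p₁_le p.D)) p.D)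

/-- The condition `k₂`: `k₂(D) = 1` for all `(D, φ) ∈ 𝒮(G, H)`, `G, H ∈ 𝒢`. -/
def CondK2 (X : Datum V A) : Prop :=
  ∀ G ∈ X.𝒢, ∀ H ∈ X.𝒢, ∀ p ∈ X.S G H, k₂ p.D = ⊥

/-- `𝒢` is closed under intersections: if `K, L ∈ 𝒢` are subgroups of a group in `𝒢`, then
`K ∩ L ∈ 𝒢`. -/
def ClosedUnderInter (X : Datum V A) : Prop :=
  ∀ G ∈ X.𝒢, ∀ K ∈ X.𝒢, ∀ L ∈ X.𝒢, ∀ (hK : K ≤ G) (hL : L ≤ G), inter hK hL ∈ X.𝒢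

/-- The data `(𝒢, 𝒮⁺)`: `(D, φ) ∈ 𝒮⁺(G, H)` iff `p₁(D), p₂(D) ∈ 𝒢` and
`(D, φ) ∈ 𝒮(p₁(D), p₂(D))`. -/
def plus (X : Datum V A) : Datum V A where
  𝒢 := X.𝒢
  S G H := {p | p₁ p.D ∈ X.𝒢 ∧ p₂ p.D ∈ X.𝒢 ∧
    p.res (p₁_le p.D) (p₂_le p.D) ∈ X.S (p₁ p.D) (p₂ p.D)}

/-! ### Elementary facts: `(𝒢, 𝒮⁺)` satisfies (i), (ii), (iii) -/

section Lemmas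

variable {G H K L M N : FinGrp V}

lemma res_self (p : MPair (G × H) A) : p.res le_rfl le_rfl = p :=
  ext' (fun _ => Iff.rfl) (fun _ _ _ => rfl)

lemma res_res {G' H' : FinGrp V} (p : MPair (G × H) A) (hK : K ≤ G) (hL : L ≤ H)
    (hK' : G' ≤ K) (hL' : H' ≤ L) :
    (p.res hK hL).res hK' hL' = p.res (hK'.trans hK) (hL'.trans hL) :=
  ext' (fun _ => Iff.rfl) (fun _ _ _ => rfl)

lemma res_mem_congr (X : Datum V A) {K' L' : FinGrp V} {p : MPair (G × H) A} {hK : K ≤ G}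
    {hL : L ≤ H} (h : p.res hK hL ∈ X.S K L) (eK : K = K') (eL : L = L') (hK' : K' ≤ G)
    (hL' : L' ≤ H) : p.res hK' hL' ∈ X.S K' L' := by
  subst eK eL
  exact h

lemma mem_p₁ {D : Subgroup (G × H)} {g : G} : (g : V) ∈ (p₁ D).carrier ↔ ∃ h, (g, h) ∈ D := by
  rw [p₁, mem_sub]
  constructor
  · rintro ⟨⟨g', h⟩, hD, rfl⟩
    exact ⟨h, hD⟩
  · rintro ⟨h, hD⟩
    exact ⟨_, hD, rfl⟩

lemma mem_p₂ {D : Subgroup (G × H)} {h : H} : (h : V) ∈ (p₂ D).carrier ↔ ∃ g, (g, h) ∈ D := by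
  rw [p₂, mem_sub]
  constructor
  · rintro ⟨⟨g', h⟩, hD, rfl⟩
    exact ⟨g', hD⟩
  · rintro ⟨h, hD⟩
    exact ⟨_, hD, rfl⟩

lemma mem_lstar {hK : K ≤ G} {D : Subgroup (G × H)} {h : H} :
    (h : V) ∈ (lstar hK D).carrier ↔ ∃ k : K, (incl hK k, h) ∈ D := by
  rw [lstar, mem_sub]
  constructor
  · rintro ⟨⟨g', h⟩, hD, rfl⟩
    exact ⟨g', hD⟩
  · rintro ⟨k, hD⟩
    exact ⟨(k, h), hD, rfl⟩

lemma mem_rstar {hL : L ≤ H} {D : Subgroup (G × H)} {g : G} :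
    (g : V) ∈ (rstar D hL).carrier ↔ ∃ l : L, (g, incl hL l) ∈ D := by
  rw [rstar, mem_sub]
  constructor
  · rintro ⟨⟨g', h⟩, hD, rfl⟩
    exact ⟨h, hD⟩
  · rintro ⟨k, hD⟩
    exact ⟨(g, k), hD, rfl⟩

/-- Two subgroups of `G` with the same elements are equal. -/
lemma eq_of_mem (hK : K ≤ G) (hL : L ≤ G) (h : ∀ g : G, (g : V) ∈ K.carrier ↔ (g : V) ∈ L.carrier) :
    K = L := by
  have aux : ∀ {K L : FinGrp V} (hK : K ≤ G) (hL : L ≤ G),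
      (∀ g : G, (g : V) ∈ K.carrier ↔ (g : V) ∈ L.carrier) → K ≤ L := by
    intro K L hK hL h
    have hs : K.carrier ⊆ L.carrier := fun x hx => (h ⟨x, hK.1 hx⟩).1 hx
    refine le_mk hs fun x y => ?_
    apply incl_injective hL
    rw [map_mul]
    exact hK.2 x y
  exact le_antisymm (aux hK hL h) (aux hL hK fun g => (h g).symm)

lemma le_of_mem (hK : K ≤ G) (hL : L ≤ G)
    (h : ∀ g : G, (g : V) ∈ K.carrier → (g : V) ∈ L.carrier) : K ≤ L := by
  have hs : K.carrier ⊆ L.carrier := fun x hx => h ⟨x, hK.1 hx⟩ hx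
  refine le_mk hs fun x y => ?_
  apply incl_injective hL
  rw [map_mul]
  exact hK.2 x y

lemma star_diagR (hL : L ≤ H) (p : MPair (G × H) A) :
    star p (diagR hL) (compat_diagR hL p) = p.res le_rfl hL := by
  have key : ∀ (l : L), (incl hL l, l) ∈ (diagR (A := A) hL).D := fun _ => rfl
  refine ext' ?_ ?_
  · rintro ⟨g, l⟩
    constructor
    · rintro ⟨h, h₁, h₂⟩
      have : incl hL l = h := h₂
      subst this
      exact h₁
    · intro h
      exact ⟨incl hL l, h, rfl⟩
  · rintro ⟨g, l⟩ h₁ h₂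
    refine (star_apply _ (h := incl hL l) h₂ (key l) h₁).trans ?_
    exact mul_one _

lemma star_diagL (hK : K ≤ G) (p : MPair (G × H) A) :
    star (diagL hK) p (compat_diagL hK p) = p.res hK le_rfl := by
  have key : ∀ (l : K), (l, incl hK l) ∈ (diagL (A := A) hK).D := fun _ => rfl
  refine ext' ?_ ?_
  · rintro ⟨g, l⟩
    constructor
    · rintro ⟨h, h₁, h₂⟩
      have : incl hK g = h := h₁
      subst this
      exact h₂
    · intro h
      exact ⟨incl hK g, rfl, h⟩
  · rintro ⟨g, l⟩ h₁ h₂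
    refine (star_apply _ (h := incl hK g) (key g) h₂ h₁).trans ?_
    exact one_mul _

variable {X : Datum V A}

/-- For `(D, φ) ∈ 𝒮⁺(G, H)` and `K ∈ 𝒢` a subgroup of `p₁(D)`, one has `K * D ∈ 𝒢` and
`(Δ(K), 1) * (D, φ) ∈ 𝒮(K, K * D)`. -/
lemma lstar_mem (h8 : X.AxiomVIII) {p : MPair (G × H) A} (hp : p ∈ X.plus.S G H)
    (hKm : K ∈ X.𝒢) (hK : K ≤ p₁ p.D) :
    lstar (hK.trans (p₁_le p.D)) p.D ∈ X.𝒢 ∧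
      p.res (hK.trans (p₁_le p.D)) (lstar_le (hK.trans (p₁_le p.D)) p.D) ∈
        X.S K (lstar (hK.trans (p₁_le p.D)) p.D) := by
  obtain ⟨h₁, h₂, h₃⟩ := hp
  obtain ⟨-, h⟩ := h8 _ h₁ _ h₂ _ h₃
  have hK' : K ≤ p₁ (p.res (p₁_le p.D) (p₂_le p.D)).D := by
    refine le_of_mem hK (p₁_le _) fun g hg => ?_
    obtain ⟨h, hh⟩ := mem_p₁.1 (show ((incl (p₁_le p.D) g : G) : V) ∈ (p₁ p.D).carrier from g.2)
    exact mem_p₁.2 ⟨⟨h, mem_p₂.2 ⟨_, hh⟩⟩, hh⟩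
  obtain ⟨a, b⟩ := h K hKm hK'
  rw [star_diagL, res_res, res_res] at b
  have e : lstar (hK'.trans (p₁_le _)) (p.res (p₁_le p.D) (p₂_le p.D)).D =
      lstar (hK.trans (p₁_le p.D)) p.D := by
    refine eq_of_mem ((lstar_le _ _).trans (p₂_le _)) (lstar_le _ _) fun x => ?_
    constructor
    · intro hx
      obtain ⟨k, hk⟩ := mem_lstar.1
        (show ((⟨x, (lstar_le _ _).1 hx⟩ : p₂ p.D) : V) ∈ _ from hx)
      exact mem_lstar.2 ⟨k, hk⟩
    · intro hx
      obtain ⟨k, hk⟩ := mem_lstar.1 hx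
      exact mem_lstar (h := (⟨x, mem_p₂.2 ⟨_, hk⟩⟩ : p₂ p.D)).2 ⟨k, hk⟩
  exact ⟨e ▸ a, res_mem_congr X b rfl e _ _⟩

/-- For `(D, φ) ∈ 𝒮⁺(G, H)` and `L ∈ 𝒢` a subgroup of `p₂(D)`, one has `D * L ∈ 𝒢` and
`(D, φ) * (Δ(L), 1) ∈ 𝒮(D * L, L)`. -/
lemma rstar_mem (h7 : X.AxiomVII) {p : MPair (G × H) A} (hp : p ∈ X.plus.S G H)
    (hLm : L ∈ X.𝒢) (hL : L ≤ p₂ p.D) :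
    rstar p.D (hL.trans (p₂_le p.D)) ∈ X.𝒢 ∧
      p.res (rstar_le p.D (hL.trans (p₂_le p.D))) (hL.trans (p₂_le p.D)) ∈
        X.S (rstar p.D (hL.trans (p₂_le p.D))) L := by
  obtain ⟨h₁, h₂, h₃⟩ := hp
  obtain ⟨-, h⟩ := h7 _ h₁ _ h₂ _ h₃
  have hL' : L ≤ p₂ (p.res (p₁_le p.D) (p₂_le p.D)).D := by
    refine le_of_mem hL (p₂_le _) fun g hg => ?_
    obtain ⟨h, hh⟩ := mem_p₂.1 (show ((incl (p₂_le p.D) g : H) : V) ∈ (p₂ p.D).carrier from g.2)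
    exact mem_p₂.2 ⟨⟨h, mem_p₁.2 ⟨_, hh⟩⟩, hh⟩
  obtain ⟨a, b⟩ := h L hLm hL'
  rw [star_diagR, res_res, res_res] at b
  have e : rstar (p.res (p₁_le p.D) (p₂_le p.D)).D (hL'.trans (p₂_le _)) =
      rstar p.D (hL.trans (p₂_le p.D)) := by
    refine eq_of_mem ((rstar_le _ _).trans (p₁_le _)) (rstar_le _ _) fun x => ?_
    constructor
    · intro hx
      obtain ⟨k, hk⟩ := mem_rstar.1
        (show ((⟨x, (rstar_le _ _).1 hx⟩ : p₁ p.D) : V) ∈ _ from hx)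
      exact mem_rstar.2 ⟨k, hk⟩
    · intro hx
      obtain ⟨k, hk⟩ := mem_rstar.1 hx
      exact mem_rstar (g := (⟨x, mem_p₁.2 ⟨_, hk⟩⟩ : p₁ p.D)).2 ⟨k, hk⟩
  exact ⟨e ▸ a, res_mem_congr X b e rfl _ _⟩

lemma mem_conj_iff {hK : K ≤ G} {g x : G} :
    (x : V) ∈ (FinGrp.conj hK g).carrier ↔ ((g⁻¹ * x * g : G) : V) ∈ K.carrier := by
  constructor
  · intro hx
    exact conj_aux hK g ⟨x, hx⟩
  · intro hx
    have := mem_conj hK g ⟨_, hx⟩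
    have e : g * incl hK ⟨_, hx⟩ * g⁻¹ = x := by
      change g * (g⁻¹ * x * g) * g⁻¹ = x
      group
    rwa [e] at this

lemma mem_conj_D {Γ : Type u} [Group Γ] {γ x : Γ} {p : MPair Γ A} :
    x ∈ (p.conj γ).D ↔ γ⁻¹ * x * γ ∈ p.D := by
  change MulAut.conj γ⁻¹ x ∈ p.D ↔ _
  rw [MulAut.conj_apply, inv_inv]

lemma conj_φ {Γ : Type u} [Group Γ] {γ x : Γ} {p : MPair Γ A} (hx : x ∈ (p.conj γ).D) :
    (p.conj γ).φ ⟨x, hx⟩ = p.φ ⟨γ⁻¹ * x * γ, mem_conj_D.1 hx⟩ := by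
  have : ∀ y (h : y ∈ p.D), y = γ⁻¹ * x * γ → p.φ ⟨y, h⟩ = p.φ ⟨γ⁻¹ * x * γ, mem_conj_D.1 hx⟩ := by
    rintro y h rfl
    rfl
  exact this (MulAut.conj γ⁻¹ x) hx (by rw [MulAut.conj_apply, inv_inv])

/-- Conjugates `ᵍK` of subgroups `K ∈ 𝒢` of `G ∈ 𝒢` lie in `𝒢`, and the conjugation isomorphism
`K → ᵍK` is a morphism of `𝒟`. -/
lemma conj_mem_aux (h : X.AxiomsItoIII) (h7 : X.AxiomVII) (hG : G ∈ X.𝒢) (hKm : K ∈ X.𝒢)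
    (hK : K ≤ G) (g : G) :
    FinGrp.conj hK g ∈ X.𝒢 ∧ graph (conjInv hK g) ∈ X.S (FinGrp.conj hK g) K := by
  have h₁ := h.conj_mem G hG G hG _ (h.diag_mem G hG) (g, 1)
  have hD : ∀ x y : G, (x, y) ∈ ((diag (A := A) G).conj (g, (1 : G))).D ↔ g⁻¹ * x * g = y := by
    intro x y
    rw [mem_conj_D]
    change g⁻¹ * x * g = 1⁻¹ * y * 1 ↔ _
    simp
  obtain ⟨-, h₂⟩ := h7 _ hG _ hG _ h₁
  have hK' : K ≤ p₂ ((diag (A := A) G).conj (g, (1 : G))).D := by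
    refine le_of_mem hK (p₂_le _) fun x _ => mem_p₂.2 ⟨g * x * g⁻¹, (hD _ _).2 (by group)⟩
  obtain ⟨a, b⟩ := h₂ K hKm hK'
  have e : rstar ((diag (A := A) G).conj (g, (1 : G))).D (hK'.trans (p₂_le _)) =
      FinGrp.conj hK g := by
    refine eq_of_mem (rstar_le _ _) (conj_le _ _) fun x => ?_
    rw [mem_rstar, mem_conj_iff]
    constructor
    · rintro ⟨l, hl⟩
      rw [(hD _ _).1 hl]
      exact l.2
    · intro hx
      exact ⟨⟨_, hx⟩, (hD _ _).2 rfl⟩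
  refine ⟨e ▸ a, ?_⟩
  rw [star_diagR, res_res] at b
  have b' := res_mem_congr X b e rfl (conj_le _ _) hK
  convert b' using 1
  refine ext' ?_ fun _ _ _ => rfl
  rintro ⟨x, y⟩
  change conjInv hK g x = y ↔
    (incl (conj_le hK g) x, incl hK y) ∈ ((diag (A := A) G).conj (g, (1 : G))).D
  rw [hD, ← incl_conjInv]
  exact (incl_injective hK).eq_iff.symm

lemma conj_mem_aux' (h : X.AxiomsItoIII) (h8 : X.AxiomVIII) (hG : G ∈ X.𝒢)
    (hKm : K ∈ X.𝒢) (hK : K ≤ G) (g : G) :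
    ((diag (A := A) G).conj ((1 : G), g)).res hK (conj_le hK g) ∈ X.S K (FinGrp.conj hK g) := by
  have h₁ := h.conj_mem G hG G hG _ (h.diag_mem G hG) (1, g)
  have hD : ∀ x y : G, (x, y) ∈ ((diag (A := A) G).conj ((1 : G), g)).D ↔ x = g⁻¹ * y * g := by
    intro x y
    rw [mem_conj_D]
    change 1⁻¹ * x * 1 = g⁻¹ * y * g ↔ _
    simp
  obtain ⟨-, h₂⟩ := h8 _ hG _ hG _ h₁
  have hK' : K ≤ p₁ ((diag (A := A) G).conj ((1 : G), g)).D := by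
    refine le_of_mem hK (p₁_le _) fun x _ => mem_p₁.2 ⟨g * x * g⁻¹, (hD _ _).2 (by group)⟩
  obtain ⟨a, b⟩ := h₂ K hKm hK'
  have e : lstar (hK'.trans (p₁_le _)) ((diag (A := A) G).conj ((1 : G), g)).D =
      FinGrp.conj hK g := by
    refine eq_of_mem (lstar_le _ _) (conj_le _ _) fun x => ?_
    rw [mem_lstar, mem_conj_iff]
    constructor
    · rintro ⟨l, hl⟩
      rw [← (hD _ _).1 hl]
      exact l.2
    · intro hx
      exact ⟨⟨_, hx⟩, (hD _ _).2 rfl⟩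
  rw [star_diagL, res_res] at b
  exact res_mem_congr X b rfl e hK (conj_le _ _)

theorem plus_axioms (h : X.AxiomsItoIII) (h7 : X.AxiomVII) (h8 : X.AxiomVIII)
    (hI : X.ClosedUnderInter) : X.plus.AxiomsItoIII where
  diag_mem G hG := by
    have e₁ : p₁ (diag (A := A) G).D = G :=
      eq_of_mem (p₁_le _) le_rfl fun g => ⟨fun _ => g.2, fun _ => mem_p₁.2 ⟨g, rfl⟩⟩
    have e₂ : p₂ (diag (A := A) G).D = G :=
      eq_of_mem (p₂_le _) le_rfl fun g => ⟨fun _ => g.2, fun _ => mem_p₂.2 ⟨g, rfl⟩⟩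
    refine ⟨e₁.symm ▸ hG, e₂.symm ▸ hG, ?_⟩
    have := h.diag_mem G hG
    rw [← res_self (diag G)] at this
    exact res_mem_congr X this e₁.symm e₂.symm _ _
  conj_mem G hG H hH p hp x := by
    obtain ⟨g, y⟩ := x
    obtain ⟨h₁, h₂, h₃⟩ := hp
    obtain ⟨a₁, b₁⟩ := conj_mem_aux h h7 hG h₁ (p₁_le p.D) g
    obtain ⟨a₂, -⟩ := conj_mem_aux h h7 hH h₂ (p₂_le p.D) y
    have b₂ := conj_mem_aux' h h8 hH h₂ (p₂_le p.D) y
    have hD : ∀ u v, (u, v) ∈ (p.conj (g, y)).D ↔ (g⁻¹ * u * g, y⁻¹ * v * y) ∈ p.D :=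
      fun u v => mem_conj_D
    have hD' : ∀ u v : H,
        (u, v) ∈ ((diag (A := A) H).conj ((1 : H), y)).D ↔ u = y⁻¹ * v * y := by
      intro u v
      rw [mem_conj_D]
      change 1⁻¹ * u * 1 = y⁻¹ * v * y ↔ _
      simp
    have e₁ : FinGrp.conj (p₁_le p.D) g = p₁ (p.conj (g, y)).D := by
      refine eq_of_mem (conj_le _ _) (p₁_le _) fun u => ?_
      rw [mem_conj_iff, mem_p₁, mem_p₁]
      constructor
      · rintro ⟨v, hv⟩
        refine ⟨y * v * y⁻¹, (hD _ _).2 ?_⟩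
        have : y⁻¹ * (y * v * y⁻¹) * y = v := by group
        rwa [this]
      · rintro ⟨v, hv⟩
        exact ⟨_, (hD _ _).1 hv⟩
    have e₂ : FinGrp.conj (p₂_le p.D) y = p₂ (p.conj (g, y)).D := by
      refine eq_of_mem (conj_le _ _) (p₂_le _) fun u => ?_
      rw [mem_conj_iff, mem_p₂, mem_p₂]
      constructor
      · rintro ⟨v, hv⟩
        refine ⟨g * v * g⁻¹, (hD _ _).2 ?_⟩
        have : g⁻¹ * (g * v * g⁻¹) * g = v := by group
        rwa [this]
      · rintro ⟨v, hv⟩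
        exact ⟨_, (hD _ _).1 hv⟩
    refine ⟨e₁ ▸ a₁, e₂ ▸ a₂, ?_⟩
    have c₁ : Compat (graph (A := A) (conjInv (p₁_le p.D) g))
        (p.res (p₁_le p.D) (p₂_le p.D)) := by
      intro z z₂ z₁
      have e : z = 1 := ((map_one (conjInv (p₁_le p.D) g)).symm.trans z₂).symm
      subst e
      exact (map_one _).trans (map_one (φ₁ _)).symm
    have s₁ := h.star_mem _ a₁ _ h₁ _ h₂ _ b₁ _ h₃ c₁
    have c₂ : Compat (star _ _ c₁) (((diag (A := A) H).conj ((1 : H), y)).res (p₂_le p.D)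
        (conj_le (p₂_le p.D) y)) := by
      intro z z₂ z₁
      have z₁' := (hD' _ _).1 z₁
      have e : z = 1 := by
        apply incl_injective (p₂_le p.D)
        rw [map_one]
        exact z₁'.trans (by simp)
      subst e
      exact (map_one (φ₂ _)).trans (map_one (φ₁ _)).symm
    have s₂ := h.star_mem _ a₁ _ h₂ _ a₂ _ s₁ _ b₂ c₂
    have key : star _ _ c₂ = (p.conj (g, y)).res (conj_le (p₁_le p.D) g)
        (conj_le (p₂_le p.D) y) := by
      refine ext' ?_ ?_
      · rintro ⟨u, v⟩
        constructor
        · rintro ⟨w, ⟨t, ht₁, ht₂⟩, hw⟩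
          have e1 : conjInv (p₁_le p.D) g u = t := ht₁
          have e2 := (hD' _ _).1 hw
          subst e1
          refine (hD _ _).2 ?_
          have ht₂ : (incl (p₁_le p.D) (conjInv (p₁_le p.D) g u), incl (p₂_le p.D) w) ∈ p.D := ht₂
          rw [incl_conjInv] at ht₂
          have e2 : incl (p₂_le p.D) w = _ := e2
          rw [e2] at ht₂
          exact ht₂
        · intro huv
          have huv := (hD _ _).1 huv
          refine ⟨⟨_, mem_p₂.2 ⟨_, huv⟩⟩, ⟨conjInv (p₁_le p.D) g u, rfl, ?_⟩, ?_⟩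
          · exact huv
          · exact (hD' _ _).2 rfl
      · rintro ⟨u, v⟩ i₁ i₂
        have huv := (hD _ _).1 i₂
        have j₁ : (u, conjInv (p₁_le p.D) g u) ∈ (graph (A := A) (conjInv (p₁_le p.D) g)).D := rfl
        have j₂ : (conjInv (p₁_le p.D) g u, (⟨_, mem_p₂.2 ⟨_, huv⟩⟩ : p₂ p.D)) ∈
            (p.res (p₁_le p.D) (p₂_le p.D)).D := huv
        have j₃ : ((⟨_, mem_p₂.2 ⟨_, huv⟩⟩ : p₂ p.D), v) ∈
            (((diag (A := A) H).conj ((1 : H), y)).res (p₂_le p.D)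
              (conj_le (p₂_le p.D) y)).D := (hD' _ _).2 rfl
        refine (star_apply c₂ (h := ⟨_, mem_p₂.2 ⟨_, huv⟩⟩)
          (show _ ∈ (star _ _ c₁).D from ⟨_, j₁, j₂⟩) j₃ i₁).trans ?_
        refine (congrArg (fun a => a * _) (star_apply c₁ j₁ j₂ _)).trans ?_
        refine Eq.trans ?_ (conj_φ i₂).symm
        refine (mul_one _).trans ((one_mul _).trans ?_)
        rfl
    rw [key] at s₂
    exact res_mem_congr X s₂ e₁ e₂ _ _
  star_mem G hG H hH K hK p hp q hq c := by
    have hQ := hI H hH _ hp.2.1 _ hq.1 (p₂_le p.D) (p₁_le q.D)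
    have memQ : ∀ y : H, (y : V) ∈ (inter (p₂_le p.D) (p₁_le q.D)).carrier ↔
        (∃ g, (g, y) ∈ p.D) ∧ ∃ k, (y, k) ∈ q.D := by
      intro y
      rw [inter, mem_sub, ← mem_p₂, ← mem_p₁]
      constructor
      · rintro ⟨⟨a, ha⟩, ⟨b, hb⟩⟩
        exact ⟨ha ▸ a.2, hb ▸ b.2⟩
      · rintro ⟨a, b⟩
        exact ⟨⟨⟨_, a⟩, rfl⟩, ⟨⟨_, b⟩, rfl⟩⟩
    have Q₂ : inter (p₂_le p.D) (p₁_le q.D) ≤ p₂ p.D :=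
      le_of_mem (sub_le _ _) (p₂_le _) fun y hy => mem_p₂.2 ((memQ y).1 hy).1
    have Q₁ : inter (p₂_le p.D) (p₁_le q.D) ≤ p₁ q.D :=
      le_of_mem (sub_le _ _) (p₁_le _) fun y hy => mem_p₁.2 ((memQ y).1 hy).2
    obtain ⟨a₁, b₁⟩ := rstar_mem h7 hp hQ Q₂
    obtain ⟨a₂, b₂⟩ := lstar_mem h8 hq hQ Q₁
    have c' : Compat
        (p.res (rstar_le p.D (Q₂.trans (p₂_le p.D))) (Q₂.trans (p₂_le p.D)))
        (q.res (Q₁.trans (p₁_le q.D)) (lstar_le (Q₁.trans (p₁_le q.D)) q.D)) :=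
      fun z z₂ z₁ => c (incl (sub_le _ _) z) z₂ z₁
    have s := h.star_mem _ a₁ _ hQ _ a₂ _ b₁ _ b₂ c'
    have key : star _ _ c' = (star p q c).res (rstar_le p.D (Q₂.trans (p₂_le p.D)))
        (lstar_le (Q₁.trans (p₁_le q.D)) q.D) := by
      refine ext' ?_ ?_
      · rintro ⟨u, v⟩
        constructor
        · rintro ⟨w, h₁, h₂⟩
          exact ⟨incl (sub_le _ _) w, h₁, h₂⟩
        · rintro ⟨w, h₁, h₂⟩
          exact ⟨⟨w, (memQ w).2 ⟨⟨_, h₁⟩, ⟨_, h₂⟩⟩⟩, h₁, h₂⟩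
      · rintro ⟨u, v⟩ i₁ i₂
        obtain ⟨w, h₁, h₂⟩ := id i₁
        refine (star_apply c' h₁ h₂ i₁).trans ?_
        exact (star_apply c (h := incl (sub_le _ _) w) h₁ h₂ i₂).symm
    rw [key] at s
    have e₁ : rstar p.D (Q₂.trans (p₂_le p.D)) = p₁ (star p q c).D := by
      refine eq_of_mem (rstar_le _ _) (p₁_le _) fun u => ?_
      rw [mem_rstar, mem_p₁]
      constructor
      · rintro ⟨y, hy⟩
        obtain ⟨k, hk⟩ := ((memQ (incl (sub_le _ _) y)).1 y.2).2
        exact ⟨k, _, hy, hk⟩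
      · rintro ⟨k, y, hy, hk⟩
        exact ⟨⟨y, (memQ y).2 ⟨⟨_, hy⟩, ⟨_, hk⟩⟩⟩, hy⟩
    have e₂ : lstar (Q₁.trans (p₁_le q.D)) q.D = p₂ (star p q c).D := by
      refine eq_of_mem (lstar_le _ _) (p₂_le _) fun u => ?_
      rw [mem_lstar, mem_p₂]
      constructor
      · rintro ⟨y, hy⟩
        obtain ⟨k, hk⟩ := ((memQ (incl (sub_le _ _) y)).1 y.2).1
        exact ⟨k, _, hk, hy⟩
      · rintro ⟨k, y, hy, hk⟩
        exact ⟨⟨y, (memQ y).2 ⟨⟨_, hy⟩, ⟨_, hk⟩⟩⟩, hk⟩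
    exact ⟨e₁ ▸ a₁, e₂ ▸ a₂, res_mem_congr X s e₁ e₂ _ _⟩

end Lemmas

end Datum

/-! ## `A`-fibered sets and bisets -/

/-- An `A`-fibered `Γ`-set: a set with commuting actions of `Γ` and `A` (that is, a
`Γ × A`-set), free as an `A`-set and with finitely many `A`-orbits. An `A`-fibered
`(G, H)`-biset is an `A`-fibered `G × H`-set; its right `H`-action is `x h = (1, h⁻¹) x`. -/
structure FibSet (Γ A : Type u) [Group Γ] [CommGroup A] where
  carrier : Type u
  [actΓ : MulAction Γ carrier]
  [actA : MulAction A carrier]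
  [comm : SMulCommClass Γ A carrier]
  free : ∀ (a b : A) (x : carrier), a • x = b • x → a = b
  fin : Finite (MulAction.orbitRel.Quotient A carrier)

attribute [instance] FibSet.actΓ FibSet.actA FibSet.comm

namespace FibSet

variable {Γ A : Type u} [Group Γ] [CommGroup A]

instance : CoeSort (FibSet Γ A) (Type u) := ⟨FibSet.carrier⟩

/-- Isomorphisms of `A`-fibered `Γ`-sets: equivariant bijections. -/
structure Iso (X Y : FibSet Γ A) where
  e : X ≃ Y
  map_Γ : ∀ (γ : Γ) x, e (γ • x) = γ • e x
  map_A : ∀ (a : A) x, e (a • x) = a • e x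

instance setoid (Γ A : Type u) [Group Γ] [CommGroup A] : Setoid (FibSet Γ A) where
  r X Y := Nonempty (Iso X Y)
  iseqv :=
    { refl := fun X => ⟨⟨Equiv.refl X, fun _ _ => rfl, fun _ _ => rfl⟩⟩
      symm := fun ⟨f⟩ => ⟨⟨f.e.symm, fun γ x => by rw [Equiv.symm_apply_eq, f.map_Γ]; simp,
        fun γ x => by rw [Equiv.symm_apply_eq, f.map_A]; simp⟩⟩
      trans := fun ⟨f⟩ ⟨g⟩ => ⟨⟨f.e.trans g.e, fun γ x => by simp [f.map_Γ, g.map_Γ],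
        fun γ x => by simp [f.map_A, g.map_A]⟩⟩ }

/-- An isomorphism from an equivariant one-to-one correspondence. -/
lemma iso_of_rel {X Y : FibSet Γ A} (r : X → Y → Prop) (h₁ : ∀ x, ∃ y, r x y)
    (h₂ : ∀ y, ∃ x, r x y) (h₃ : ∀ x y x' y', r x y → r x' y' → (x = x' ↔ y = y'))
    (h₄ : ∀ (γ : Γ) x y, r x y → r (γ • x) (γ • y)) (h₅ : ∀ (a : A) x y, r x y → r (a • x) (a • y)) :
    X ≈ Y := by
  choose f hf using h₁
  refine ⟨⟨Equiv.ofBijective f ⟨fun x x' h => (h₃ _ _ _ _ (hf x) (hf x')).2 h, fun y => ?_⟩,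
    fun γ x => ?_, fun a x => ?_⟩⟩
  · obtain ⟨x, hx⟩ := h₂ y
    exact ⟨x, (h₃ _ _ _ _ (hf x) hx).1 rfl⟩
  · exact (h₃ _ _ _ _ (hf _) (h₄ γ _ _ (hf x))).1 rfl
  · exact (h₃ _ _ _ _ (hf _) (h₅ a _ _ (hf x))).1 rfl

lemma A_smul_comm (X : FibSet Γ A) (a : A) (γ : Γ) (x : X) : a • γ • x = γ • a • x :=
  (smul_comm γ a x).symm

lemma exists_reps (X : FibSet Γ A) : ∃ s : Set X, s.Finite ∧ ∀ x, ∃ y ∈ s, ∃ a : A, x = a • y := by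
  have := X.fin
  refine ⟨Set.range (fun o : MulAction.orbitRel.Quotient A X => o.out), Set.finite_range _,
    fun x => ?_⟩
  refine ⟨_, ⟨Quotient.mk'' x, rfl⟩, ?_⟩
  have h : (MulAction.orbitRel A X) x (Quotient.mk'' x : MulAction.orbitRel.Quotient A X).out :=
    Quotient.exact (Quotient.out_eq' _).symm
  obtain ⟨a, ha⟩ := h
  exact ⟨a, ha.symm⟩

lemma fin_of_reps {X : Type u} [MulAction A X] (s : Set X) (hs : s.Finite)
    (h : ∀ x, ∃ y ∈ s, ∃ a : A, x = a • y) : Finite (MulAction.orbitRel.Quotient A X) := by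
  have := hs.to_subtype
  refine Finite.of_surjective
    (fun y : s => (Quotient.mk'' y.1 : MulAction.orbitRel.Quotient A X)) fun o => ?_
  induction o using Quotient.inductionOn' with
  | h x =>
    obtain ⟨y, hy, a, ha⟩ := h x
    exact ⟨⟨y, hy⟩, Quotient.sound' ⟨a⁻¹, by simp [ha]⟩⟩

/-- The unique action on the empty type. -/
abbrev emptyAct (Γ : Type u) [Group Γ] : MulAction Γ PEmpty.{u + 1} where
  smul _ x := x
  one_smul _ := rfl
  mul_smul _ _ _ := rfl

/-- The empty `A`-fibered set. -/
def empty (Γ A : Type u) [Group Γ] [CommGroup A] : FibSet Γ A where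
  carrier := PEmpty
  actΓ := emptyAct Γ
  actA := emptyAct A
  comm := by
    let _ := emptyAct Γ
    let _ := emptyAct A
    exact ⟨fun _ _ x => x.elim⟩
  free _ _ x := x.elim
  fin := by
    let _ := emptyAct A
    exact fin_of_reps ∅ Set.finite_empty fun x => x.elim

/-- The disjoint union of two `A`-fibered sets. -/
def sum (X Y : FibSet Γ A) : FibSet Γ A where
  carrier := X ⊕ Y
  actΓ :=
    { smul := fun γ => Sum.map (γ • ·) (γ • ·)
      one_smul := by rintro (x | x) <;> simp [HSMul.hSMul, SMul.smul] <;> exact one_smul _ _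
      mul_smul := by rintro a b (x | x) <;> simp [HSMul.hSMul, SMul.smul] <;> exact mul_smul _ _ _ }
  actA :=
    { smul := fun γ => Sum.map (γ • ·) (γ • ·)
      one_smul := by rintro (x | x) <;> simp [HSMul.hSMul, SMul.smul] <;> exact one_smul _ _
      mul_smul := by rintro a b (x | x) <;> simp [HSMul.hSMul, SMul.smul] <;> exact mul_smul _ _ _ }
  comm := ⟨by
    rintro γ a (x | x)
    · exact congrArg Sum.inl (smul_comm γ a x)
    · exact congrArg Sum.inr (smul_comm γ a x)⟩
  free := by
    rintro a b (x | x) h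
    · exact X.free a b x (Sum.inl_injective h)
    · exact Y.free a b x (Sum.inr_injective h)
  fin := by
    obtain ⟨s, hs, h⟩ := X.exists_reps
    obtain ⟨t, ht, h'⟩ := Y.exists_reps
    refine @fin_of_reps A _ _ (_) (Sum.inl '' s ∪ Sum.inr '' t)
      ((hs.image _).union (ht.image _)) ?_
    rintro (x | x)
    · obtain ⟨y, hy, a, ha⟩ := h x
      exact ⟨_, Or.inl ⟨y, hy, rfl⟩, a, congrArg Sum.inl ha⟩
    · obtain ⟨y, hy, a, ha⟩ := h' x
      exact ⟨_, Or.inr ⟨y, hy, rfl⟩, a, congrArg Sum.inr ha⟩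

/-! ### Stabilizing pairs and transitive fibered sets -/

/-- The stabilizer `Γ_x` of the `A`-orbit of `x`. -/
def stabD (X : FibSet Γ A) (x : X) : Subgroup Γ where
  carrier := {γ | ∃ a : A, γ • x = a • x}
  one_mem' := ⟨1, by simp⟩
  mul_mem' := by
    rintro γ δ ⟨a, ha⟩ ⟨b, hb⟩
    exact ⟨a * b, by rw [mul_smul, hb, smul_comm, ha, smul_smul, mul_comm]⟩
  inv_mem' := by
    rintro γ ⟨a, ha⟩
    exact ⟨a⁻¹, by rw [inv_smul_eq_iff, smul_comm, ha, inv_smul_smul]⟩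

lemma stab_mul (X : FibSet Γ A) {x : X} {γ δ : Γ} {a b c : A} (h₁ : γ • x = a • x)
    (h₂ : δ • x = b • x) (h₃ : (γ * δ) • x = c • x) : c = a * b := by
  apply X.free _ _ x
  rw [← h₃, mul_smul, h₂, smul_comm, h₁, smul_smul, mul_comm]

/-- The stabilizing pair `(Γ_x, φ_x)` of `x`, where `γ x = φ_x(γ) x` for `γ ∈ Γ_x`. -/
def stab (X : FibSet Γ A) (x : X) : MPair Γ A where
  D := X.stabD x
  φ := MonoidHom.mk' (fun γ => γ.2.choose) (fun γ δ =>
    X.stab_mul γ.2.choose_spec δ.2.choose_spec (γ * δ).2.choose_spec)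

lemma stab_spec {X : FibSet Γ A} {x : X} {γ : Γ} (h : γ ∈ (X.stab x).D) :
    γ • x = (X.stab x).φ ⟨γ, h⟩ • x := h.choose_spec

lemma stab_eq {X : FibSet Γ A} {x : X} {γ : Γ} {a : A} (h : γ • x = a • x)
    (h' : γ ∈ (X.stab x).D) : (X.stab x).φ ⟨γ, h'⟩ = a :=
  X.free _ _ x ((stab_spec h').symm.trans h)

lemma stab_smul_A (X : FibSet Γ A) (x : X) (a : A) : X.stab (a • x) = X.stab x := by
  have key : ∀ (γ : Γ) (b : A), γ • a • x = b • a • x ↔ γ • x = b • x := by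
    intro γ b
    rw [smul_comm γ a x, smul_comm b a x, smul_left_cancel_iff]
  refine MPair.ext' (fun γ => exists_congr fun b => key γ b) fun γ h h' => ?_
  exact stab_eq ((key _ _).2 (stab_spec h')) h

lemma stab_smul (X : FibSet Γ A) (x : X) (δ : Γ) : X.stab (δ • x) = (X.stab x).conj δ := by
  have key : ∀ (γ : Γ) (b : A), γ • δ • x = b • δ • x ↔ (δ⁻¹ * γ * δ) • x = b • x := by
    intro γ b
    rw [mul_smul, mul_smul, inv_smul_eq_iff, smul_comm δ b x]
  refine MPair.ext' (fun γ => ?_) fun γ h h' => ?_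
  · rw [Datum.mem_conj_D]
    exact exists_congr fun b => key γ b
  · rw [Datum.conj_φ h']
    exact stab_eq ((key _ _).2 (stab_spec _)) h

/-- The subgroup `{(γ, φ(γ)⁻¹) ∣ γ ∈ D}` of `Γ × A`. -/
def transN (p : MPair Γ A) : Subgroup (Γ × A) where
  carrier := {x | ∃ h : x.1 ∈ p.D, x.2 = (p.φ ⟨x.1, h⟩)⁻¹}
  one_mem' := ⟨p.D.one_mem, by
    change (1 : A) = (p.φ 1)⁻¹
    simp⟩
  mul_mem' := by
    rintro x y ⟨h, hx⟩ ⟨h', hy⟩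
    refine ⟨p.D.mul_mem h h', ?_⟩
    change x.2 * y.2 = (p.φ (⟨_, h⟩ * ⟨_, h'⟩))⁻¹
    rw [map_mul, hx, hy, mul_inv]
  inv_mem' := by
    rintro x ⟨h, hx⟩
    refine ⟨p.D.inv_mem h, ?_⟩
    change x.2⁻¹ = (p.φ (⟨_, h⟩⁻¹))⁻¹
    rw [map_inv, hx]

/-- The action of `Γ` on `(Γ × A) / {(γ, φ(γ)⁻¹)}` by left multiplication. -/
abbrev transActΓ (p : MPair Γ A) : MulAction Γ ((Γ × A) ⧸ transN p) :=
  MulAction.compHom _ (MonoidHom.inl Γ A)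

/-- The action of `A` on `(Γ × A) / {(γ, φ(γ)⁻¹)}` by multiplication. -/
abbrev transActA (p : MPair Γ A) : MulAction A ((Γ × A) ⧸ transN p) :=
  MulAction.compHom _ (MonoidHom.inr Γ A)

/-- The transitive `A`-fibered `Γ`-set `Γ / (D, φ) = (Γ × A) / {(γ, φ(γ)⁻¹) ∣ γ ∈ D}`,
with the action by left multiplication. -/
def trans [Finite Γ] (p : MPair Γ A) : FibSet Γ A where
  carrier := (Γ × A) ⧸ transN p
  actΓ := transActΓ p
  actA := transActA p
  comm := by
    let _ := transActΓ p
    let _ := transActA p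
    refine ⟨fun γ a x => ?_⟩
    change ((γ, 1) : Γ × A) • ((1, a) : Γ × A) • x = ((1, a) : Γ × A) • ((γ, 1) : Γ × A) • x
    rw [smul_smul, smul_smul]
    simp
  free a b x h := by
    have h : ((1, a) : Γ × A) • x = ((1, b) : Γ × A) • x := h
    induction x using QuotientGroup.induction_on with
    | H z =>
      have h := QuotientGroup.eq.1 h
      have e : (((1, a) : Γ × A) • z)⁻¹ * ((1, b) : Γ × A) • z = (1, a⁻¹ * b) := by
        ext
        · simp
        · simp [mul_comm, mul_assoc]
      rw [e] at h
      obtain ⟨h₁, h₂⟩ := h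
      have h₂ : a⁻¹ * b = (p.φ 1)⁻¹ := h₂
      rw [map_one, inv_one, inv_mul_eq_one] at h₂
      exact h₂
  fin := by
    let _ := transActA p
    refine fin_of_reps (Set.range fun γ : Γ => (QuotientGroup.mk (γ, 1) : (Γ × A) ⧸ transN p))
      (Set.finite_range _) fun x => ?_
    induction x using QuotientGroup.induction_on with
    | H z =>
      refine ⟨_, ⟨z.1, rfl⟩, z.2, ?_⟩
      change _ = QuotientGroup.mk (((1, z.2) : Γ × A) * (z.1, 1))
      simp

section Trans

variable [Finite Γ]

/-- The base point of `Γ / (D, φ)`. -/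
def base (p : MPair Γ A) : trans p := (QuotientGroup.mk 1 : (Γ × A) ⧸ transN p)

lemma exists_base (p : MPair Γ A) (x : trans p) : ∃ (γ : Γ) (a : A), x = γ • a • base p := by
  induction x using QuotientGroup.induction_on with
  | H z =>
    refine ⟨z.1, z.2, ?_⟩
    change _ = QuotientGroup.mk (((z.1, 1) : Γ × A) * (((1, z.2) : Γ × A) * 1))
    simp

lemma smul_base_iff (p : MPair Γ A) (γ : Γ) (a : A) :
    γ • base p = a • base p ↔ ∃ h : γ ∈ p.D, p.φ ⟨γ, h⟩ = a := by
  have : γ • base p = a • base p ↔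
      (((1, a) : Γ × A) * 1)⁻¹ * (((γ, 1) : Γ × A) * 1) ∈ transN p := by
    rw [← QuotientGroup.eq]
    exact eq_comm
  rw [this]
  have e : (((1, a) : Γ × A) * 1)⁻¹ * (((γ, 1) : Γ × A) * 1) = (γ, a⁻¹) := by
    ext <;> simp
  rw [e]
  constructor
  · rintro ⟨h, h'⟩
    exact ⟨h, (inv_injective h').symm⟩
  · rintro ⟨h, h'⟩
    exact ⟨h, congrArg _ h'.symm⟩

lemma stab_base (p : MPair Γ A) : (trans p).stab (base p) = p := by
  refine MPair.ext' (fun γ => ?_) fun γ h h' => ?_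
  · constructor
    · rintro ⟨a, ha⟩
      exact ((smul_base_iff p γ a).1 ha).1
    · intro h
      exact ⟨_, (smul_base_iff p γ _).2 ⟨h, rfl⟩⟩
  · exact stab_eq ((smul_base_iff p γ _).2 ⟨h', rfl⟩) h

lemma iso_trans (X : FibSet Γ A) (x : X) (hx : ∀ y : X, ∃ (γ : Γ) (a : A), y = γ • a • x) :
    X ≈ trans (X.stab x) := by
  have key : ∀ (γ γ' : Γ) (a a' : A) (Y : FibSet Γ A) (y : Y),
      γ • a • y = γ' • a' • y ↔ (γ'⁻¹ * γ) • y = (a⁻¹ * a') • y := by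
    intro γ γ' a a' Y y
    rw [mul_smul, mul_smul, inv_smul_eq_iff, smul_comm γ' a⁻¹, eq_inv_smul_iff, smul_comm γ a]
  refine iso_of_rel (fun u v => ∃ (γ : Γ) (a : A), u = γ • a • x ∧ v = γ • a • base _) ?_ ?_ ?_
    ?_ ?_
  · intro u
    obtain ⟨γ, a, h⟩ := hx u
    exact ⟨_, γ, a, h, rfl⟩
  · intro v
    obtain ⟨γ, a, h⟩ := exists_base _ v
    exact ⟨_, γ, a, rfl, h⟩
  · rintro _ _ _ _ ⟨γ, a, rfl, rfl⟩ ⟨γ', a', rfl, rfl⟩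
    rw [key, key, smul_base_iff]
    constructor
    · intro h
      exact ⟨⟨_, h⟩, stab_eq h _⟩
    · rintro ⟨h, h'⟩
      rw [← h']
      exact stab_spec h
  · rintro δ _ _ ⟨γ, a, rfl, rfl⟩
    exact ⟨δ * γ, a, (mul_smul _ _ _).symm, (mul_smul _ _ _).symm⟩
  · rintro b _ _ ⟨γ, a, rfl, rfl⟩
    exact ⟨γ, b * a, by rw [mul_smul, smul_comm γ b], by rw [mul_smul, smul_comm γ b]⟩

end Trans

/-! ### The tensor product `X ⊗_{AH} Y` -/

section Tensor

variable {G H K L : Type u} [Group G] [Group H] [Group K] [Group L]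

/-- `(x, y) ∼ (x (ha)⁻¹, h a y)` for `h ∈ H`, `a ∈ A`; the classes are the `H × A`-orbits
on `X × Y`. -/
def tensorRel (X : FibSet (G × H) A) (Y : FibSet (H × K) A) : Setoid (X × Y) where
  r x y := ∃ (h : H) (a : A),
    y = (((1, h) : G × H) • a⁻¹ • x.1, ((h, 1) : H × K) • a • x.2)
  iseqv :=
    { refl := fun x => ⟨1, 1, by ext <;> simp [← Prod.one_eq_mk]⟩
      symm := by
        rintro x _ ⟨h, a, rfl⟩
        refine ⟨h⁻¹, a⁻¹, Prod.ext ?_ ?_⟩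
        · simp [A_smul_comm, smul_smul, ← Prod.one_eq_mk]
        · simp [A_smul_comm, smul_smul, ← Prod.one_eq_mk]
      trans := by
        rintro x _ _ ⟨h, a, rfl⟩ ⟨h', a', rfl⟩
        refine ⟨h' * h, a' * a, Prod.ext ?_ ?_⟩
        · simp [A_smul_comm, smul_smul, mul_comm]
        · simp [A_smul_comm, smul_smul] }

/-- The set of `H × A`-orbits on `X × Y`. -/
abbrev PreTensor (X : FibSet (G × H) A) (Y : FibSet (H × K) A) : Type u :=
  Quotient (tensorRel X Y)

instance preTensorA (X : FibSet (G × H) A) (Y : FibSet (H × K) A) :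
    MulAction A (PreTensor X Y) where
  smul b := Quotient.map (fun x => (b • x.1, x.2)) (by
    rintro x _ ⟨h, a, rfl⟩
    refine ⟨h, a, Prod.ext ?_ rfl⟩
    simp [A_smul_comm, smul_smul, mul_comm])
  one_smul := by
    rintro ⟨x⟩
    exact congrArg (Quotient.mk _) (by ext <;> simp)
  mul_smul := by
    rintro b c ⟨x⟩
    exact congrArg (Quotient.mk _) (by ext <;> simp [mul_smul])

instance preTensorΓ (X : FibSet (G × H) A) (Y : FibSet (H × K) A) :
    MulAction (G × K) (PreTensor X Y) where
  smul γ := Quotient.map (fun x => (((γ.1, 1) : G × H) • x.1, ((1, γ.2) : H × K) • x.2)) (by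
    rintro x _ ⟨h, a, rfl⟩
    refine ⟨h, a, Prod.ext ?_ ?_⟩
    · simp [A_smul_comm, smul_smul]
    · simp [A_smul_comm, smul_smul])
  one_smul := by
    rintro ⟨x⟩
    exact congrArg (Quotient.mk _) (by ext <;> simp [← Prod.one_eq_mk])
  mul_smul := by
    rintro b c ⟨x⟩
    exact congrArg (Quotient.mk _) (by ext <;> simp [smul_smul])

lemma preTensor_mk_eq {X : FibSet (G × H) A} {Y : FibSet (H × K) A} {x x' : X} {y y' : Y} :
    (Quotient.mk (tensorRel X Y) (x, y) = Quotient.mk (tensorRel X Y) (x', y')) ↔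
      ∃ (h : H) (a : A), x' = ((1, h) : G × H) • a⁻¹ • x ∧ y' = ((h, 1) : H × K) • a • y := by
  rw [Quotient.eq]
  exact exists_congr fun h => exists_congr fun a => Prod.ext_iff

instance preTensorComm (X : FibSet (G × H) A) (Y : FibSet (H × K) A) :
    SMulCommClass (G × K) A (PreTensor X Y) where
  smul_comm := by
    rintro γ a ⟨x⟩
    exact congrArg (Quotient.mk _) (Prod.ext (smul_comm _ _ _) rfl)

/-- The `A`-free `H × A`-orbits on `X × Y`. -/
abbrev FreeOrbits (X : FibSet (G × H) A) (Y : FibSet (H × K) A) : Type u :=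
  {ω : PreTensor X Y // ∀ a : A, a • ω = ω → a = 1}

instance freeOrbitsΓ (X : FibSet (G × H) A) (Y : FibSet (H × K) A) :
    MulAction (G × K) (FreeOrbits X Y) where
  smul γ ω := ⟨γ • ω.1, fun a h => ω.2 a (by rwa [← smul_comm, smul_left_cancel_iff] at h)⟩
  one_smul ω := Subtype.ext (one_smul _ ω.1)
  mul_smul _ _ ω := Subtype.ext (mul_smul _ _ ω.1)

instance freeOrbitsA (X : FibSet (G × H) A) (Y : FibSet (H × K) A) :
    MulAction A (FreeOrbits X Y) where
  smul γ ω := ⟨γ • ω.1, fun a h => ω.2 a (by rwa [smul_comm, smul_left_cancel_iff] at h)⟩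
  one_smul ω := Subtype.ext (one_smul _ ω.1)
  mul_smul _ _ ω := Subtype.ext (mul_smul _ _ ω.1)

/-- The tensor product `X ⊗_{AH} Y`: the `H × A`-orbits on `X × Y` that are `A`-free under the
induced `A`-action, with `(g, k)(x ⊗ y) = (g, 1)x ⊗ (1, k)y`. -/
def tensor (X : FibSet (G × H) A) (Y : FibSet (H × K) A) : FibSet (G × K) A where
  carrier := FreeOrbits X Y
  comm := ⟨fun γ a ω => Subtype.ext (smul_comm γ a ω.1)⟩
  free a b ω h := by
    have h : a • ω.1 = b • ω.1 := congrArg Subtype.val h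
    rw [← inv_smul_eq_iff, smul_smul] at h
    exact (inv_mul_eq_one.1 (ω.2 _ h)).symm
  fin := by
    obtain ⟨s, hs, h⟩ := X.exists_reps
    obtain ⟨t, ht, h'⟩ := Y.exists_reps
    refine @fin_of_reps A _ _ (_) (Subtype.val ⁻¹' (Quotient.mk (tensorRel X Y) '' (s ×ˢ t)))
      (((hs.prod ht).image _).preimage Subtype.val_injective.injOn) ?_
    rintro ⟨⟨x, y⟩, hω⟩
    obtain ⟨x', hx', a, rfl⟩ := h x
    obtain ⟨y', hy', b, rfl⟩ := h' y
    have e : Quotient.mk (tensorRel X Y) (a • x', b • y') =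
        (a * b) • Quotient.mk (tensorRel X Y) (x', y') := by
      refine preTensor_mk_eq.2 ⟨1, b⁻¹, ?_⟩
      simp [← Prod.one_eq_mk, smul_smul, mul_comm]
    have e : Quot.mk _ (a • x', b • y') = (a * b) • Quotient.mk (tensorRel X Y) (x', y') := e
    refine ⟨⟨Quotient.mk (tensorRel X Y) (x', y'), fun c hc => hω c ?_⟩,
      ⟨(x', y'), ⟨hx', hy'⟩, rfl⟩, a * b, Subtype.ext e⟩
    rw [e, smul_comm, hc]

end Tensor

end FibSet

namespace FibSet

variable {Γ A : Type u} [Group Γ] [CommGroup A]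

section TensorLemmas

variable {G H K L : Type u} [Group G] [Group H] [Group K] [Group L]
variable {X X' : FibSet (G × H) A} {Y Y' : FibSet (H × K) A} {Z : FibSet (K × L) A}

lemma mk_eq_mk {x x' : X} {y y' : Y} :
    (Quotient.mk (tensorRel X Y) (x, y) = Quotient.mk (tensorRel X Y) (x', y')) ↔
      ∃ (h : H) (a : A), a • x' = ((1, h) : G × H) • x ∧ y' = a • ((h, 1) : H × K) • y := by
  rw [preTensor_mk_eq]
  refine exists_congr fun h => exists_congr fun a => ?_
  rw [← A_smul_comm, eq_inv_smul_iff, A_smul_comm Y]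

/-- The condition that the orbit of `(x, y)` is `A`-free. -/
def Free (x : X) (y : Y) : Prop :=
  ∀ (h : H) (a b : A), ((1, h) : G × H) • x = a • x → ((h, 1) : H × K) • y = b • y → a * b = 1

lemma free_iff (x : X) (y : Y) :
    Free x y ↔ ∀ a : A, a • Quotient.mk (tensorRel X Y) (x, y) = Quotient.mk _ (x, y) → a = 1 := by
  have key : ∀ a : A, (a • Quotient.mk (tensorRel X Y) (x, y) = Quotient.mk _ (x, y)) ↔
      ∃ (h : H) (b : A), b • x = ((1, h) : G × H) • a • x ∧ y = b • ((h, 1) : H × K) • y :=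
    fun a => mk_eq_mk (x := a • x) (y := y)
  constructor
  · intro hf a ha
    obtain ⟨h, b, h₁, h₂⟩ := (key a).1 ha
    have := hf h (a⁻¹ * b) b⁻¹ (by rw [mul_smul, h₁, ← A_smul_comm, inv_smul_smul])
      (by rw [eq_inv_smul_iff]; exact h₂.symm)
    rw [mul_inv_cancel_right, inv_eq_one] at this
    exact this
  · intro hf h a b h₁ h₂
    have := hf (a * b)⁻¹ ((key _).2 ⟨h, b⁻¹, by
      rw [← A_smul_comm, h₁, smul_smul]; simp, by rw [h₂, inv_smul_smul]⟩)
    exact inv_eq_one.1 this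

/-- The element `x ⊗ y`. -/
def tmk (x : X) (y : Y) (h : Free x y) : tensor X Y :=
  (⟨Quotient.mk _ (x, y), (free_iff x y).1 h⟩ : FreeOrbits X Y)

lemma exists_tmk (ω : tensor X Y) : ∃ (x : X) (y : Y) (h : Free x y), ω = tmk x y h := by
  obtain ⟨⟨x, y⟩, h⟩ := ω
  exact ⟨x, y, (free_iff x y).2 h, rfl⟩

lemma tmk_eq {x x' : X} {y y' : Y} {h : Free x y} {h' : Free x' y'} :
    tmk x y h = tmk x' y' h' ↔
      ∃ (h : H) (a : A), a • x' = ((1, h) : G × H) • x ∧ y' = a • ((h, 1) : H × K) • y := by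
  rw [← mk_eq_mk]
  exact Subtype.ext_iff

lemma smul_tmk (g : G) (k : K) (x : X) (y : Y) (h : Free x y) :
    ∃ h', ((g, k) : G × K) • tmk x y h =
      tmk (((g, 1) : G × H) • x) (((1, k) : H × K) • y) h' :=
  ⟨(free_iff _ _).2 (((g, k) : G × K) • tmk x y h).2, rfl⟩

lemma smul_tmk_A (a : A) (x : X) (y : Y) (h : Free x y) :
    ∃ h', a • tmk x y h = tmk (a • x) y h' :=
  ⟨(free_iff _ _).2 (a • tmk x y h).2, rfl⟩

lemma smul_tmk_eq {g : G} {k : K} {a : A} {x : X} {y : Y} {h : Free x y} :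
    ((g, k) : G × K) • tmk x y h = a • tmk x y h ↔
      ∃ (h : H) (b c : A), ((g, h) : G × H) • x = b • x ∧ ((h, k) : H × K) • y = c • y ∧
        b * c = a := by
  obtain ⟨h₁, e₁⟩ := smul_tmk g k x y h
  obtain ⟨h₂, e₂⟩ := smul_tmk_A a x y h
  rw [e₁, e₂, tmk_eq]
  refine exists_congr fun h => ?_
  rw [smul_smul, smul_smul]
  simp only [Prod.mk_mul_mk, one_mul, mul_one]
  constructor
  · rintro ⟨b, h₁, h₂⟩
    refine ⟨b * a, b⁻¹, ?_, ?_, by simp [mul_comm]⟩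
    · rw [mul_smul, h₁]
    · rw [eq_inv_smul_iff]
      exact h₂.symm
  · rintro ⟨b, c, f₁, f₂, rfl⟩
    refine ⟨c⁻¹, ?_, ?_⟩
    · rw [f₁, smul_smul]
      simp
    · rw [f₂, inv_smul_smul]

/-- The stabilizing pair of `x ⊗ y` is the product of those of `x` and `y`. -/
lemma stab_tmk {x : X} {y : Y} (h : Free x y) :
    ∃ c : MPair.Compat (X.stab x) (Y.stab y),
      (tensor X Y).stab (tmk x y h) = MPair.star (X.stab x) (Y.stab y) c := by
  have c : MPair.Compat (X.stab x) (Y.stab y) := fun z h₂ h₁ => by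
    have := h z _ _ (stab_spec (X := X) h₂) (stab_spec (X := Y) h₁)
    exact inv_eq_of_mul_eq_one_right this
  refine ⟨c, MPair.ext' ?_ ?_⟩
  · rintro ⟨g, k⟩
    constructor
    · rintro ⟨a, ha⟩
      obtain ⟨z, b, b', h₁, h₂, -⟩ := smul_tmk_eq.1 ha
      exact ⟨z, ⟨b, h₁⟩, ⟨b', h₂⟩⟩
    · rintro ⟨z, ⟨b, h₁⟩, ⟨b', h₂⟩⟩
      exact ⟨b * b', smul_tmk_eq.2 ⟨z, b, b', h₁, h₂, rfl⟩⟩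
  · rintro ⟨g, k⟩ i₁ i₂
    obtain ⟨z, h₁, h₂⟩ := id i₂
    refine (stab_eq (smul_tmk_eq.2 ⟨z, _, _, stab_spec h₁, stab_spec h₂, rfl⟩) i₁).trans ?_
    exact (MPair.star_apply c h₁ h₂ i₂).symm

lemma iso_free (f : Iso X X') (g : Iso Y Y') {x : X} {y : Y} :
    Free (f.e x) (g.e y) ↔ Free x y := by
  simp only [Free, ← f.map_Γ, ← f.map_A, ← g.map_Γ, ← g.map_A, f.e.apply_eq_iff_eq,
    g.e.apply_eq_iff_eq]

lemma tensor_congr (hX : X ≈ X') (hY : Y ≈ Y') : tensor X Y ≈ tensor X' Y' := by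
  obtain ⟨f⟩ := hX
  obtain ⟨g⟩ := hY
  refine iso_of_rel (fun ω ω' => ∃ x y h h', ω = tmk x y h ∧ ω' = tmk (f.e x) (g.e y) h')
    ?_ ?_ ?_ ?_ ?_
  · intro ω
    obtain ⟨x, y, h, rfl⟩ := exists_tmk ω
    exact ⟨_, x, y, h, (iso_free f g).2 h, rfl, rfl⟩
  · intro ω
    obtain ⟨x, y, h, rfl⟩ := exists_tmk ω
    obtain ⟨x, rfl⟩ := f.e.surjective x
    obtain ⟨y, rfl⟩ := g.e.surjective y
    exact ⟨_, x, y, (iso_free f g).1 h, h, rfl, rfl⟩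
  · rintro _ _ _ _ ⟨x, y, h, h', rfl, rfl⟩ ⟨z, w, i, i', rfl, rfl⟩
    rw [tmk_eq, tmk_eq]
    simp only [← f.map_Γ, ← f.map_A, ← g.map_Γ, ← g.map_A, f.e.apply_eq_iff_eq,
      g.e.apply_eq_iff_eq]
  · rintro ⟨γ, k⟩ _ _ ⟨x, y, h, h', rfl, rfl⟩
    obtain ⟨h₁, e₁⟩ := smul_tmk γ k x y h
    obtain ⟨h₂, e₂⟩ := smul_tmk γ k _ _ h'
    refine ⟨_, _, h₁, (iso_free f g).2 h₁, e₁, ?_⟩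
    rw [e₂]
    simp only [f.map_Γ, g.map_Γ]
  · rintro a _ _ ⟨x, y, h, h', rfl, rfl⟩
    obtain ⟨h₁, e₁⟩ := smul_tmk_A a x y h
    obtain ⟨h₂, e₂⟩ := smul_tmk_A a _ _ h'
    refine ⟨_, _, h₁, (iso_free f g).2 h₁, e₁, ?_⟩
    rw [e₂]
    simp only [f.map_A]

lemma tensor_assoc : tensor (tensor X Y) Z ≈ tensor X (tensor Y Z) := by
  have F₁ : ∀ (x : X) (y : Y) (z : Z) (h : Free x y), Free (tmk x y h) z ↔
      ∀ (h : H) (k : K) (a b c : A), ((1, h) : G × H) • x = a • x → ((h, k) : H × K) • y = b • y →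
        ((k, 1) : K × L) • z = c • z → a * b * c = 1 := by
    intro x y z h
    simp only [Free, smul_tmk_eq]
    constructor
    · intro f h k a b c h₁ h₂ h₃
      exact f k _ c ⟨h, a, b, h₁, h₂, rfl⟩ h₃
    · rintro f k _ c ⟨h, a, b, h₁, h₂, rfl⟩ h₃
      exact f h k a b c h₁ h₂ h₃
  have F₂ : ∀ (x : X) (y : Y) (z : Z) (h : Free y z), Free x (tmk y z h) ↔
      ∀ (h : H) (k : K) (a b c : A), ((1, h) : G × H) • x = a • x → ((h, k) : H × K) • y = b • y →
        ((k, 1) : K × L) • z = c • z → a * b * c = 1 := by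
    intro x y z h
    simp only [Free, smul_tmk_eq]
    constructor
    · intro f h k a b c h₁ h₂ h₃
      rw [mul_assoc]
      exact f h a _ h₁ ⟨k, b, c, h₂, h₃, rfl⟩
    · rintro f h a _ h₁ ⟨k, b, c, h₂, h₃, rfl⟩
      rw [← mul_assoc]
      exact f h k a b c h₁ h₂ h₃
  have one_X : ∀ x : X, ((1, 1) : G × H) • x = (1 : A) • x := fun x => by
    rw [one_smul]; exact one_smul _ x
  have one_Z : ∀ x : Z, ((1, 1) : K × L) • x = (1 : A) • x := fun x => by
    rw [one_smul]; exact one_smul _ x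
  refine iso_of_rel (fun ω ω' => ∃ x y z h₁ h₂ h₃ h₄,
    ω = tmk (tmk x y h₁) z h₂ ∧ ω' = tmk x (tmk y z h₃) h₄) ?_ ?_ ?_ ?_ ?_
  · intro ω
    obtain ⟨ω, z, h₂, rfl⟩ := exists_tmk ω
    obtain ⟨x, y, h₁, rfl⟩ := exists_tmk ω
    have h := (F₁ x y z h₁).1 h₂
    have h₃ : Free y z := fun k b c e₁ e₂ => by
      simpa using h 1 k 1 b c (one_X x) e₁ e₂
    exact ⟨_, x, y, z, h₁, h₂, h₃, (F₂ x y z h₃).2 h, rfl, rfl⟩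
  · intro ω
    obtain ⟨x, ω, h₄, rfl⟩ := exists_tmk ω
    obtain ⟨y, z, h₃, rfl⟩ := exists_tmk ω
    have h := (F₂ x y z h₃).1 h₄
    have h₁ : Free x y := fun k b c e₁ e₂ => by
      simpa using h k 1 b c 1 e₁ e₂ (one_Z z)
    exact ⟨_, x, y, z, h₁, (F₁ x y z h₁).2 h, h₃, h₄, rfl, rfl⟩
  · rintro _ _ _ _ ⟨x, y, z, h₁, h₂, h₃, h₄, rfl, rfl⟩ ⟨x', y', z', h₁', h₂', h₃', h₄', rfl, rfl⟩
    rw [tmk_eq, tmk_eq]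
    constructor
    · rintro ⟨k, a, e, rfl⟩
      obtain ⟨i, e₁⟩ := smul_tmk_A a x' y' h₁'
      obtain ⟨j, e₂⟩ := smul_tmk 1 k x y h₁
      rw [e₁, e₂, eq_comm, tmk_eq] at e
      obtain ⟨h, b, e₃, rfl⟩ := e
      refine ⟨h, a * b, ?_, ?_⟩
      · rw [mul_comm, mul_smul, e₃, smul_smul]
        simp
      · obtain ⟨j', e₄⟩ := smul_tmk h 1 y z h₃
        obtain ⟨j'', e₅⟩ := smul_tmk_A (a * b) _ _ j'
        rw [e₄, e₅, eq_comm, tmk_eq]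
        refine ⟨k, a, ?_, ?_⟩
        · simp [A_smul_comm, smul_smul]
        · simp [smul_smul]
    · rintro ⟨h, c, e, e'⟩
      obtain ⟨j', e₄⟩ := smul_tmk h 1 y z h₃
      obtain ⟨j'', e₅⟩ := smul_tmk_A c _ _ j'
      rw [e₄, e₅, eq_comm, tmk_eq] at e'
      obtain ⟨k, a, e₁, rfl⟩ := e'
      refine ⟨k, a, ?_, ?_⟩
      · obtain ⟨i, e₂⟩ := smul_tmk_A a x' y' h₁'
        obtain ⟨j, e₃⟩ := smul_tmk 1 k x y h₁
        rw [e₂, e₃, eq_comm, tmk_eq]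
        refine ⟨h, a⁻¹ * c, ?_, ?_⟩
        · rw [smul_smul, mul_comm, mul_inv_cancel_left, e, smul_smul]
          simp
        · rw [mul_smul, eq_inv_smul_iff, e₁]
          simp [A_smul_comm, smul_smul]
      · simp [smul_smul]
  · rintro ⟨g, l⟩ _ _ ⟨x, y, z, h₁, h₂, h₃, h₄, rfl, rfl⟩
    obtain ⟨i₁, e₁⟩ := smul_tmk g l _ _ h₂
    obtain ⟨i₂, e₂⟩ := smul_tmk g 1 _ _ h₁
    obtain ⟨i₃, e₃⟩ := smul_tmk g l _ _ h₄
    obtain ⟨i₄, e₄⟩ := smul_tmk 1 l _ _ h₃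
    have hy : ((1, 1) : H × K) • y = y := one_smul _ y
    simp only [e₂, e₄, hy] at e₁ e₃ i₁ i₂ i₃ i₄
    exact ⟨_, _, _, i₂, i₁, i₄, i₃, e₁, e₃⟩
  · rintro a _ _ ⟨x, y, z, h₁, h₂, h₃, h₄, rfl, rfl⟩
    obtain ⟨i₁, e₁⟩ := smul_tmk_A a _ _ h₂
    obtain ⟨i₂, e₂⟩ := smul_tmk_A a _ _ h₁
    obtain ⟨i₃, e₃⟩ := smul_tmk_A a _ _ h₄
    simp only [e₂] at e₁ i₁ i₂
    exact ⟨_, _, _, i₂, i₁, h₃, i₃, e₁, e₃⟩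

end TensorLemmas

end FibSet

namespace FibSet

variable {Γ A : Type u} [Group Γ] [CommGroup A]

section TensorLemmas

variable {G H K : Type u} [Group G] [Group H] [Group K]

lemma diag_base_left [Finite G] (g h : G) (a : A) :
    ((g, h) : G × G) • base (MPair.diag (A := A) G) = a • base _ ↔ g = h ∧ a = 1 := by
  rw [smul_base_iff]
  constructor
  · rintro ⟨h, h'⟩
    exact ⟨h, h'.symm⟩
  · rintro ⟨h, h'⟩
    exact ⟨h, h'.symm⟩

lemma exists_diag_base [Finite G] (x : trans (MPair.diag (A := A) G)) :
    (∃ (g : G) (a : A), x = ((1, g) : G × G) • a • base _) ∧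
      ∃ (g : G) (a : A), x = ((g, 1) : G × G) • a • base _ := by
  obtain ⟨⟨g, h⟩, a, rfl⟩ := exists_base _ x
  have key : ∀ (g h k l m n : G), k⁻¹ * g = l⁻¹ * h →
      ((g, h) : G × G) • a • base (MPair.diag (A := A) G) = ((k, l) : G × G) • a • base _ := by
    intro g h k l m n e
    have : (((k, l) : G × G)⁻¹ * (g, h)) • base (MPair.diag (A := A) G) = (1 : A) • base _ := by
      exact (diag_base_left _ _ _).2 ⟨e, rfl⟩
    rw [mul_smul, inv_smul_eq_iff, one_smul] at this
    rw [← A_smul_comm, this, A_smul_comm]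
  exact ⟨⟨h * g⁻¹, a, key _ _ _ _ 1 1 (by group)⟩, ⟨g * h⁻¹, a, key _ _ _ _ 1 1 (by group)⟩⟩

lemma tensor_unit_left [Finite G] (X : FibSet (G × H) A) :
    tensor (trans (MPair.diag (A := A) G)) X ≈ X := by
  have one_X : ∀ x : X, ((1, 1) : G × H) • x = x := one_smul _
  have F : ∀ x : X, Free (base (MPair.diag (A := A) G)) x := by
    intro x h a b h₁ h₂
    obtain ⟨rfl, rfl⟩ := (diag_base_left _ _ _).1 h₁
    rw [one_X] at h₂
    rw [one_mul]
    exact X.free b 1 x (by rw [one_smul]; exact h₂.symm)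
  have E : ∀ (g : G) (x y : X) (h h'), tmk (((g, 1) : G × G) • base (MPair.diag (A := A) G)) x h =
      tmk (base _) y h' ↔ y = ((g, 1) : G × H) • x := by
    intro g x y h h'
    rw [tmk_eq]
    constructor
    · rintro ⟨h, a, h₁, rfl⟩
      rw [smul_smul, eq_comm, Prod.mk_mul_mk, one_mul, mul_one, diag_base_left] at h₁
      obtain ⟨rfl, rfl⟩ := h₁
      rw [one_smul]
    · rintro rfl
      refine ⟨g, 1, ?_, by rw [one_smul]⟩
      rw [smul_smul, eq_comm, Prod.mk_mul_mk, one_mul, mul_one, diag_base_left]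
      exact ⟨rfl, rfl⟩
  have hb : ((1, 1) : G × G) • base (MPair.diag (A := A) G) = base _ := one_smul _ _
  refine iso_of_rel (fun ω x => ω = tmk (base _) x (F x)) ?_ ?_ ?_ ?_ ?_
  · intro ω
    obtain ⟨z, x, h, rfl⟩ := exists_tmk ω
    obtain ⟨-, g, a, rfl⟩ := exists_diag_base z
    refine ⟨a • ((g, 1) : G × H) • x, ?_⟩
    rw [tmk_eq]
    refine ⟨g, a, ?_, rfl⟩
    rw [← A_smul_comm, ← A_smul_comm]
    congr 1
    rw [smul_smul, eq_comm, Prod.mk_mul_mk, one_mul, mul_one]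
    have := (diag_base_left g g (1 : A)).2 ⟨rfl, rfl⟩
    rwa [one_smul] at this
  · exact fun x => ⟨_, rfl⟩
  · rintro _ x _ y rfl rfl
    have := E 1 x y
    rw [hb, one_X] at this
    exact (this (F x) (F y)).trans eq_comm
  · rintro ⟨g, k⟩ _ x rfl
    obtain ⟨i, e⟩ := smul_tmk g k _ _ (F x)
    rw [e, E, smul_smul]
    simp
  · rintro a _ x rfl
    obtain ⟨i, e⟩ := smul_tmk_A a _ _ (F x)
    rw [e, tmk_eq]
    refine ⟨1, a, ?_, ?_⟩
    · exact (one_smul _ _).symm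
    · rw [one_X]

lemma tensor_unit_right [Finite H] (X : FibSet (G × H) A) :
    tensor X (trans (MPair.diag (A := A) H)) ≈ X := by
  have one_X : ∀ x : X, ((1, 1) : G × H) • x = x := one_smul _
  have F : ∀ x : X, Free x (base (MPair.diag (A := A) H)) := by
    intro x h a b h₁ h₂
    obtain ⟨rfl, rfl⟩ := (diag_base_left _ _ _).1 h₂
    rw [one_X] at h₁
    rw [mul_one]
    exact X.free a 1 x (by rw [one_smul]; exact h₁.symm)
  have hb : ((1, 1) : H × H) • base (MPair.diag (A := A) H) = base _ := one_smul _ _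
  refine iso_of_rel (fun ω x => ω = tmk x (base _) (F x)) ?_ ?_ ?_ ?_ ?_
  · intro ω
    obtain ⟨x, z, h, rfl⟩ := exists_tmk ω
    obtain ⟨-, g, a, rfl⟩ := exists_diag_base z
    refine ⟨a • ((1, g⁻¹) : G × H) • x, ?_⟩
    rw [tmk_eq]
    refine ⟨g⁻¹, a⁻¹, ?_, ?_⟩
    · rw [inv_smul_smul]
    · rw [smul_smul, Prod.mk_mul_mk, inv_mul_cancel, one_mul]
      rw [← A_smul_comm, inv_smul_smul]
      exact hb.symm
  · exact fun x => ⟨_, rfl⟩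
  · rintro _ x _ y rfl rfl
    rw [tmk_eq]
    constructor
    · rintro ⟨h, a, h₁, h₂⟩
      rw [eq_comm, ← eq_inv_smul_iff, diag_base_left] at h₂
      obtain ⟨rfl, h₂⟩ := h₂
      rw [one_X, inv_eq_one.1 h₂, one_smul] at h₁
      exact h₁.symm
    · rintro rfl
      exact ⟨1, 1, by rw [one_X, one_smul], by rw [hb, one_smul]⟩
  · rintro ⟨g, k⟩ _ x rfl
    obtain ⟨i, e⟩ := smul_tmk g k _ _ (F x)
    rw [e, tmk_eq]
    refine ⟨k, 1, ?_, ?_⟩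
    · rw [smul_smul, one_smul]
      simp
    · rw [smul_smul, one_smul, eq_comm]
      have := (diag_base_left k k (1 : A)).2 ⟨rfl, rfl⟩
      rw [one_smul] at this
      simpa using this
  · rintro a _ x rfl
    obtain ⟨i, e⟩ := smul_tmk_A a _ _ (F x)
    exact e

/-! ### Compatibility with disjoint unions -/

variable {X X' : FibSet (G × H) A} {Y Y' : FibSet (H × K) A}

/-- The two inclusions into a disjoint union. -/
def inl {X Y : FibSet Γ A} (x : X) : sum X Y := (Sum.inl x : X.carrier ⊕ Y.carrier)
/-- The two inclusions into a disjoint union. -/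
def inr {X Y : FibSet Γ A} (y : Y) : sum X Y := (Sum.inr y : X.carrier ⊕ Y.carrier)

section SumBasics
variable {P Q : FibSet Γ A}

lemma inl_inj {x x' : P} : (inl x : sum P Q) = inl x' ↔ x = x' := Sum.inl_injective.eq_iff
lemma inr_inj {x x' : Q} : (inr x : sum P Q) = inr x' ↔ x = x' := Sum.inr_injective.eq_iff
lemma inl_ne_inr {x : P} {y : Q} : (inl x : sum P Q) ≠ inr y := Sum.inl_ne_inr
lemma inr_ne_inl {x : P} {y : Q} : (inr y : sum P Q) ≠ inl x := Sum.inr_ne_inl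
lemma smul_inl (γ : Γ) (x : P) : γ • (inl x : sum P Q) = inl (γ • x) := rfl
lemma smul_inr (γ : Γ) (x : Q) : γ • (inr x : sum P Q) = inr (γ • x) := rfl
lemma smul_inl_A (γ : A) (x : P) : γ • (inl x : sum P Q) = inl (γ • x) := rfl
lemma smul_inr_A (γ : A) (x : Q) : γ • (inr x : sum P Q) = inr (γ • x) := rfl
lemma sum_cases (z : sum P Q) : (∃ x, z = inl x) ∨ ∃ y, z = inr y := by
  rcases z with x | y
  · exact Or.inl ⟨x, rfl⟩
  · exact Or.inr ⟨y, rfl⟩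

lemma sum_congr {P' Q' : FibSet Γ A} (h : P ≈ P') (h' : Q ≈ Q') : sum P Q ≈ sum P' Q' := by
  obtain ⟨f⟩ := h
  obtain ⟨g⟩ := h'
  refine ⟨⟨Equiv.sumCongr f.e g.e, ?_, ?_⟩⟩
  · rintro γ (x | x)
    · exact congrArg Sum.inl (f.map_Γ γ x)
    · exact congrArg Sum.inr (g.map_Γ γ x)
  · rintro γ (x | x)
    · exact congrArg Sum.inl (f.map_A γ x)
    · exact congrArg Sum.inr (g.map_A γ x)

lemma sum_comm : sum P Q ≈ sum Q P := by
  refine ⟨⟨Equiv.sumComm P.carrier Q.carrier, ?_, ?_⟩⟩ <;> rintro γ (x | x) <;> rfl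

lemma sum_assoc {S : FibSet Γ A} : sum (sum P Q) S ≈ sum P (sum Q S) := by
  refine ⟨⟨Equiv.sumAssoc P.carrier Q.carrier S.carrier, ?_, ?_⟩⟩ <;>
    rintro γ ((x | x) | x) <;> rfl

lemma empty_sum : sum (empty Γ A) P ≈ P := by
  refine ⟨⟨Equiv.emptySum PEmpty P.carrier, ?_, ?_⟩⟩ <;> rintro γ (x | x) <;>
    first | exact x.elim | rfl

end SumBasics

lemma tensor_sum_left : tensor (sum X X') Y ≈ sum (tensor X Y) (tensor X' Y) := by
  have F₁ : ∀ (x : X) (y : Y), Free (inl x : sum X X') y ↔ Free x y := by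
    intro x y
    simp only [Free, smul_inl, smul_inl_A, inl_inj]
  have F₂ : ∀ (x : X') (y : Y), Free (inr x : sum X X') y ↔ Free x y := by
    intro x y
    simp only [Free, smul_inr, smul_inr_A, inr_inj]
  refine iso_of_rel (fun ω z => (∃ x y h h', ω = tmk (inl x) y h ∧ z = inl (tmk x y h')) ∨
    ∃ x y h h', ω = tmk (inr x) y h ∧ z = inr (tmk x y h')) ?_ ?_ ?_ ?_ ?_
  · intro ω
    obtain ⟨z, y, h, rfl⟩ := exists_tmk ω
    obtain ⟨x, rfl⟩ | ⟨x, rfl⟩ := sum_cases z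
    · exact ⟨_, Or.inl ⟨x, y, h, (F₁ x y).1 h, rfl, rfl⟩⟩
    · exact ⟨_, Or.inr ⟨x, y, h, (F₂ x y).1 h, rfl, rfl⟩⟩
  · intro z
    obtain ⟨ω, rfl⟩ | ⟨ω, rfl⟩ := sum_cases z
    · obtain ⟨x, y, h, rfl⟩ := exists_tmk ω
      exact ⟨_, Or.inl ⟨x, y, (F₁ x y).2 h, h, rfl, rfl⟩⟩
    · obtain ⟨x, y, h, rfl⟩ := exists_tmk ω
      exact ⟨_, Or.inr ⟨x, y, (F₂ x y).2 h, h, rfl, rfl⟩⟩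
  · rintro _ _ _ _ (⟨x, y, h, h', rfl, rfl⟩ | ⟨x, y, h, h', rfl, rfl⟩)
      (⟨x', y', i, i', rfl, rfl⟩ | ⟨x', y', i, i', rfl, rfl⟩) <;>
    simp only [tmk_eq, inl_inj, inr_inj, inl_ne_inr, inr_ne_inl, smul_inl, smul_inl_A, smul_inr,
      smul_inr_A, false_and, exists_false]
  · rintro ⟨g, k⟩ _ _ (⟨x, y, h, h', rfl, rfl⟩ | ⟨x, y, h, h', rfl, rfl⟩)
    · obtain ⟨i, e⟩ := smul_tmk g k _ _ h
      obtain ⟨i', e'⟩ := smul_tmk g k _ _ h'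
      exact Or.inl ⟨_, _, i, i', e, by rw [smul_inl, e']⟩
    · obtain ⟨i, e⟩ := smul_tmk g k _ _ h
      obtain ⟨i', e'⟩ := smul_tmk g k _ _ h'
      exact Or.inr ⟨_, _, i, i', e, by rw [smul_inr, e']⟩
  · rintro a _ _ (⟨x, y, h, h', rfl, rfl⟩ | ⟨x, y, h, h', rfl, rfl⟩)
    · obtain ⟨i, e⟩ := smul_tmk_A a _ _ h
      obtain ⟨i', e'⟩ := smul_tmk_A a _ _ h'
      exact Or.inl ⟨_, _, i, i', e, by rw [smul_inl_A, e']⟩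
    · obtain ⟨i, e⟩ := smul_tmk_A a _ _ h
      obtain ⟨i', e'⟩ := smul_tmk_A a _ _ h'
      exact Or.inr ⟨_, _, i, i', e, by rw [smul_inr_A, e']⟩

lemma tensor_sum_right : tensor X (sum Y Y') ≈ sum (tensor X Y) (tensor X Y') := by
  have F₁ : ∀ (x : X) (y : Y), Free x (inl y : sum Y Y') ↔ Free x y := by
    intro x y
    simp only [Free, smul_inl, smul_inl_A, inl_inj]
  have F₂ : ∀ (x : X) (y : Y'), Free x (inr y : sum Y Y') ↔ Free x y := by
    intro x y
    simp only [Free, smul_inr, smul_inr_A, inr_inj]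
  refine iso_of_rel (fun ω z => (∃ x y h h', ω = tmk x (inl y) h ∧ z = inl (tmk x y h')) ∨
    ∃ x y h h', ω = tmk x (inr y) h ∧ z = inr (tmk x y h')) ?_ ?_ ?_ ?_ ?_
  · intro ω
    obtain ⟨x, z, h, rfl⟩ := exists_tmk ω
    obtain ⟨y, rfl⟩ | ⟨y, rfl⟩ := sum_cases z
    · exact ⟨_, Or.inl ⟨x, y, h, (F₁ x y).1 h, rfl, rfl⟩⟩
    · exact ⟨_, Or.inr ⟨x, y, h, (F₂ x y).1 h, rfl, rfl⟩⟩
  · intro z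
    obtain ⟨ω, rfl⟩ | ⟨ω, rfl⟩ := sum_cases z
    · obtain ⟨x, y, h, rfl⟩ := exists_tmk ω
      exact ⟨_, Or.inl ⟨x, y, (F₁ x y).2 h, h, rfl, rfl⟩⟩
    · obtain ⟨x, y, h, rfl⟩ := exists_tmk ω
      exact ⟨_, Or.inr ⟨x, y, (F₂ x y).2 h, h, rfl, rfl⟩⟩
  · rintro _ _ _ _ (⟨x, y, h, h', rfl, rfl⟩ | ⟨x, y, h, h', rfl, rfl⟩)
      (⟨x', y', i, i', rfl, rfl⟩ | ⟨x', y', i, i', rfl, rfl⟩) <;>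
    simp only [tmk_eq, inl_inj, inr_inj, inl_ne_inr, inr_ne_inl, smul_inl, smul_inl_A, smul_inr,
      smul_inr_A, and_false, exists_false]
  · rintro ⟨g, k⟩ _ _ (⟨x, y, h, h', rfl, rfl⟩ | ⟨x, y, h, h', rfl, rfl⟩)
    · obtain ⟨i, e⟩ := smul_tmk g k _ _ h
      obtain ⟨i', e'⟩ := smul_tmk g k _ _ h'
      exact Or.inl ⟨_, _, i, i', e, by rw [smul_inl, e']⟩
    · obtain ⟨i, e⟩ := smul_tmk g k _ _ h
      obtain ⟨i', e'⟩ := smul_tmk g k _ _ h'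
      exact Or.inr ⟨_, _, i, i', e, by rw [smul_inr, e']⟩
  · rintro a _ _ (⟨x, y, h, h', rfl, rfl⟩ | ⟨x, y, h, h', rfl, rfl⟩)
    · obtain ⟨i, e⟩ := smul_tmk_A a _ _ h
      obtain ⟨i', e'⟩ := smul_tmk_A a _ _ h'
      exact Or.inl ⟨_, _, i, i', e, by rw [smul_inl_A, e']⟩
    · obtain ⟨i, e⟩ := smul_tmk_A a _ _ h
      obtain ⟨i', e'⟩ := smul_tmk_A a _ _ h'
      exact Or.inr ⟨_, _, i, i', e, by rw [smul_inr_A, e']⟩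

lemma iso_empty (X : FibSet Γ A) (h : IsEmpty X) : X ≈ empty Γ A :=
  iso_of_rel (fun _ _ => True) (fun x => h.elim x) (fun x => PEmpty.elim x) (fun x => h.elim x)
    (fun _ x => h.elim x) (fun _ x => h.elim x)

lemma tensor_empty_left : tensor (empty (G × H) A) Y ≈ empty (G × K) A :=
  iso_empty _ ⟨fun ω => by
    obtain ⟨x, y, h, rfl⟩ := exists_tmk ω
    exact PEmpty.elim x⟩

lemma tensor_empty_right : tensor X (empty (H × K) A) ≈ empty (G × K) A :=
  iso_empty _ ⟨fun ω => by
    obtain ⟨x, y, h, rfl⟩ := exists_tmk ω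
    exact PEmpty.elim y⟩

end TensorLemmas

/-! ### Decomposition into orbits -/

/-- The action on a stable subset. -/
abbrev restrictAct {Γ X : Type u} [Group Γ] [MulAction Γ X] (s : Set X)
    (h : ∀ (γ : Γ) x, x ∈ s → γ • x ∈ s) : MulAction Γ s where
  smul γ x := ⟨γ • x.1, h γ _ x.2⟩
  one_smul x := Subtype.ext (one_smul _ x.1)
  mul_smul _ _ x := Subtype.ext (mul_smul _ _ x.1)

/-- A subset of `X` that is stable under both actions. -/
def restrict (X : FibSet Γ A) (s : Set X) (h₁ : ∀ (γ : Γ) x, x ∈ s → γ • x ∈ s)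
    (h₂ : ∀ (a : A) x, x ∈ s → a • x ∈ s) : FibSet Γ A where
  carrier := s
  actΓ := restrictAct s h₁
  actA := restrictAct s h₂
  comm := by
    let _ := restrictAct s h₁
    let _ := restrictAct s h₂
    exact ⟨fun γ a x => Subtype.ext (smul_comm γ a x.1)⟩
  free a b x h := X.free a b x.1 (congrArg Subtype.val h)
  fin := by
    obtain ⟨t, ht, h⟩ := X.exists_reps
    refine @fin_of_reps A _ _ (_) (Subtype.val ⁻¹' t) (ht.preimage Subtype.val_injective.injOn) ?_
    intro x
    obtain ⟨y, hy, a, ha⟩ := h x.1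
    have hys : y ∈ s := by
      have := h₂ a⁻¹ _ x.2
      rwa [ha, inv_smul_smul] at this
    exact ⟨⟨y, hys⟩, hy, a, Subtype.ext ha⟩

lemma sum_restrict (X : FibSet Γ A) (s : Set X) (h₁ : ∀ (γ : Γ) x, x ∈ s → γ • x ∈ s)
    (h₂ : ∀ (a : A) x, x ∈ s → a • x ∈ s) (h₃ : ∀ (γ : Γ) x, x ∈ sᶜ → γ • x ∈ sᶜ)
    (h₄ : ∀ (a : A) x, x ∈ sᶜ → a • x ∈ sᶜ) :
    sum (X.restrict s h₁ h₂) (X.restrict sᶜ h₃ h₄) ≈ X := by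
  classical
  refine ⟨⟨Equiv.Set.sumCompl s, ?_, ?_⟩⟩ <;> rintro γ (x | x) <;> rfl

lemma stab_restrict (X : FibSet Γ A) (s : Set X) (h₁ : ∀ (γ : Γ) x, x ∈ s → γ • x ∈ s)
    (h₂ : ∀ (a : A) x, x ∈ s → a • x ∈ s) (x : X.restrict s h₁ h₂) :
    (X.restrict s h₁ h₂).stab x = X.stab x.1 := by
  have key : ∀ (γ : Γ) (a : A), γ • x = a • x ↔ γ • x.1 = a • x.1 := fun _ _ => Subtype.ext_iff
  refine MPair.ext' (fun γ => exists_congr fun a => key γ a) fun γ h h' => ?_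
  exact stab_eq ((key _ _).2 (stab_spec h')) h

/-! ### The Grothendieck group -/

/-- Isomorphism classes of `A`-fibered `Γ`-sets, an additive monoid under disjoint union. -/
def IsoCls (Γ A : Type u) [Group Γ] [CommGroup A] : Type (u + 1) := Quotient (setoid Γ A)

instance : Add (IsoCls Γ A) :=
  ⟨Quotient.map₂ sum (fun _ _ h _ _ h' => sum_congr h h')⟩

instance : Zero (IsoCls Γ A) := ⟨Quotient.mk _ (empty Γ A)⟩

instance : AddCommMonoid (IsoCls Γ A) where
  add_assoc := by
    rintro ⟨X⟩ ⟨Y⟩ ⟨Z⟩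
    exact Quotient.sound sum_assoc
  add_comm := by
    rintro ⟨X⟩ ⟨Y⟩
    exact Quotient.sound sum_comm
  zero_add := by
    rintro ⟨X⟩
    exact Quotient.sound empty_sum
  add_zero := by
    rintro ⟨X⟩
    exact Quotient.sound (Setoid.trans sum_comm empty_sum)
  nsmul := nsmulRec

/-- The isomorphism class of `X`. -/
def icls (X : FibSet Γ A) : IsoCls Γ A := Quotient.mk _ X

lemma icls_sum (X Y : FibSet Γ A) : icls (sum X Y) = icls X + icls Y := rfl

lemma icls_eq {X Y : FibSet Γ A} (h : X ≈ Y) : icls X = icls Y := Quotient.sound h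

variable (Γ A) in
/-- The `A`-fibered Burnside group `B^A(Γ)`: the Grothendieck group of `A`-fibered `Γ`-sets with
respect to disjoint union; `B^A(G, H)` is `B^A(G × H)`. -/
abbrev B : Type (u + 1) := Algebra.GrothendieckAddGroup (IsoCls Γ A)

/-- The tensor product on isomorphism classes. -/
def tensorCls {G H K : Type u} [Group G] [Group H] [Group K] :
    IsoCls (G × H) A →+ IsoCls (H × K) A →+ IsoCls (G × K) A where
  toFun x :=
    { toFun := fun y => Quotient.map₂ tensor (fun _ _ h _ _ h' => tensor_congr h h') x y
      map_zero' := by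
        obtain ⟨X⟩ := x
        exact Quotient.sound tensor_empty_right
      map_add' := by
        obtain ⟨X⟩ := x
        rintro ⟨Y⟩ ⟨Z⟩
        exact Quotient.sound tensor_sum_right }
  map_zero' := by
    ext ⟨Y⟩
    exact Quotient.sound tensor_empty_left
  map_add' := by
    rintro ⟨X⟩ ⟨X'⟩
    ext ⟨Y⟩
    exact Quotient.sound tensor_sum_left

open Algebra in
lemma lift_of {M N : Type*} [AddCommMonoid M] [AddCommGroup N] (f : M →+ N) (x : M) :
    GrothendieckAddGroup.lift f (GrothendieckAddGroup.of x) = f x :=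
  DFunLike.congr_fun (GrothendieckAddGroup.lift.symm_apply_apply f) x

open Algebra in
lemma groth_ext {M N : Type*} [AddCommMonoid M] [AddCommGroup N]
    {f g : GrothendieckAddGroup M →+ N}
    (h : ∀ x, f (GrothendieckAddGroup.of x) = g (GrothendieckAddGroup.of x)) : f = g :=
  GrothendieckAddGroup.lift.symm.injective (AddMonoidHom.ext h)

open Algebra in
/-- The biadditive map `B^A(G, H) × B^A(H, K) → B^A(G, K)` induced by the tensor product. -/
def tensorB {G H K : Type u} [Group G] [Group H] [Group K] :
    B (G × H) A →+ B (H × K) A →+ B (G × K) A :=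
  GrothendieckAddGroup.lift
    { toFun := fun x => GrothendieckAddGroup.lift (GrothendieckAddGroup.of.comp (tensorCls x))
      map_zero' := groth_ext fun y => by
        rw [lift_of, map_zero]
        exact map_zero GrothendieckAddGroup.of
      map_add' := fun x x' => groth_ext fun y => by
        rw [AddMonoidHom.add_apply, lift_of, lift_of, lift_of, map_add]
        exact map_add GrothendieckAddGroup.of _ _ }

variable (R : Type r) [CommRing R]

variable (Γ A) in
/-- `B^A_R(Γ) = R ⊗_ℤ B^A(Γ)`. -/
abbrev BR : Type (max (u + 1) r) := R ⊗[ℤ] B Γ A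

/-- The class `[X] = 1 ⊗ [X]` of `X` in `B^A_R(Γ)`. -/
def cls (X : FibSet Γ A) : BR Γ A R := (1 : R) ⊗ₜ[ℤ] Algebra.GrothendieckAddGroup.of (icls X)

/-- The `R`-bilinear map `B^A_R(G, H) × B^A_R(H, K) → B^A_R(G, K)` induced by the tensor
product. -/
def tensorR {G H K : Type u} [Group G] [Group H] [Group K] :
    BR (G × H) A R →ₗ[R] BR (H × K) A R →ₗ[R] BR (G × K) A R :=
  LinearMap.liftBaseChange R
    ((LinearMap.baseChangeHom ℤ R (B (H × K) A) (B (G × K) A)).comp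
      (AddMonoidHom.toIntLinearMap
        { toFun := fun b => (tensorB (G := G) (H := H) (K := K) b).toIntLinearMap
          map_zero' := by ext; simp
          map_add' := fun _ _ => by ext; simp }))

variable {R}

lemma cls_eq {X Y : FibSet Γ A} (h : X ≈ Y) : cls R X = cls R Y := by
  rw [cls, cls, icls_eq h]

lemma cls_sum (X Y : FibSet Γ A) : cls R (sum X Y) = cls R X + cls R Y := by
  rw [cls, icls_sum, map_add, TensorProduct.tmul_add]
  rfl

lemma cls_empty : cls R (empty Γ A) = 0 := by
  have : icls (empty Γ A) = 0 := rfl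
  rw [cls, this, map_zero, TensorProduct.tmul_zero]

lemma tensorR_cls {G H K : Type u} [Group G] [Group H] [Group K] (X : FibSet (G × H) A)
    (Y : FibSet (H × K) A) : tensorR R (cls R X) (cls R Y) = cls R (tensor X Y) := by
  have : tensorB (Algebra.GrothendieckAddGroup.of (icls X))
      (Algebra.GrothendieckAddGroup.of (icls Y)) =
      Algebra.GrothendieckAddGroup.of (icls (tensor X Y)) := by
    rw [tensorB, lift_of]
    exact lift_of _ _
  rw [cls, cls, tensorR, LinearMap.liftBaseChange_tmul, one_smul]
  exact congrArg (fun b => (1 : R) ⊗ₜ[ℤ] b) this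

lemma span_cls : Submodule.span R (Set.range (cls R : FibSet Γ A → BR Γ A R)) = ⊤ := by
  rw [eq_top_iff]
  rintro z -
  induction z using TensorProduct.induction_on with
  | zero => exact Submodule.zero_mem _
  | add x y hx hy => exact Submodule.add_mem _ hx hy
  | tmul c b =>
    have h : ∀ x : IsoCls Γ A, c ⊗ₜ[ℤ] Algebra.GrothendieckAddGroup.of x ∈
        Submodule.span R (Set.range (cls R : FibSet Γ A → BR Γ A R)) := by
      rintro ⟨X⟩
      have := Submodule.smul_mem (Submodule.span R (Set.range (cls R : FibSet Γ A → BR Γ A R)))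
        c (Submodule.subset_span ⟨X, rfl⟩)
      rw [cls, TensorProduct.smul_tmul', smul_eq_mul, mul_one] at this
      exact this
    have : ∃ x y : IsoCls Γ A, b = Algebra.GrothendieckAddGroup.of x -
        Algebra.GrothendieckAddGroup.of y := by
      induction b using AddLocalization.ind with
      | H p =>
        refine ⟨p.1, p.2, ?_⟩
        rw [eq_sub_iff_add_eq]
        rw [AddLocalization.mk_eq_addMonoidOf_mk']
        exact (AddLocalization.addMonoidOf ⊤).mk'_spec p.1 p.2
    obtain ⟨x, y, rfl⟩ := this
    rw [TensorProduct.tmul_sub]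
    exact Submodule.sub_mem _ (h x) (h y)

/-- If all stabilizing pairs of `X` lie in `T`, then `[X]` is a combination of the classes
`[Γ/(D, φ)]` with `(D, φ) ∈ T`. -/
lemma cls_mem_span [Finite Γ] (T : Set (MPair Γ A)) (X : FibSet Γ A) (hX : ∀ x, X.stab x ∈ T) :
    cls R X ∈ Submodule.span R ((fun p => cls R (trans p)) '' T) := by
  classical
  have main : ∀ (n : ℕ) (X : FibSet Γ A) (s : Finset X), s.card ≤ n →
      (∀ x, ∃ y ∈ s, ∃ a : A, x = a • y) → (∀ x, X.stab x ∈ T) →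
      cls R X ∈ Submodule.span R ((fun p => cls R (trans p)) '' T) := by
    intro n
    induction n with
    | zero =>
      intro X s hs h _
      have hE : IsEmpty X := ⟨fun x => by
        obtain ⟨y, hy, -⟩ := h x
        rw [Finset.card_eq_zero.1 (Nat.le_zero.1 hs)] at hy
        exact absurd hy (Finset.notMem_empty _)⟩
      rw [cls_eq (iso_empty X hE), cls_empty]
      exact Submodule.zero_mem _
    | succ n ih =>
      intro X s hs h hT
      by_cases hE : IsEmpty X
      · rw [cls_eq (iso_empty X hE), cls_empty]
        exact Submodule.zero_mem _
      · obtain ⟨x₀⟩ := not_isEmpty_iff.1 hE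
        obtain ⟨x, hx, -⟩ := h x₀
        let O : Set X := {y | ∃ (γ : Γ) (a : A), y = γ • a • x}
        have h₁ : ∀ (γ : Γ) y, y ∈ O → γ • y ∈ O := by
          rintro δ _ ⟨γ, a, rfl⟩
          exact ⟨δ * γ, a, (mul_smul _ _ _).symm⟩
        have h₂ : ∀ (a : A) y, y ∈ O → a • y ∈ O := by
          rintro b _ ⟨γ, a, rfl⟩
          exact ⟨γ, b * a, by rw [mul_smul, A_smul_comm]⟩
        have h₃ : ∀ (γ : Γ) y, y ∈ Oᶜ → γ • y ∈ Oᶜ := fun γ y hy hy' => hy (by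
          have := h₁ γ⁻¹ _ hy'
          rwa [inv_smul_smul] at this)
        have h₄ : ∀ (a : A) y, y ∈ Oᶜ → a • y ∈ Oᶜ := fun γ y hy hy' => hy (by
          have := h₂ γ⁻¹ _ hy'
          rwa [inv_smul_smul] at this)
        rw [← cls_eq (sum_restrict X O h₁ h₂ h₃ h₄), cls_sum]
        refine Submodule.add_mem _ ?_ ?_
        · have hxO : x ∈ O := ⟨1, 1, by rw [one_smul, one_smul]⟩
          have e := iso_trans (X.restrict O h₁ h₂) ⟨x, hxO⟩ (by
            rintro ⟨_, γ, a, rfl⟩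
            exact ⟨γ, a, rfl⟩)
          rw [cls_eq e]
          refine Submodule.subset_span ⟨_, ?_, rfl⟩
          exact (stab_restrict X O h₁ h₂ ⟨x, hxO⟩).symm ▸ hT x
        · refine ih (X.restrict Oᶜ h₃ h₄) (s.subtype (· ∈ Oᶜ)) ?_ ?_ ?_
          · refine (Finset.card_subtype _ _).trans_le ?_
            have : s.filter (· ∈ Oᶜ) ⊂ s := by
              refine Finset.filter_ssubset.2 ⟨x, hx, fun h => h ⟨1, 1, ?_⟩⟩
              rw [one_smul, one_smul]
            have := Finset.card_lt_card this
            omega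
          · rintro ⟨y, hy⟩
            obtain ⟨z, hz, a, rfl⟩ := h y
            have hzO : z ∈ Oᶜ := by
              have := h₄ a⁻¹ _ hy
              rwa [inv_smul_smul] at this
            exact ⟨⟨z, hzO⟩, Finset.mem_subtype.2 hz, a, rfl⟩
          · intro y
            rw [stab_restrict]
            exact hT _
  obtain ⟨s, hs, h⟩ := X.exists_reps
  exact main _ X hs.toFinset le_rfl (by simpa using h) hX

end FibSet

/-! ## The fibered biset category and the categories `𝒟 = 𝒞^A(𝒢, 𝒮)` -/

section Categories

open FinGrp MPair FibSet

variable {V A : Type u} [CommGroup A]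

lemma tensorR_assoc {R : Type r} [CommRing R] {G H K L : Type u} [Group G] [Group H] [Group K]
    [Group L] (a : BR (G × H) A R) (b : BR (H × K) A R) (c : BR (K × L) A R) :
    tensorR R (tensorR R a b) c = tensorR R a (tensorR R b c) := by
  have h₁ : ∀ x ∈ Submodule.span R (Set.range (cls R : FibSet (G × H) A → _)),
      ∀ y ∈ Submodule.span R (Set.range (cls R : FibSet (H × K) A → _)),
      ∀ z ∈ Submodule.span R (Set.range (cls R : FibSet (K × L) A → _)),
      tensorR R (tensorR R x y) z = tensorR R x (tensorR R y z) := by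
    intro x hx y hy z hz
    induction hx using Submodule.span_induction with
    | zero => simp
    | add _ _ _ _ h h' => simp [h, h']
    | smul _ _ _ h => simp [h]
    | mem x hx =>
      obtain ⟨X, rfl⟩ := hx
      induction hy using Submodule.span_induction with
      | zero => simp
      | add _ _ _ _ h h' => simp [h, h']
      | smul _ _ _ h => simp [h]
      | mem y hy =>
        obtain ⟨Y, rfl⟩ := hy
        induction hz using Submodule.span_induction with
        | zero => simp
        | add _ _ _ _ h h' => simp [h, h']
        | smul _ _ _ h => simp [h]
        | mem z hz =>
          obtain ⟨Z, rfl⟩ := hz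
          rw [tensorR_cls, tensorR_cls, tensorR_cls, tensorR_cls, cls_eq tensor_assoc]
  refine h₁ a ?_ b ?_ c ?_ <;> rw [span_cls] <;> exact Submodule.mem_top

lemma tensorR_unit_left {R : Type r} [CommRing R] {G H : Type u} [Group G] [Group H] [Finite G]
    (a : BR (G × H) A R) : tensorR R (cls R (trans (diag G))) a = a := by
  have h : ∀ x ∈ Submodule.span R (Set.range (cls R : FibSet (G × H) A → _)),
      tensorR R (cls R (trans (diag G))) x = x := by
    intro x hx
    induction hx using Submodule.span_induction with
    | zero => simp
    | add _ _ _ _ h h' => rw [map_add, h, h']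
    | smul _ _ _ h => rw [map_smul, h]
    | mem x hx =>
      obtain ⟨X, rfl⟩ := hx
      rw [tensorR_cls, cls_eq (tensor_unit_left X)]
  exact h a (by rw [span_cls]; exact Submodule.mem_top)

lemma tensorR_unit_right {R : Type r} [CommRing R] {G H : Type u} [Group G] [Group H] [Finite H]
    (a : BR (G × H) A R) : tensorR R a (cls R (trans (diag H))) = a := by
  have h : ∀ x ∈ Submodule.span R (Set.range (cls R : FibSet (G × H) A → _)),
      tensorR R x (cls R (trans (diag H))) = x := by
    intro x hx
    induction hx using Submodule.span_induction with
    | zero => simp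
    | add _ _ _ _ h h' => rw [map_add, LinearMap.add_apply, h, h']
    | smul _ _ _ h => rw [map_smul, LinearMap.smul_apply, h]
    | mem x hx =>
      obtain ⟨X, rfl⟩ := hx
      rw [tensorR_cls, cls_eq (tensor_unit_right X)]
  exact h a (by rw [span_cls]; exact Submodule.mem_top)

/-- The objects of the `A`-fibered biset category `𝒞^A_R`: finite groups. -/
@[ext]
structure CA (V _A : Type u) (_R : Type r) where
  grp : FinGrp V

/-- The `A`-fibered biset category `𝒞^A_R`: `Hom(H, G) = B^A_R(G, H)`, the composition is the
tensor product of `A`-fibered bisets, and the identity of `G` is `[(G × G)/(Δ(G), 1)]`. -/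
instance (R : Type r) [CommRing R] : Category (CA V A R) where
  Hom H G := BR (G.grp × H.grp) A R
  id G := cls R (trans (diag G.grp))
  comp f g := tensorR R g f
  id_comp f := tensorR_unit_right f
  comp_id f := tensorR_unit_left f
  assoc f g h := (tensorR_assoc h g f).symm

namespace Datum

variable (X : Datum V A) (R : Type r) [CommRing R]

/-- `Hom_𝒟(H, G) ⊆ B^A_R(G, H)`: the `R`-span of the classes `[(G × H)/(D, φ)]` with
`(D, φ) ∈ 𝒮(G, H)`. -/
def homD (G H : FinGrp V) : Submodule R (BR (G × H) A R) :=
  Submodule.span R ((fun p => cls R (trans p)) '' X.S G H)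

variable {X R}

lemma stab_mem (h : X.AxiomsItoIII) {G H : FinGrp V} (hG : G ∈ X.𝒢) (hH : H ∈ X.𝒢)
    {p : MPair (G × H) A} (hp : p ∈ X.S G H) (x : trans p) : (trans p).stab x ∈ X.S G H := by
  obtain ⟨γ, a, rfl⟩ := exists_base p x
  rw [stab_smul, stab_smul_A, stab_base]
  exact h.conj_mem G hG H hH p hp γ

lemma tensor_mem (h : X.AxiomsItoIII) {G H K : FinGrp V} (hG : G ∈ X.𝒢) (hH : H ∈ X.𝒢)
    (hK : K ∈ X.𝒢) {a : BR (G × H) A R} {b : BR (H × K) A R} (ha : a ∈ X.homD R G H)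
    (hb : b ∈ X.homD R H K) : tensorR R a b ∈ X.homD R G K := by
  induction ha using Submodule.span_induction with
  | zero => simp
  | add _ _ _ _ h h' => rw [map_add, LinearMap.add_apply]; exact Submodule.add_mem _ h h'
  | smul _ _ _ h => rw [map_smul, LinearMap.smul_apply]; exact Submodule.smul_mem _ _ h
  | mem x hx =>
    obtain ⟨p, hp, rfl⟩ := hx
    induction hb using Submodule.span_induction with
    | zero => simp
    | add _ _ _ _ h h' => rw [map_add]; exact Submodule.add_mem _ h h'
    | smul _ _ _ h => rw [map_smul]; exact Submodule.smul_mem _ _ h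
    | mem y hy =>
      obtain ⟨q, hq, rfl⟩ := hy
      change tensorR R (cls R (trans p)) (cls R (trans q)) ∈ _
      rw [tensorR_cls]
      refine cls_mem_span _ _ fun ω => ?_
      obtain ⟨x, y, hf, rfl⟩ := exists_tmk ω
      obtain ⟨c, e⟩ := stab_tmk hf
      rw [e]
      exact h.star_mem G hG H hH K hK _ (stab_mem h hG hH hp x) _ (stab_mem h hH hK hq y) c

/-- The objects of the category `𝒟 = 𝒞^A(𝒢, 𝒮)` over `R`: the groups in `𝒢`. -/
structure DCat (X : Datum V A) (R : Type r) (_h : X.AxiomsItoIII) where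
  grp : FinGrp V
  mem : grp ∈ X.𝒢

variable {h : X.AxiomsItoIII}

/-- The subcategory `𝒟 = 𝒞^A(𝒢, 𝒮)` of `𝒞^A_R`. -/
instance : Category (X.DCat R h) where
  Hom H G := X.homD R G.grp H.grp
  id G := ⟨𝟙 (⟨G.grp⟩ : CA V A R), Submodule.subset_span ⟨_, h.diag_mem _ G.mem, rfl⟩⟩
  comp {K H G} f g := ⟨show (⟨K.grp⟩ : CA V A R) ⟶ ⟨G.grp⟩ from
      (show (⟨K.grp⟩ : CA V A R) ⟶ ⟨H.grp⟩ from f.1) ≫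
      (show (⟨H.grp⟩ : CA V A R) ⟶ ⟨G.grp⟩ from g.1),
    tensor_mem h G.mem H.mem K.mem g.2 f.2⟩
  id_comp f := Subtype.ext (tensorR_unit_right f.1)
  comp_id f := Subtype.ext (tensorR_unit_left f.1)
  assoc f g h := Subtype.ext (tensorR_assoc h.1 g.1 f.1).symm

instance : Preadditive (X.DCat R h) where
  homGroup H G := inferInstanceAs (AddCommGroup (X.homD R G.grp H.grp))
  add_comp _ _ _ f f' g := Subtype.ext (map_add (tensorR R g.1) f.1 f'.1)
  comp_add _ _ _ f g g' := Subtype.ext (by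
    change tensorR R (g.1 + g'.1) f.1 = tensorR R g.1 f.1 + tensorR R g'.1 f.1
    rw [map_add, LinearMap.add_apply])

instance : Linear R (X.DCat R h) where
  homModule H G := inferInstanceAs (Module R (X.homD R G.grp H.grp))
  smul_comp _ _ _ c f g := Subtype.ext (map_smul (tensorR R g.1) c f.1)
  comp_smul _ _ _ f c g := Subtype.ext (by
    change tensorR R (c • g.1) f.1 = c • tensorR R g.1 f.1
    rw [map_smul, LinearMap.smul_apply])

/-- The morphism `[(G × H)/(D, φ)] : H → G` of `𝒟`, for `(D, φ) ∈ 𝒮(G, H)`. -/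
def mor {G H : FinGrp V} (hG : G ∈ X.𝒢) (hH : H ∈ X.𝒢) (p : MPair (G × H) A)
    (hp : p ∈ X.S G H) : (⟨H, hH⟩ : X.DCat R h) ⟶ ⟨G, hG⟩ :=
  ⟨cls R (trans p), Submodule.subset_span ⟨p, hp, rfl⟩⟩

/-- The morphism `[U] : H → G` of `𝒟`, for an `A`-fibered `(G, H)`-biset `U` all of whose
stabilizing pairs lie in `𝒮(G, H)`. -/
def morU {G H : X.DCat R h} (U : FibSet (G.grp × H.grp) A)
    (hU : ∀ u, U.stab u ∈ X.S G.grp H.grp) : H ⟶ G :=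
  ⟨cls R U, cls_mem_span _ U hU⟩

variable (X R h) in
/-- The category `ℱ_{𝒟,R}` of `A`-fibered biset functors on `𝒟` over `R`: the `R`-linear functors
from `𝒟` to `R`-modules, with natural transformations as morphisms. -/
abbrev FunctorCat : Type _ :=
  ObjectProperty.FullSubcategory
    (fun F : X.DCat R h ⥤ ModuleCat.{max u w} R => F.Additive ∧ F.Linear R)

/-! ## The upper plus construction -/

variable (X) in
/-- The set `ℳ'(G)` of pairs `(K, λ)` with `K ∈ 𝒢` a subgroup of `G` and `λ ∈ Hom(K, A)`. -/
structure MPrime (G : FinGrp V) where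
  K : FinGrp V
  mem : K ∈ X.𝒢
  le : K ≤ G
  lam : K →* A

/-- `ᵍ(K, λ) = (ᵍK, ᵍλ)`, where `ᵍλ(gkg⁻¹) = λ(k)`. -/
def MPrime.conj (h : X.AxiomsItoIII) (h7 : X.AxiomVII) {G : FinGrp V} (hG : G ∈ X.𝒢)
    (p : X.MPrime G) (g : G) : X.MPrime G where
  K := FinGrp.conj p.le g
  mem := (conj_mem_aux h h7 hG p.mem p.le g).1
  le := conj_le p.le g
  lam := p.lam.comp (conjInv p.le g)

/-- The value `F(K)` at the first component of `(K, λ) ∈ ℳ'(G)`. -/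
abbrev val (F : FunctorCat.{u, w, r} X R h) {G : FinGrp V} (p : X.MPrime G) : ModuleCat.{max u w} R :=
  F.obj.obj ⟨p.K, p.mem⟩

/-- The conjugation map `F(Iso) : F(K) → F(ᵍK)`. -/
def conjMap (h7 : X.AxiomVII) (F : FunctorCat.{u, w, r} X R h) {G : FinGrp V} (hG : G ∈ X.𝒢)
    (p : X.MPrime G) (g : G) : val F p →ₗ[R] val F (p.conj h h7 hG g) :=
  (F.obj.map (mor (h := h) (R := R) (p.conj h h7 hG g).mem p.mem (graph (conjInv p.le g))
    (conj_mem_aux h h7 hG p.mem p.le g).2)).hom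

/-- The submodule `F⁺(G)` of `⨁_{(K, λ) ∈ ℳ'(G)} F(K)`: the families `x` such that
`ᵍx_{(K, λ)} = x_{(ᵍK, ᵍλ)}` for all `g ∈ G` and `(K, λ) ∈ ℳ'(G)`. -/
def Fplus (h7 : X.AxiomVII) (F : FunctorCat.{u, w, r} X R h) {G : FinGrp V} (hG : G ∈ X.𝒢) :
    Submodule R (⨁ p : X.MPrime G, val F p) where
  carrier := {x | ∀ (p : X.MPrime G) (g : G), conjMap h7 F hG p g (x p) = x (p.conj h h7 hG g)}
  zero_mem' p g := by simp
  add_mem' hx hy p g := by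
    rw [DirectSum.add_apply, map_add, hx p g, hy p g, DirectSum.add_apply]
  smul_mem' c x hx p g := by
    rw [DirectSum.smul_apply, map_smul, hx p g, DirectSum.smul_apply]

/-- The pair `(Kᵘ, μ) ∈ ℳ'(H)` for `(D, φ) ∈ 𝒮⁺(G, H)`, a subgroup `K ∈ 𝒢` of `p₁(D)`, and
`μ ∈ Hom(Kᵘ, A)`, where `Kᵘ = K * D`. -/
def pairU (h8 : X.AxiomVIII) {G H : FinGrp V} {p : MPair (G × H) A} (hp : p ∈ X.plus.S G H)
    (q : X.MPrime G) (hK : q.K ≤ p₁ p.D) (μ : lstar (hK.trans (p₁_le p.D)) p.D →* A) :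
    X.MPrime H where
  K := lstar (hK.trans (p₁_le p.D)) p.D
  mem := (lstar_mem h8 hp q.mem hK).1
  le := lstar_le _ _
  lam := μ

/-- The map `F([(K × Kᵘ)/((K × H)_u, φ_u)]) : F(Kᵘ) → F(K)`, where
`((K × H)_u, φ_u) = (Δ(K), 1) * (D, φ)`. -/
def mapU (h8 : X.AxiomVIII) (F : FunctorCat.{u, w, r} X R h) {G H : FinGrp V} {p : MPair (G × H) A}
    (hp : p ∈ X.plus.S G H) (q : X.MPrime G) (hK : q.K ≤ p₁ p.D)
    (μ : lstar (hK.trans (p₁_le p.D)) p.D →* A) :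
    val F (pairU h8 hp q hK μ) →ₗ[R] val F q :=
  (F.obj.map (mor (h := h) (R := R) q.mem (pairU h8 hp q hK μ).mem
    (p.res (hK.trans (p₁_le p.D)) (lstar_le (hK.trans (p₁_le p.D)) p.D))
    (lstar_mem h8 hp q.mem hK).2)).hom

/-- The conditions `φ₂ = μ` on `k₂(D) ∩ Kᵘ` and `φ * μ = α` on `K`, for `K ≤ p₁(D)`, `α ∈ Hom(K, A)`
and `μ ∈ Hom(Kᵘ, A)`; here `(φ * μ)(k) = φ(k, y) μ(y)` for any `y ∈ Kᵘ` with `(k, y) ∈ D`. -/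
def CondU {G H : FinGrp V} (p : MPair (G × H) A) (q : X.MPrime G) (hK : q.K ≤ p₁ p.D)
    (μ : lstar (hK.trans (p₁_le p.D)) p.D →* A) : Prop :=
  (∀ (y : lstar (hK.trans (p₁_le p.D)) p.D) (hy : incl (lstar_le _ _) y ∈ k₂ p.D),
    p.φ₂ ⟨_, hy⟩ = μ y) ∧
  ∀ (k : q.K) (y : lstar (hK.trans (p₁_le p.D)) p.D)
    (hy : (incl q.le k, incl (lstar_le _ _) y) ∈ p.D), p.φ ⟨_, hy⟩ * μ y = q.lam k

/-- `T` is a set of representatives of the `(A, H)`-orbits of `U`. -/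
def IsReps {G H : FinGrp V} (U : FibSet (G × H) A) (T : Finset U) : Prop :=
  ∀ x : U, ∃! t, t ∈ T ∧ ∃ (a : A) (y : H), x = a • ((1, y) : G × H) • t

/-- The coordinate
`y_{(K, α)} = ∑ F([(K × Kᵘ)/((K × H)_u, φ_u)]) (x_{(Kᵘ, μ)})` of `F⁺(U)(x)`, where the sum is over
`u ∈ T` with `K ≤ p₁((G × H)_u)` and `μ ∈ Hom(Kᵘ, A)` with `φ_{u,2} = μ` on `k₂((G × H)_u) ∩ Kᵘ`
and `φ_u * μ = α`. For every `u` at most one `μ` satisfies the conditions. -/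
def coordU (h8 : X.AxiomVIII) (F : FunctorCat.{u, w, r} X R h) {G H : FinGrp V} (U : FibSet (G × H) A)
    (hU : ∀ u, U.stab u ∈ X.plus.S G H) (T : Finset U) (x : ⨁ p : X.MPrime H, val F p)
    (q : X.MPrime G) : val F q :=
  ∑ u ∈ T, ∑ᶠ (hK : q.K ≤ p₁ (U.stab u).D)
    (μ : lstar (hK.trans (p₁_le (U.stab u).D)) (U.stab u).D →* A)
    (_ : CondU (U.stab u) q hK μ), mapU h8 F (hU u) q hK μ (x (pairU h8 (hU u) q hK μ))

end Datum

end Categories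

end

end FiberedBiset

/-!
The conditions say that, for `(D, φ) ∈ 𝒮⁺(G, H)` and `K ∈ 𝒢` with `K ≤ p₁(D)`, the subgroup
`D ∩ (K × H)` is the graph of a surjective homomorphism `f : K → K * D`, because `k₂(D) = 1`. Hence
for a pair `(K, α)` there is at most one pair `(L, μ)` with `L = K * D` and `φ * μ = α`; it is said
to be linked to `(K, α)` by `(D, φ)` (`Links`), and `F⁺(U)(x)` has at `(K, α)` the coordinate
`∑_u F([(K × L)/((Δ(K), 1) * (D_u, φ_u))])(x_{(L, μ)})`. The sum is over those representatives `u`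
of the `(A, H)`-orbits whose stabilizing pair `(D_u, φ_u)` links `(K, α)` to some pair `(L, μ)`, and
the summand (`term`) depends on `u` through `(D_u, φ_u)` only.

Everything then follows from one fact on composition: if `p₂(D)` is the whole intermediate group
and `k₂(D) = 1`, Mackey's formula has a single summand, so that the class of `(D, φ) * (E, ψ)` is the
composite of the classes of the factors (`tensor_trans`, `map_mor_mor`). Applied to a conjugation on
the right, it shows that the summand of `u` depends only on the orbit of `u`, if `x ∈ F⁺(H)`
(`term_conj_right`); applied to a conjugation on the left, that the result lies in `F⁺(G)`
(`term_conj_left`). Applied to a product, it gives functoriality (`term_star`): links via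
`(D, φ) * (E, ψ)` are composites of links via the factors in exactly one way (`Links.star`,
`Links.of_star`), and since all `k₂` are trivial, all orbits on `U × W` are `A`-free and the products
`t ⊗ s` of representatives represent the right orbits of `U ⊗ W` (`IsReps.tensor`).

The map `U ↦ F⁺(U)` is invariant under isomorphisms and additive on disjoint unions. If orbits with
stabilizing pairs outside `𝒮⁺` are given the contribution `0`, it is defined for all bisets, and so it
extends to an `R`-linear map on `B^A_R(G, H)` (`plusLin`), whose restriction to the morphisms of `𝒟⁺`
is `F⁺`.
-/

namespace FiberedBiset

noncomputable section

open FinGrp MPair FibSet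

/-! ### Pairs as graphs -/

namespace MPair

variable {A : Type u} [CommGroup A] {Γ : Type u} [Group Γ]

/-- `p.Val x a` says that `x` lies in the subgroup `D` of the pair `p = (D, φ)` and `φ(x) = a`:
the graph of `φ`. It determines `p` and spares the membership proofs in `φ ⟨x, _⟩`. -/
def Val (p : MPair Γ A) (x : Γ) (a : A) : Prop := ∃ h : x ∈ p.D, p.φ ⟨x, h⟩ = a

lemma val_of_mem {p : MPair Γ A} {x : Γ} (h : x ∈ p.D) : p.Val x (p.φ ⟨x, h⟩) := ⟨h, rfl⟩

lemma Val.mem {p : MPair Γ A} {x : Γ} {a : A} (h : p.Val x a) : x ∈ p.D := h.1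

lemma Val.eq {p : MPair Γ A} {x : Γ} {a b : A} (h : p.Val x a) (h' : p.Val x b) : a = b :=
  h.2.symm.trans h'.2

lemma Val.mul {p : MPair Γ A} {x y : Γ} {a b : A} (h : p.Val x a) (h' : p.Val y b) :
    p.Val (x * y) (a * b) := by
  obtain ⟨h, rfl⟩ := h
  obtain ⟨h', rfl⟩ := h'
  exact ⟨p.D.mul_mem h h', map_mul p.φ ⟨x, h⟩ ⟨y, h'⟩⟩

lemma ext_val {p q : MPair Γ A} (h : ∀ x a, p.Val x a ↔ q.Val x a) : p = q :=
  ext' (fun x => ⟨fun hx => ((h x _).1 (val_of_mem hx)).mem,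
    fun hx => ((h x _).2 (val_of_mem hx)).mem⟩)
    fun x hp hq => ((h x _).1 (val_of_mem hp)).eq (val_of_mem hq)

lemma val_conj {p : MPair Γ A} {γ x : Γ} {a : A} :
    (p.conj γ).Val x a ↔ p.Val (γ⁻¹ * x * γ) a :=
  ⟨fun ⟨h, e⟩ => ⟨Datum.mem_conj_D.1 h, (Datum.conj_φ h).symm.trans e⟩,
    fun ⟨h, e⟩ => ⟨Datum.mem_conj_D.2 h, (Datum.conj_φ _).trans e⟩⟩

variable {G H K : Type u} [Group G] [Group H] [Group K]

lemma val_star {p : MPair (G × H) A} {q : MPair (H × K) A} (c : Compat p q) {g : G} {k : K}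
    {a : A} : (star p q c).Val (g, k) a ↔
      ∃ (h : H) (b b' : A), p.Val (g, h) b ∧ q.Val (h, k) b' ∧ b * b' = a := by
  constructor
  · rintro ⟨hx, rfl⟩
    obtain ⟨h, h₁, h₂⟩ := id hx
    exact ⟨h, _, _, ⟨h₁, rfl⟩, ⟨h₂, rfl⟩, (star_apply c h₁ h₂ hx).symm⟩
  · rintro ⟨h, _, _, ⟨h₁, rfl⟩, ⟨h₂, rfl⟩, rfl⟩
    exact ⟨⟨h, h₁, h₂⟩, star_apply c h₁ h₂ _⟩

lemma val_graph {f : G →* H} {g : G} {h : H} {a : A} :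
    (graph f : MPair (G × H) A).Val (g, h) a ↔ f g = h ∧ a = 1 :=
  ⟨fun ⟨h, e⟩ => ⟨h, e.symm⟩, fun ⟨h, e⟩ => ⟨h, e.symm⟩⟩

lemma val_conj_prod {p : MPair (G × H) A} {g x : G} {h y : H} {a : A} :
    (p.conj (g, h)).Val (x, y) a ↔ p.Val (g⁻¹ * x * g, h⁻¹ * y * h) a := val_conj

/-- A subgroup with trivial `k₂` is the graph of a function on its first projection. -/
lemma right_unique {D : Subgroup (G × H)} (hD : k₂ D = ⊥) {g : G} {y z : H} (hy : (g, y) ∈ D)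
    (hz : (g, z) ∈ D) : y = z := by
  have h₁ : y⁻¹ * z ∈ k₂ D := by
    change ((1 : G), y⁻¹ * z) ∈ D
    simpa using D.mul_mem (D.inv_mem hy) hz
  rw [hD, Subgroup.mem_bot, inv_mul_eq_one] at h₁
  exact h₁

lemma compat_of_k₂ {p : MPair (G × H) A} (hp : k₂ p.D = ⊥) (q : MPair (H × K) A) :
    Compat p q := by
  intro h h₂ h₁
  have e : h = 1 := by
    have := h₂
    rwa [hp, Subgroup.mem_bot] at this
  subst e
  exact (map_one p.φ₂).trans (map_one q.φ₁).symm

end MPair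

/-! ### Stabilizing pairs, products of transitive sets and right orbits -/

namespace FibSet

variable {A : Type u} [CommGroup A] {Γ : Type u} [Group Γ]

lemma val_stab {X : FibSet Γ A} {x : X} {γ : Γ} {a : A} : (X.stab x).Val γ a ↔ γ • x = a • x :=
  ⟨fun ⟨h, e⟩ => e ▸ stab_spec h, fun h => ⟨⟨a, h⟩, stab_eq h _⟩⟩

lemma stab_iso {X Y : FibSet Γ A} (f : Iso X Y) (x : X) : Y.stab (f.e x) = X.stab x :=
  ext_val fun γ a => by
    rw [val_stab, val_stab, ← f.map_Γ, ← f.map_A, f.e.apply_eq_iff_eq]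

variable {G H K : Type u} [Group G] [Group H] [Group K]

lemma free_of_k₂ {X : FibSet (G × H) A} {Y : FibSet (H × K) A} {x : X}
    (hx : k₂ (X.stab x).D = ⊥) (y : Y) : Free x y := by
  intro h a b h₁ h₂
  have e : h = 1 := by
    have : h ∈ k₂ (X.stab x).D := ⟨a, h₁⟩
    rwa [hx, Subgroup.mem_bot] at this
  subst e
  have e₁ : a = 1 := X.free _ _ x (h₁.symm.trans ((one_smul _ x).trans (one_smul A x).symm))
  have e₂ : b = 1 := Y.free _ _ y (h₂.symm.trans ((one_smul _ y).trans (one_smul A y).symm))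
  rw [e₁, e₂, mul_one]

/-- Mackey's formula in the case of a single double coset: if `p₂(D)` is all of `H` and
`k₂(D) = 1`, then `(G × H)/(D, φ) ⊗ (H × K)/(E, ψ)` is transitive, with stabilizing pair
`(D, φ) * (E, ψ)` at the product of the base points. -/
lemma tensor_trans [Finite G] [Finite H] [Finite K] (p : MPair (G × H) A) (q : MPair (H × K) A)
    (hp : k₂ p.D = ⊥) (hs : ∀ h : H, ∃ g, (g, h) ∈ p.D) :
    tensor (trans p) (trans q) ≈ trans (star p q (compat_of_k₂ hp q)) := by
  have hF : ∀ y : trans q, Free (base p) y := free_of_k₂ (by rw [stab_base]; exact hp)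
  obtain ⟨c, hc⟩ := stab_tmk (hF (base q))
  have e : (tensor (trans p) (trans q)).stab (tmk _ _ (hF (base q))) =
      star p q (compat_of_k₂ hp q) := by
    rw [hc]
    refine ext_val ?_
    rintro ⟨g, k⟩ a
    rw [val_star, val_star, stab_base, stab_base]
  rw [← e]
  refine iso_trans _ _ fun ω => ?_
  obtain ⟨x, y, h, rfl⟩ := exists_tmk ω
  obtain ⟨⟨g, z⟩, a, rfl⟩ := exists_base p x
  obtain ⟨⟨z', k⟩, b, rfl⟩ := exists_base q y
  -- `z'` is moved to the left factor and, with `z`, absorbed there by an element `(g', z'⁻¹ z)` of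
  -- `D`, at the cost of the scalar `φ(g', z'⁻¹ z)`.
  obtain ⟨g', hg'⟩ := hs (z'⁻¹ * z)
  refine ⟨(g * g'⁻¹, k), a * b * p.φ ⟨_, hg'⟩, ?_⟩
  obtain ⟨i₁, e₁⟩ := smul_tmk_A (a * b * p.φ ⟨_, hg'⟩) _ _ (hF (base q))
  obtain ⟨i₂, e₂⟩ := smul_tmk (g * g'⁻¹) k _ _ i₁
  rw [e₁, e₂, tmk_eq]
  refine ⟨z'⁻¹, b⁻¹, ?_, ?_⟩
  · have : ((g', z'⁻¹ * z) : G × H) • base p = p.φ ⟨_, hg'⟩ • base p :=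
      (smul_base_iff p _ _).2 ⟨hg', rfl⟩
    rw [mul_smul (a * b), ← this]
    simp only [A_smul_comm, smul_smul]
    congr 1
    · simp
    · congr 1
      rw [mul_comm a b, inv_mul_cancel_left]
  · simp only [A_smul_comm, smul_smul]
    simp

/-- `x` and `t` lie in the same `(A, H)`-orbit. -/
def RightEq (U : FibSet (G × H) A) (x t : U) : Prop :=
  ∃ (a : A) (y : H), x = a • ((1, y) : G × H) • t

lemma rightEq_refl (U : FibSet (G × H) A) (x : U) : RightEq U x x :=
  ⟨1, 1, by rw [one_smul]; exact (one_smul (G × H) x).symm⟩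

lemma RightEq.symm {U : FibSet (G × H) A} {x t : U} (h : RightEq U x t) : RightEq U t x := by
  obtain ⟨a, y, rfl⟩ := h
  refine ⟨a⁻¹, y⁻¹, ?_⟩
  rw [← A_smul_comm, inv_smul_smul, smul_smul]
  simp [← Prod.one_eq_mk]

lemma RightEq.trans {U : FibSet (G × H) A} {x t s : U} (h : RightEq U x t) (h' : RightEq U t s) :
    RightEq U x s := by
  obtain ⟨a, y, rfl⟩ := h
  obtain ⟨b, z, rfl⟩ := h'
  refine ⟨a * b, y * z, ?_⟩
  rw [← A_smul_comm, smul_smul, smul_smul]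
  simp

lemma RightEq.smul {U : FibSet (G × H) A} {x t : U} (h : RightEq U x t) (g : G) :
    RightEq U (((g, 1) : G × H) • x) (((g, 1) : G × H) • t) := by
  obtain ⟨a, y, rfl⟩ := h
  refine ⟨a, y, ?_⟩
  rw [← A_smul_comm, smul_smul, smul_smul]
  simp

lemma rightEq_map {U U' : FibSet (G × H) A} (f : Iso U U') {x t : U} :
    RightEq U' (f.e x) (f.e t) ↔ RightEq U x t := by
  simp only [RightEq, ← f.map_Γ, ← f.map_A, f.e.apply_eq_iff_eq]

end FibSet

namespace Datum

variable {V A : Type u} [CommGroup A] {X : Datum V A} {G H K : FinGrp V}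

/-! ### Representatives of the right orbits -/

section Reps

variable {U U' : FibSet (G × H) A} {W : FibSet (H × K) A}

lemma exists_isReps (U : FibSet (G × H) A) : ∃ T : Finset U, IsReps U T := by
  classical
  let s : Setoid U := ⟨RightEq U, rightEq_refl U, RightEq.symm, RightEq.trans⟩
  have hf : Finite (_root_.Quotient s) := by
    have := U.fin
    refine Finite.of_surjective (Quotient.map' (s₁ := MulAction.orbitRel A U) (s₂ := s) id ?_) ?_
    · rintro _ x ⟨a, rfl⟩
      exact ⟨a, 1, congrArg (a • ·) (one_smul (G × H) x).symm⟩
    · rintro ⟨x⟩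
      exact ⟨Quotient.mk'' x, rfl⟩
  have := Fintype.ofFinite (_root_.Quotient s)
  refine ⟨Finset.univ.image (fun o : _root_.Quotient s => o.out), fun x => ⟨(Quotient.mk s x).out,
    ⟨Finset.mem_image_of_mem _ (Finset.mem_univ _), ?_⟩, ?_⟩⟩
  · exact RightEq.symm (Quotient.mk_out (s := s) x)
  · rintro t ⟨ht, h⟩
    obtain ⟨o, -, rfl⟩ := Finset.mem_image.1 ht
    have : Quotient.mk s x = o := (Quotient.sound (s := s) h).trans o.out_eq
    rw [this]

/-- Sums over representatives of the `(A, H)`-orbits do not depend on the representatives. -/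
lemma IsReps.sum_eq {M : Type*} [AddCommMonoid M] {T T' : Finset U} (hT : IsReps U T)
    (hT' : IsReps U T') (f : U → M) (hf : ∀ x t, RightEq U x t → f x = f t) :
    ∑ t ∈ T, f t = ∑ t ∈ T', f t := by
  refine Finset.sum_bij (fun t _ => (hT' t).choose) (fun t _ => (hT' t).choose_spec.1.1) ?_ ?_ ?_
  · intro t ht s hs e
    have h₁ : RightEq U t _ := (hT' t).choose_spec.1.2
    have h₂ : RightEq U s _ := (hT' s).choose_spec.1.2
    rw [← e] at h₂
    exact (hT t).unique ⟨ht, rightEq_refl U t⟩ ⟨hs, h₁.trans h₂.symm⟩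
  · intro t ht
    obtain ⟨s, ⟨hs, h⟩, -⟩ := hT t
    exact ⟨s, hs, (hT' s).unique (hT' s).choose_spec.1 ⟨ht, RightEq.symm h⟩⟩
  · intro t ht
    exact hf _ _ (hT' t).choose_spec.1.2

lemma IsReps.map (f : Iso U U') {T : Finset U} (hT : IsReps U T) :
    IsReps U' (T.map f.e.toEmbedding) := by
  intro x
  obtain ⟨x, rfl⟩ := f.e.surjective x
  obtain ⟨t, ⟨ht, h⟩, hu⟩ := hT x
  refine ⟨f.e t, ⟨Finset.mem_map_of_mem _ ht, (rightEq_map f).2 h⟩, ?_⟩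
  rintro s ⟨hs, h'⟩
  obtain ⟨s, hs₁, rfl⟩ := Finset.mem_map.1 hs
  exact congrArg f.e (hu s ⟨hs₁, (rightEq_map f).1 h'⟩)

lemma IsReps.smul {T : Finset U} (hT : IsReps U T) (g : G) :
    IsReps U (T.map (MulAction.toPerm ((g, 1) : G × H)).toEmbedding) := by
  intro x
  obtain ⟨t, ⟨ht, h⟩, hu⟩ := hT (((g⁻¹, 1) : G × H) • x)
  have key : ∀ z : U, ((g, 1) : G × H) • ((g⁻¹, 1) : G × H) • z = z := fun z => by
    rw [smul_smul]; simp [← Prod.one_eq_mk]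
  have key' : ∀ z : U, ((g⁻¹, 1) : G × H) • ((g, 1) : G × H) • z = z := fun z => by
    rw [smul_smul]; simp [← Prod.one_eq_mk]
  refine ⟨((g, 1) : G × H) • t, ⟨Finset.mem_map.2 ⟨t, ht, rfl⟩, ?_⟩, ?_⟩
  · have := RightEq.smul h g
    rwa [key] at this
  · rintro s ⟨hs, h'⟩
    obtain ⟨s, hs₁, rfl⟩ := Finset.mem_map.1 hs
    have := RightEq.smul h' g⁻¹
    change RightEq U _ (((g⁻¹, 1) : G × H) • ((g, 1) : G × H) • s) at this
    rw [key'] at this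
    exact congrArg (((g, 1) : G × H) • ·) (hu s ⟨hs₁, this⟩)

lemma IsReps.sum {T : Finset U} {T' : Finset U'} (hT : IsReps U T) (hT' : IsReps U' T') :
    IsReps (FibSet.sum U U') (T.disjSum T' : Finset (U.carrier ⊕ U'.carrier)) := by
  intro z
  rcases sum_cases z with ⟨x, rfl⟩ | ⟨x, rfl⟩
  · obtain ⟨t, ⟨ht, a, y, h⟩, hu⟩ := hT x
    refine ⟨FibSet.inl t, ⟨Finset.inl_mem_disjSum.2 ht, a, y, congrArg FibSet.inl h⟩, ?_⟩
    rintro s ⟨hs, b, w, h'⟩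
    rcases sum_cases s with ⟨s, rfl⟩ | ⟨s, rfl⟩
    · exact congrArg FibSet.inl (hu s ⟨Finset.inl_mem_disjSum.1 hs, b, w, inl_inj.1 h'⟩)
    · exact (inl_ne_inr h').elim
  · obtain ⟨t, ⟨ht, a, y, h⟩, hu⟩ := hT' x
    refine ⟨FibSet.inr t, ⟨Finset.inr_mem_disjSum.2 ht, a, y, congrArg FibSet.inr h⟩, ?_⟩
    rintro s ⟨hs, b, w, h'⟩
    rcases sum_cases s with ⟨s, rfl⟩ | ⟨s, rfl⟩
    · exact (inr_ne_inl h').elim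
    · exact congrArg FibSet.inr (hu s ⟨Finset.inr_mem_disjSum.1 hs, b, w, inr_inj.1 h'⟩)

/-- If all `k₂` of the stabilizers of `U` are trivial, then the products `t ⊗ s` of
representatives represent the right orbits of `U ⊗ W`, each of them once. -/
lemma IsReps.tensor (hk : ∀ x, k₂ (U.stab x).D = ⊥) {T : Finset U} {S : Finset W}
    (hT : IsReps U T) (hS : IsReps W S) :
    ∃ hinj : Function.Injective
      (fun z : T × S => tmk z.1.1 z.2.1 (free_of_k₂ (hk z.1.1) z.2.1)),
      IsReps (FibSet.tensor U W) (Finset.univ.map ⟨_, hinj⟩) := by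
  have hF : ∀ (x : U) (y : W), Free x y := fun x y => free_of_k₂ (hk x) y
  -- `t ⊗ s` and `t' ⊗ s'` in one orbit force `t = t'`, and then `s`, `s'` lie in one orbit.
  have key : ∀ t ∈ T, ∀ t' ∈ T, ∀ (s s' : W),
      RightEq (FibSet.tensor U W) (tmk t s (hF t s)) (tmk t' s' (hF t' s')) →
      t = t' ∧ RightEq W s s' := by
    rintro t ht t' ht' s s' ⟨a, k, h⟩
    obtain ⟨i₁, e₁⟩ := smul_tmk (1 : G) k _ _ (hF t' s')
    obtain ⟨i₂, e₂⟩ := smul_tmk_A a _ _ i₁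
    rw [e₁, e₂, eq_comm, tmk_eq] at h
    obtain ⟨z, b, h₁, h₂⟩ := h
    have h₁' : t = (b⁻¹ * a) • ((1, z) : G × H) • t' := by
      rw [mul_smul, eq_inv_smul_iff, h₁]
      simp only [A_smul_comm, smul_smul]
      simp
    have e : t = t' := (hT t).unique ⟨ht, rightEq_refl U t⟩ ⟨ht', _, _, h₁'⟩
    subst e
    have hz : z = 1 := by
      have : z ∈ k₂ (U.stab t).D := by
        refine ⟨(b⁻¹ * a)⁻¹, ?_⟩
        change ((1, z) : G × H) • t = _
        rw [eq_inv_smul_iff]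
        exact h₁'.symm
      rwa [hk, Subgroup.mem_bot] at this
    subst hz
    refine ⟨rfl, b, k, ?_⟩
    rw [h₂, smul_smul]
    simp
  refine ⟨?_, ?_⟩
  · rintro ⟨⟨t, ht⟩, ⟨s, hs⟩⟩ ⟨⟨t', ht'⟩, ⟨s', hs'⟩⟩ h
    have h : tmk t s (hF t s) = tmk t' s' (hF t' s') := h
    obtain ⟨rfl, e⟩ := key t ht t' ht' s s' (h ▸ rightEq_refl _ _)
    obtain rfl := (hS s).unique ⟨hs, rightEq_refl W s⟩ ⟨hs', e⟩
    rfl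
  · intro ω
    obtain ⟨x, y, hxy, rfl⟩ := exists_tmk ω
    obtain ⟨t, ⟨ht, a, z, rfl⟩, -⟩ := hT x
    -- `a (1, z) t ⊗ y = t ⊗ a (z⁻¹, 1) y`
    obtain ⟨s, ⟨hs, b, k, hb⟩, -⟩ := hS (a • ((z⁻¹, 1) : H × K) • y)
    have h₀ : RightEq (FibSet.tensor U W) (tmk (a • ((1, z) : G × H) • t) y hxy)
        (tmk t s (hF t s)) := by
      refine ⟨b, k, ?_⟩
      obtain ⟨i₁, e₁⟩ := smul_tmk (1 : G) k _ _ (hF t s)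
      obtain ⟨i₂, e₂⟩ := smul_tmk_A b _ _ i₁
      rw [e₁, e₂, tmk_eq]
      refine ⟨z⁻¹, a * b⁻¹, ?_, ?_⟩
      · simp only [A_smul_comm, smul_smul]
        simp
      · rw [mul_comm, mul_smul, eq_inv_smul_iff, hb]
    refine ⟨_, ⟨Finset.mem_map.2 ⟨(⟨t, ht⟩, ⟨s, hs⟩), Finset.mem_univ _, rfl⟩, h₀⟩, ?_⟩
    rintro _ ⟨hω, h₁⟩
    obtain ⟨⟨⟨t', ht'⟩, ⟨s', hs'⟩⟩, -, rfl⟩ := Finset.mem_map.1 hω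
    obtain ⟨rfl, e⟩ := key t ht t' ht' s s' (h₀.symm.trans h₁)
    obtain rfl := (hS s).unique ⟨hs, rightEq_refl W s⟩ ⟨hs', e⟩
    rfl

end Reps

/-! ### Links between the pairs in `ℳ'(G)` and `ℳ'(H)` -/

lemma k₂_eq_bot (hk : X.CondK2) {p : MPair (G × H) A} (hp : p ∈ X.plus.S G H) : k₂ p.D = ⊥ := by
  obtain ⟨h₁, h₂, h₃⟩ := hp
  have := hk _ h₁ _ h₂ _ h₃
  rw [eq_bot_iff]
  intro y hy
  have hm : (⟨y, mem_p₂.2 ⟨1, hy⟩⟩ : p₂ p.D) ∈ k₂ (p.res (p₁_le p.D) (p₂_le p.D)).D := hy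
  rw [this, Subgroup.mem_bot] at hm
  exact congrArg (incl (p₂_le p.D)) hm

/-- For `(D, φ) ∈ ℳ(G × H)` the pair `(K, α) ∈ ℳ'(G)` is linked to `(L, μ) ∈ ℳ'(H)` if
`K ≤ p₁(D)`, `L = K * D` and `φ * μ = α`. If `k₂(D) = 1`, then `D` restricts to the graph of a
surjective homomorphism `K → L`. -/
structure Links (p : MPair (G × H) A) (q : X.MPrime G) (q' : X.MPrime H) : Prop where
  exists_right : ∀ k : q.K, ∃ y : q'.K, (incl q.le k, incl q'.le y) ∈ p.D
  exists_left : ∀ y : q'.K, ∃ k : q.K, (incl q.le k, incl q'.le y) ∈ p.D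
  mem_right : ∀ (k : q.K) (y : H), (incl q.le k, y) ∈ p.D → (y : V) ∈ q'.K.carrier
  lam_eq : ∀ (k : q.K) (y : q'.K) (a : A), p.Val (incl q.le k, incl q'.le y) a →
    a * q'.lam y = q.lam k

lemma MPrime.ext' {q q' : X.MPrime G} (h : q.K = q'.K)
    (h' : ∀ (x : V) (hx : x ∈ q.K.carrier) (hx' : x ∈ q'.K.carrier),
      q.lam ⟨x, hx⟩ = q'.lam ⟨x, hx'⟩) : q = q' := by
  obtain ⟨K, m, l, lam⟩ := q
  obtain ⟨K', m', l', lam'⟩ := q'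
  obtain rfl : K = K' := h
  congr 1
  ext x
  exact h' x.1 x.2 x.2

lemma Links.K_eq {p : MPair (G × H) A} {q : X.MPrime G} {q' : X.MPrime H} (hl : Links p q q') :
    lstar q.le p.D = q'.K := by
  refine eq_of_mem (lstar_le _ _) q'.le fun y => ?_
  rw [mem_lstar]
  exact ⟨fun ⟨k, hk⟩ => hl.mem_right k y hk, fun hy => hl.exists_left ⟨y, hy⟩⟩

lemma Links.le {p : MPair (G × H) A} {q : X.MPrime G} {q' : X.MPrime H} (hl : Links p q q') :
    q.K ≤ p₁ p.D :=
  le_of_mem q.le (p₁_le _) fun g hg => by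
    obtain ⟨y, hy⟩ := hl.exists_right ⟨g, hg⟩
    exact mem_p₁.2 ⟨_, hy⟩

lemma Links.mem_S (h8 : X.AxiomVIII) {p : MPair (G × H) A} (hp : p ∈ X.plus.S G H)
    {q : X.MPrime G} {q' : X.MPrime H} (hl : Links p q q') :
    p.res q.le q'.le ∈ X.S q.K q'.K :=
  res_mem_congr X (lstar_mem h8 hp q.mem hl.le).2 rfl hl.K_eq _ _

lemma Links.right_unique {p : MPair (G × H) A} {q : X.MPrime G} {q' q'' : X.MPrime H}
    (hl : Links p q q') (hl' : Links p q q'') : q' = q'' := by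
  refine MPrime.ext' (hl.K_eq.symm.trans hl'.K_eq) fun x hx hx' => ?_
  obtain ⟨k, hk⟩ := hl.exists_left ⟨x, hx⟩
  have h₁ := hl.lam_eq k ⟨x, hx⟩ _ (val_of_mem hk)
  have h₂ := hl'.lam_eq k ⟨x, hx'⟩ _ (val_of_mem hk)
  exact mul_left_cancel (h₁.trans h₂.symm)

/-- The character `α` of `(K, α)` is determined by `K` and a pair linked to it. -/
lemma Links.left_unique {p : MPair (G × H) A} {q₁ q₂ : X.MPrime G} {q' : X.MPrime H}
    (hl : Links p q₁ q') (hl' : Links p q₂ q') (hK : q₁.K = q₂.K) : q₁ = q₂ := by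
  refine MPrime.ext' hK fun x hx hx' => ?_
  obtain ⟨y, hy⟩ := hl.exists_right ⟨x, hx⟩
  exact (hl.lam_eq ⟨x, hx⟩ y _ (val_of_mem hy)).symm.trans
    (hl'.lam_eq ⟨x, hx'⟩ y _ (val_of_mem hy))

/-- The condition `φ₂ = μ` in `CondU` holds automatically, as `k₂(D) = 1`. -/
lemma links_pairU (h8 : X.AxiomVIII) (hk : X.CondK2) {p : MPair (G × H) A}
    (hp : p ∈ X.plus.S G H) (q : X.MPrime G) (hK : q.K ≤ p₁ p.D)
    (μ : lstar (hK.trans (p₁_le p.D)) p.D →* A) :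
    CondU p q hK μ ↔ Links p q (pairU h8 hp q hK μ) := by
  constructor
  · rintro ⟨-, hc⟩
    refine ⟨fun k => ?_, fun y => ?_, fun k y hy => ?_, fun k y a ⟨hy, e⟩ => ?_⟩
    · obtain ⟨y, hy⟩ := mem_p₁.1 (show ((incl q.le k : G) : V) ∈ (p₁ p.D).carrier from hK.1 k.2)
      exact ⟨⟨y, mem_lstar.2 ⟨k, hy⟩⟩, hy⟩
    · exact mem_lstar.1 (show ((incl (lstar_le (hK.trans (p₁_le p.D)) p.D) y : H) : V) ∈
        (lstar (hK.trans (p₁_le p.D)) p.D).carrier from y.2)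
    · exact mem_lstar.2 ⟨k, hy⟩
    · rw [← e]
      exact hc k y hy
  · intro hl
    refine ⟨fun y hy => ?_, fun k y hy => hl.lam_eq k y _ ⟨hy, rfl⟩⟩
    have e : incl (lstar_le (hK.trans (p₁_le p.D)) p.D) y = 1 := by
      rw [k₂_eq_bot hk hp, Subgroup.mem_bot] at hy
      exact hy
    obtain rfl : y = 1 := incl_injective _ (e.trans (map_one _).symm)
    have e' : (⟨_, hy⟩ : k₂ p.D) = 1 := Subtype.ext e
    exact (congrArg p.φ₂ e').trans ((map_one p.φ₂).trans (map_one μ).symm)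

lemma Links.eq_pairU (h8 : X.AxiomVIII) {p : MPair (G × H) A}
    (hp : p ∈ X.plus.S G H) {q : X.MPrime G} {q' : X.MPrime H} (hl : Links p q q')
    (hK : q.K ≤ p₁ p.D) : ∃ μ, q' = pairU h8 hp q hK μ := by
  obtain ⟨K, m, l, lam⟩ := q'
  obtain rfl : lstar q.le p.D = K := hl.K_eq
  exact ⟨lam, rfl⟩

lemma conjInv_surjective {K G : FinGrp V} (hK : K ≤ G) (g : G) :
    Function.Surjective (conjInv hK g) := by
  intro k
  refine ⟨⟨_, mem_conj hK g k⟩, incl_injective hK ?_⟩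
  rw [incl_conjInv]
  change g⁻¹ * (g * incl hK k * g⁻¹) * g = _
  group

lemma val_conj_left {p : MPair (G × H) A} {K : FinGrp V} {hK : K ≤ G} {g : G} {y : H} {a : A}
    (z : FinGrp.conj hK g) : (p.conj (g, 1)).Val (incl (conj_le hK g) z, y) a ↔
      p.Val (incl hK (conjInv hK g z), y) a := by
  rw [val_conj_prod, incl_conjInv, inv_one, one_mul, mul_one]

lemma val_conj_right {p : MPair (G × H) A} {K : FinGrp V} {hK : K ≤ H} {g : G} {y : H} {a : A}
    (z : FinGrp.conj hK y) : (p.conj (1, y)).Val (g, incl (conj_le hK y) z) a ↔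
      p.Val (g, incl hK (conjInv hK y z)) a := by
  rw [val_conj_prod, incl_conjInv, inv_one, one_mul, mul_one]

/-! ### Behaviour of links under conjugation and products -/

lemma Links.conj_right (h : X.AxiomsItoIII) (h7 : X.AxiomVII) (hH : H ∈ X.𝒢)
    {p : MPair (G × H) A} {q : X.MPrime G} {q' : X.MPrime H} (hl : Links p q q') (y : H) :
    Links (p.conj (1, y)) q (q'.conj h h7 hH y) := by
  have hv : ∀ (k : q.K) (z : (q'.conj h h7 hH y).K) (a : A),
      (p.conj ((1 : G), y)).Val (incl q.le k, incl (q'.conj h h7 hH y).le z) a ↔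
        p.Val (incl q.le k, incl q'.le (conjInv q'.le y z)) a :=
    fun _ _ _ => val_conj_right _
  refine ⟨fun k => ?_, fun z => ?_, fun k z hz => ?_, fun k z a hz => ?_⟩
  · obtain ⟨z, hz⟩ := hl.exists_right k
    obtain ⟨z, rfl⟩ := conjInv_surjective q'.le y z
    exact ⟨z, ((hv _ _ _).2 (val_of_mem hz)).mem⟩
  · obtain ⟨k, hk⟩ := hl.exists_left (conjInv q'.le y z)
    exact ⟨k, ((hv _ _ _).2 (val_of_mem hk)).mem⟩
  · refine mem_conj_iff.2 (hl.mem_right k _ ?_)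
    have := (val_conj_prod.1 (val_of_mem hz)).mem
    simpa using this
  · exact hl.lam_eq k _ a ((hv _ _ _).1 hz)

lemma links_conj_left (h : X.AxiomsItoIII) (h7 : X.AxiomVII) (hG : G ∈ X.𝒢)
    {p : MPair (G × H) A} {q : X.MPrime G} {q' : X.MPrime H} (g : G) :
    Links (p.conj (g, 1)) (q.conj h h7 hG g) q' ↔ Links p q q' := by
  have hv : ∀ (k : (q.conj h h7 hG g).K) (z : H) (a : A),
      (p.conj (g, (1 : H))).Val (incl (q.conj h h7 hG g).le k, z) a ↔
        p.Val (incl q.le (conjInv q.le g k), z) a :=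
    fun _ _ _ => val_conj_left _
  have hm : ∀ (k : (q.conj h h7 hG g).K) (z : H),
      (incl (q.conj h h7 hG g).le k, z) ∈ (p.conj (g, (1 : H))).D ↔
        (incl q.le (conjInv q.le g k), z) ∈ p.D := fun k z =>
    ⟨fun hz => ((hv _ _ _).1 (val_of_mem hz)).mem, fun hz => ((hv _ _ _).2 (val_of_mem hz)).mem⟩
  have hs : ∀ k : q.K, ∃ k' : (q.conj h h7 hG g).K, conjInv q.le g k' = k :=
    conjInv_surjective q.le g
  constructor
  · intro hl
    refine ⟨fun k => ?_, fun z => ?_, fun k z hz => ?_, fun k z a hz => ?_⟩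
    · obtain ⟨k, rfl⟩ := hs k
      obtain ⟨y, hy⟩ := hl.exists_right k
      exact ⟨y, (hm _ _).1 hy⟩
    · obtain ⟨k, hk⟩ := hl.exists_left z
      exact ⟨_, (hm _ _).1 hk⟩
    · obtain ⟨k, rfl⟩ := hs k
      exact hl.mem_right k z ((hm _ _).2 hz)
    · obtain ⟨k, rfl⟩ := hs k
      exact hl.lam_eq k z a ((hv _ _ _).2 hz)
  · intro hl
    refine ⟨fun k => ?_, fun z => ?_, fun k z hz => ?_, fun k z a hz => ?_⟩
    · obtain ⟨y, hy⟩ := hl.exists_right (conjInv q.le g k)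
      exact ⟨y, (hm _ _).2 hy⟩
    · obtain ⟨k, hk⟩ := hl.exists_left z
      obtain ⟨k, rfl⟩ := hs k
      exact ⟨_, (hm _ _).2 hk⟩
    · exact hl.mem_right _ z ((hm _ _).1 hz)
    · exact hl.lam_eq _ z a ((hv _ _ _).1 hz)

lemma Links.star {p : MPair (G × H) A} {p' : MPair (H × K) A} (c : Compat p p')
    {q : X.MPrime G} {q' : X.MPrime H} {q'' : X.MPrime K} (hl : Links p q q')
    (hl' : Links p' q' q'') : Links (MPair.star p p' c) q q'' := by
  refine ⟨fun k => ?_, fun z => ?_, fun k z hz => ?_, fun k z a hz => ?_⟩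
  · obtain ⟨y, hy⟩ := hl.exists_right k
    obtain ⟨z, hz⟩ := hl'.exists_right y
    exact ⟨z, _, hy, hz⟩
  · obtain ⟨y, hy⟩ := hl'.exists_left z
    obtain ⟨k, hk⟩ := hl.exists_left y
    exact ⟨k, _, hk, hy⟩
  · obtain ⟨y, h₁, h₂⟩ := hz
    exact hl'.mem_right ⟨y, hl.mem_right k y h₁⟩ z h₂
  · obtain ⟨y, b, b', h₁, h₂, rfl⟩ := (val_star c).1 hz
    have hy := hl.mem_right k y h₁.mem
    rw [mul_assoc, hl'.lam_eq ⟨y, hy⟩ z b' h₂, hl.lam_eq k ⟨y, hy⟩ b h₁]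

/-- A pair linked via a product `(D, φ) * (E, ψ)` is linked in two steps: for the intermediate
pair `(L, μ)` take `L = K * D` and `μ = ψ * λ`. -/
lemma Links.of_star (h8 : X.AxiomVIII) (hk : X.CondK2) {p : MPair (G × H) A}
    {p' : MPair (H × K) A} (hp : p ∈ X.plus.S G H) (hp' : p' ∈ X.plus.S H K) (c : Compat p p')
    {q : X.MPrime G} {q'' : X.MPrime K} (hl : Links (MPair.star p p' c) q q'') :
    ∃ q' : X.MPrime H, Links p q q' ∧ Links p' q' q'' := by
  have hq : ∀ k : q.K, ∃ (y : H) (z : q''.K), (incl q.le k, y) ∈ p.D ∧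
      (y, incl q''.le z) ∈ p'.D := fun k => by
    obtain ⟨z, y, h₁, h₂⟩ := hl.exists_right k
    exact ⟨y, z, h₁, h₂⟩
  have hK : q.K ≤ p₁ p.D := le_of_mem q.le (p₁_le _) fun g hg => by
    obtain ⟨y, z, h₁, h₂⟩ := hq ⟨g, hg⟩
    exact mem_p₁.2 ⟨_, h₁⟩
  -- `L` is a variable rather than `lstar _ _`, so that only its membership relation is used.
  obtain ⟨L, hL⟩ : ∃ L, L = lstar q.le p.D := ⟨_, rfl⟩
  have hLm : L ∈ X.𝒢 := hL ▸ (lstar_mem h8 hp q.mem hK).1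
  have hLl : L ≤ H := hL ▸ lstar_le _ _
  have hmem : ∀ y : H, (y : V) ∈ L.carrier ↔ ∃ k : q.K, (incl q.le k, y) ∈ p.D := by
    subst hL
    exact fun y => mem_lstar
  have hz : ∀ y : L, ∃ (z : q''.K) (a : A), p'.Val (incl hLl y, incl q''.le z) a := by
    intro y
    obtain ⟨k, hk₁⟩ := (hmem (incl hLl y)).1 y.2
    obtain ⟨y', z, h₁, h₂⟩ := hq k
    obtain rfl := MPair.right_unique (k₂_eq_bot hk hp) hk₁ h₁
    exact ⟨z, _, val_of_mem h₂⟩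
  choose f b hf using hz
  have hf' : ∀ (y : L) (z : q''.K) (a : A), p'.Val (incl hLl y, incl q''.le z) a →
      f y = z ∧ b y = a := by
    intro y z a hv
    obtain rfl : f y = z := incl_injective _
      (MPair.right_unique (k₂_eq_bot hk hp') (hf y).mem hv.mem)
    exact ⟨rfl, (hf y).eq hv⟩
  let μ : L →* A := MonoidHom.mk' (fun y => b y * q''.lam (f y)) (by
    intro y y'
    obtain ⟨e₁, e₂⟩ := hf' (y * y') (f y * f y') (b y * b y') (by
      rw [map_mul, map_mul]
      exact (hf y).mul (hf y'))
    rw [e₁, e₂, map_mul, mul_mul_mul_comm])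
  refine ⟨⟨L, hLm, hLl, μ⟩, ⟨fun k => ?_, fun y => (hmem _).1 y.2, fun k y hy => (hmem y).2 ⟨k, hy⟩,
    fun k y a ha => ?_⟩, ⟨fun y => ⟨f y, (hf y).mem⟩, fun z => ?_, fun y z hz => ?_,
    fun y z a ha => ?_⟩⟩
  · obtain ⟨y, z, h₁, h₂⟩ := hq k
    exact ⟨⟨y, (hmem y).2 ⟨k, h₁⟩⟩, h₁⟩
  · change a * (b y * q''.lam (f y)) = _
    rw [← mul_assoc]
    exact hl.lam_eq k (f y) _ ((val_star c).2 ⟨_, a, b y, ha, hf y, rfl⟩)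
  · obtain ⟨k, y, h₁, h₂⟩ := hl.exists_left z
    exact ⟨⟨y, (hmem y).2 ⟨k, h₁⟩⟩, h₂⟩
  · obtain ⟨k, hk₁⟩ := (hmem (incl hLl y)).1 y.2
    exact hl.mem_right k z ⟨_, hk₁, hz⟩
  · obtain ⟨rfl, rfl⟩ := hf' y z a ha
    rfl

variable {R : Type r} [CommRing R] {h : X.AxiomsItoIII}

/-! ### The maps between the coordinates -/

/-- The functor `F` takes the product `(D, φ) * (E, ψ)` to the composite if `p₂(D)` is all of the
intermediate group; the condition `k₂` makes the product defined. -/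
lemma map_mor_mor (hk : X.CondK2) (F : FunctorCat.{u, w, r} X R h) (hG : G ∈ X.𝒢) (hH : H ∈ X.𝒢)
    (hK : K ∈ X.𝒢) {p : MPair (G × H) A} (hp : p ∈ X.S G H) {q : MPair (H × K) A}
    (hq : q ∈ X.S H K) {t : MPair (G × K) A} (ht : t ∈ X.S G K)
    (hs : ∀ y : H, ∃ g, (g, y) ∈ p.D)
    (hv : ∀ g k a, t.Val (g, k) a ↔
      ∃ (y : H) (b b' : A), p.Val (g, y) b ∧ q.Val (y, k) b' ∧ b * b' = a)
    (x : F.obj.obj (⟨K, hK⟩ : X.DCat R h)) :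
    (F.obj.map (mor (h := h) hG hH p hp)).hom ((F.obj.map (mor (h := h) hH hK q hq)).hom x) =
      (F.obj.map (mor (h := h) hG hK t ht)).hom x := by
  have e : mor (R := R) (h := h) hH hK q hq ≫ mor (h := h) hG hH p hp =
      mor (h := h) hG hK t ht := by
    refine Subtype.ext ?_
    change tensorR R (cls R (trans p)) (cls R (trans q)) = cls R (trans t)
    rw [tensorR_cls, cls_eq (tensor_trans p q (hk _ hG _ hH _ hp) hs)]
    congr 2
    refine ext_val ?_
    rintro ⟨g, k⟩ a
    rw [val_star, hv]
  rw [← e, F.obj.map_comp]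
  rfl

/-- The map `F(L) → F(K)` attached to a link from `(K, α)` to `(L, μ)`. -/
def linkMap (h8 : X.AxiomVIII) (F : FunctorCat.{u, w, r} X R h) {p : MPair (G × H) A}
    (hp : p ∈ X.plus.S G H) {q : X.MPrime G} {q' : X.MPrime H} (hl : Links p q q') :
    val F q' →ₗ[R] val F q :=
  (F.obj.map (mor (h := h) (R := R) q.mem q'.mem (p.res q.le q'.le) (hl.mem_S h8 hp))).hom

open Classical in
/-- The contribution to the coordinate at `q = (K, α)` of an element with stabilizing pair `p`:
it is the map attached to the link from `q`, evaluated at the coordinate of `x` at the other end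
of that link, and `0` if there is no link or if `p` is not in `𝒮⁺(G, H)`. -/
def term (h8 : X.AxiomVIII) (F : FunctorCat.{u, w, r} X R h) (p : MPair (G × H) A)
    (q : X.MPrime G) : (⨁ q' : X.MPrime H, val F q') →ₗ[R] val F q :=
  if hp : p ∈ X.plus.S G H ∧ ∃ q' : X.MPrime H, Links p q q' then
    (linkMap h8 F hp.1 hp.2.choose_spec).comp
      (DirectSum.component R (X.MPrime H) (fun q' => val F q') hp.2.choose)
  else 0

lemma term_of_links (h8 : X.AxiomVIII) (F : FunctorCat.{u, w, r} X R h) {p : MPair (G × H) A}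
    (hp : p ∈ X.plus.S G H) {q : X.MPrime G} {q' : X.MPrime H} (hl : Links p q q')
    (x : ⨁ q' : X.MPrime H, val F q') : term h8 F p q x = linkMap h8 F hp hl (x q') := by
  have he : ∃ q' : X.MPrime H, Links p q q' := ⟨q', hl⟩
  obtain rfl := hl.right_unique he.choose_spec
  rw [term, dif_pos ⟨hp, he⟩]
  rfl

lemma term_of_not (h8 : X.AxiomVIII) (F : FunctorCat.{u, w, r} X R h) {p : MPair (G × H) A}
    {q : X.MPrime G} (hn : ¬ (p ∈ X.plus.S G H ∧ ∃ q' : X.MPrime H, Links p q q'))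
    (x : ⨁ q' : X.MPrime H, val F q') : term h8 F p q x = 0 := by
  rw [term, dif_neg hn]
  rfl

/-- The sum over `μ` in the coordinates of `F⁺(U)(x)` has at most one nonzero summand. -/
lemma finsum_mapU (h8 : X.AxiomVIII) (hk : X.CondK2) (F : FunctorCat.{u, w, r} X R h)
    {p : MPair (G × H) A} (hp : p ∈ X.plus.S G H) (q : X.MPrime G)
    (x : ⨁ q' : X.MPrime H, val F q') :
    (∑ᶠ (hK : q.K ≤ p₁ p.D) (μ : lstar (hK.trans (p₁_le p.D)) p.D →* A) (_ : CondU p q hK μ),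
      mapU h8 F hp q hK μ (x (pairU h8 hp q hK μ))) = term h8 F p q x := by
  by_cases he : ∃ q' : X.MPrime H, Links p q q'
  · obtain ⟨q', hl⟩ := he
    have hK := hl.le
    obtain ⟨μ, rfl⟩ := hl.eq_pairU h8 hp hK
    have hμ : CondU p q hK μ := (links_pairU h8 hk hp q _ _).2 hl
    rw [term_of_links h8 F hp hl, finsum_eq_single _ hK fun hK hne => (hne rfl).elim,
      finsum_eq_single _ μ, finsum_eq_single _ hμ fun hK hne => (hne rfl).elim]
    · rfl
    · intro ν hν
      refine (finsum_congr fun hc => ?_).trans finsum_zero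
      refine (hν ?_).elim
      have := hl.right_unique ((links_pairU h8 hk hp q _ _).1 hc)
      simpa [pairU] using this.symm
  · rw [term_of_not h8 F fun hn => he hn.2]
    refine (finsum_congr fun hK => ?_).trans finsum_zero
    refine (finsum_congr fun μ => ?_).trans finsum_zero
    refine (finsum_congr fun hc => ?_).trans finsum_zero
    exact (he ⟨_, (links_pairU h8 hk hp q hK μ).1 hc⟩).elim

lemma val_res {K' L' : FinGrp V} {hK : K' ≤ G} {hL : L' ≤ H} {p : MPair (G × H) A} {k : K'}
    {l : L'} {a : A} : (p.res hK hL).Val (k, l) a ↔ p.Val (incl hK k, incl hL l) a := Iff.rfl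

/-- Conjugation from the left moves the source of a link and keeps its target. -/
lemma term_conj_left (h7 : X.AxiomVII) (h8 : X.AxiomVIII) (hI : X.ClosedUnderInter)
    (hk : X.CondK2) (F : FunctorCat.{u, w, r} X R h) (hG : G ∈ X.𝒢) (hH : H ∈ X.𝒢)
    (p : MPair (G × H) A) (q : X.MPrime G) (g : G) (x : ⨁ q' : X.MPrime H, val F q') :
    conjMap h7 F hG q g (term h8 F p q x) =
      term h8 F (p.conj (g, 1)) (q.conj h h7 hG g) x := by
  have hax := plus_axioms h h7 h8 hI
  by_cases hn : p ∈ X.plus.S G H ∧ ∃ q' : X.MPrime H, Links p q q'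
  · obtain ⟨hp, q', hl⟩ := hn
    have hp' := hax.conj_mem G hG H hH p hp (g, 1)
    have hl' := (links_conj_left h h7 hG (q := q) g).2 hl
    rw [term_of_links h8 F hp hl, term_of_links h8 F hp' hl']
    refine map_mor_mor hk F _ _ _ _ _ _ ?_ ?_ _
    · intro y
      obtain ⟨z, hz⟩ := conjInv_surjective q.le g y
      exact ⟨z, hz⟩
    · intro k z a
      refine (val_conj_left (hK := q.le) k).trans ?_
      constructor
      · intro hv
        exact ⟨conjInv q.le g k, 1, a, ⟨rfl, rfl⟩, hv, one_mul a⟩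
      · rintro ⟨y, b, b', hb, hb', rfl⟩
        obtain ⟨rfl, rfl⟩ := val_graph.1 hb
        rw [one_mul]
        exact hb'
  · rw [term_of_not h8 F hn, map_zero, term_of_not h8 F]
    rintro ⟨hp, q', hl⟩
    refine hn ⟨?_, q', (links_conj_left h h7 hG g).1 hl⟩
    have := hax.conj_mem G hG H hH _ hp (g⁻¹, 1)
    convert this using 1
    refine ext_val ?_
    rintro ⟨k, l⟩ a
    rw [val_conj_prod, val_conj_prod]
    simp [mul_assoc]

lemma conj_conj_right (p : MPair (G × H) A) (y : H) :
    (p.conj (1, y)).conj (1, y⁻¹) = p := by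
  refine ext_val ?_
  rintro ⟨k, l⟩ a
  rw [val_conj_prod, val_conj_prod]
  simp [mul_assoc]

/-- Conjugation from the right moves the target of a link and keeps its source, and the coordinates
of `x ∈ F⁺(H)` at both targets correspond under the conjugation map. -/
lemma term_conj_right (h7 : X.AxiomVII) (h8 : X.AxiomVIII) (hI : X.ClosedUnderInter)
    (hk : X.CondK2) (F : FunctorCat.{u, w, r} X R h) (hG : G ∈ X.𝒢) (hH : H ∈ X.𝒢)
    (p : MPair (G × H) A) (q : X.MPrime G) (y : H) (x : Fplus h7 F hH) :
    term h8 F (p.conj (1, y)) q x.1 = term h8 F p q x.1 := by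
  have hax := plus_axioms h h7 h8 hI
  by_cases hn : p ∈ X.plus.S G H ∧ ∃ q' : X.MPrime H, Links p q q'
  · obtain ⟨hp, q', hl⟩ := hn
    have hp' := hax.conj_mem G hG H hH p hp (1, y)
    have hl' := hl.conj_right h h7 hH y
    rw [term_of_links h8 F hp hl, term_of_links h8 F hp' hl', ← x.2 q' y]
    refine map_mor_mor hk F _ _ _ _ _ _ ?_ ?_ _
    · exact fun z => hl'.exists_left z
    · intro k z a
      constructor
      · intro hv
        obtain ⟨z, rfl⟩ := conjInv_surjective q'.le y z
        exact ⟨z, a, 1, (val_conj_right (hK := q'.le) z).2 hv, ⟨rfl, rfl⟩, mul_one a⟩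
      · rintro ⟨z, b, b', hb, hb', rfl⟩
        obtain ⟨rfl, rfl⟩ := val_graph.1 hb'
        rw [mul_one]
        exact (val_conj_right (hK := q'.le) z).1 hb
  · rw [term_of_not h8 F hn, term_of_not h8 F]
    rintro ⟨hp, q', hl⟩
    refine hn ⟨?_, q'.conj h h7 hH y⁻¹, ?_⟩
    · have := hax.conj_mem G hG H hH _ hp (1, y⁻¹)
      rwa [conj_conj_right] at this
    · have := hl.conj_right h h7 hH y⁻¹
      rwa [conj_conj_right] at this

/-- The contributions of the products `(D, φ) * (Eᵢ, ψᵢ)` add up to the contribution of `(D, φ)`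
evaluated at the family `z` to which the `(Eᵢ, ψᵢ)` contribute: a link via a product factors uniquely
through an intermediate pair, and there the composition formula applies. -/
lemma term_star (h7 : X.AxiomVII) (h8 : X.AxiomVIII) (hI : X.ClosedUnderInter)
    (hk : X.CondK2) (F : FunctorCat.{u, w, r} X R h) (hG : G ∈ X.𝒢) (hH : H ∈ X.𝒢)
    (hK : K ∈ X.𝒢) {ι : Type*} (s : Finset ι) {p : MPair (G × H) A} (hp : p ∈ X.plus.S G H)
    (p' : ι → MPair (H × K) A) (hp' : ∀ i, p' i ∈ X.plus.S H K)
    (q : X.MPrime G) (x : ⨁ q' : X.MPrime K, val F q') (z : ⨁ q' : X.MPrime H, val F q')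
    (hz : ∀ q', z q' = ∑ i ∈ s, term h8 F (p' i) q' x) :
    term h8 F p q z =
      ∑ i ∈ s, term h8 F (star p (p' i) (compat_of_k₂ (k₂_eq_bot hk hp) (p' i))) q x := by
  have hax := plus_axioms h h7 h8 hI
  by_cases he : ∃ q' : X.MPrime H, Links p q q'
  · obtain ⟨q', hl⟩ := he
    rw [term_of_links h8 F hp hl, hz, map_sum]
    refine Finset.sum_congr rfl fun i _ => ?_
    have hc := compat_of_k₂ (k₂_eq_bot hk hp) (p' i)
    have hm := hax.star_mem G hG H hH K hK p hp (p' i) (hp' i) hc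
    by_cases he' : ∃ q'' : X.MPrime K, Links (p' i) q' q''
    · obtain ⟨q'', hl'⟩ := he'
      have hl'' := hl.star hc hl'
      rw [term_of_links h8 F (hp' i) hl', term_of_links h8 F hm hl'']
      refine map_mor_mor hk F _ _ _ _ _ _ hl.exists_left ?_ _
      intro k z a
      rw [val_res, val_star]
      constructor
      · rintro ⟨y, b, b', h₁, h₂, e⟩
        exact ⟨⟨y, hl.mem_right k y h₁.mem⟩, b, b', h₁, h₂, e⟩
      · rintro ⟨y, b, b', h₁, h₂, e⟩
        exact ⟨_, b, b', h₁, h₂, e⟩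
    · rw [term_of_not h8 F fun hn => he' hn.2, map_zero, term_of_not h8 F]
      rintro ⟨-, q'', hl'⟩
      obtain ⟨q₁, h₁, h₂⟩ := Links.of_star h8 hk hp (hp' i) hc hl'
      obtain rfl := hl.right_unique h₁
      exact he' ⟨_, h₂⟩
  · rw [term_of_not h8 F fun hn => he hn.2]
    refine (Finset.sum_eq_zero fun i _ => term_of_not h8 F ?_ x).symm
    rintro ⟨-, q'', hl'⟩
    obtain ⟨q₁, h₁, -⟩ := Links.of_star h8 hk hp (hp' i) _ hl'
    exact he ⟨_, h₁⟩

lemma term_diag (h7 : X.AxiomVII) (h8 : X.AxiomVIII) (hI : X.ClosedUnderInter)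
    (F : FunctorCat.{u, w, r} X R h) (hG : G ∈ X.𝒢) (q : X.MPrime G)
    (x : ⨁ q' : X.MPrime G, val F q') : term h8 F (diag G) q x = x q := by
  have hp := (plus_axioms h h7 h8 hI).diag_mem G hG
  have hl : Links (diag G) q q := by
    refine ⟨fun k => ⟨k, rfl⟩, fun k => ⟨k, rfl⟩, fun k y hy => ?_, fun k y a hv => ?_⟩
    · obtain rfl : incl q.le k = y := hy
      exact k.2
    · obtain ⟨e, rfl⟩ := val_graph.1 hv
      obtain rfl := incl_injective q.le e
      exact one_mul _
  rw [term_of_links h8 F hp hl]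
  have e : mor (R := R) (h := h) q.mem q.mem ((diag G).res q.le q.le) (hl.mem_S h8 hp) =
      𝟙 (⟨q.K, q.mem⟩ : X.DCat R h) := by
    refine Subtype.ext ?_
    change cls R (trans ((diag G).res q.le q.le)) = cls R (trans (diag q.K))
    congr 2
    refine ext_val ?_
    rintro ⟨k, l⟩ a
    refine val_graph.trans (Iff.trans ?_ val_graph.symm)
    exact and_congr (incl_injective q.le).eq_iff Iff.rfl
  rw [linkMap, e, F.obj.map_id]
  rfl

lemma term_naturality (h8 : X.AxiomVIII) {F F' : FunctorCat.{u, w, r} X R h} (η : F ⟶ F')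
    (p : MPair (G × H) A) (q : X.MPrime G) (x : ⨁ q' : X.MPrime H, val F q')
    (x' : ⨁ q' : X.MPrime H, val F' q')
    (hx : ∀ q' : X.MPrime H, x' q' = (η.hom.app ⟨q'.K, q'.mem⟩).hom (x q')) :
    term h8 F' p q x' = (η.hom.app ⟨q.K, q.mem⟩).hom (term h8 F p q x) := by
  by_cases hn : p ∈ X.plus.S G H ∧ ∃ q' : X.MPrime H, Links p q q'
  · obtain ⟨hp, q', hl⟩ := hn
    rw [term_of_links h8 F hp hl, term_of_links h8 F' hp hl, hx]
    exact (congrArg (fun f => f.hom (x q')) (η.hom.naturality (mor (h := h) (R := R) q.mem q'.mem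
      (p.res q.le q'.le) (hl.mem_S h8 hp)))).symm
  · rw [term_of_not h8 F hn, term_of_not h8 F' hn, map_zero]

/-! ### The map `F⁺(U)` -/

lemma finite_le (G : FinGrp V) : {K : FinGrp V | K ≤ G}.Finite := by
  refine Set.Finite.of_finite_image (f := FinGrp.carrier)
    ((Set.toFinite G.carrier).finite_subsets.subset ?_) ?_
  · rintro _ ⟨K, hK, rfl⟩
    exact hK.1
  · intro K hK L hL e
    exact eq_of_mem hK hL fun g => by rw [e]

/-- For given `p`, only finitely many coordinates receive a contribution: `(K, α)` is determined
by `K` and the pair linked to it, which must lie in the support of `x`. -/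
lemma finite_term (h8 : X.AxiomVIII) (F : FunctorCat.{u, w, r} X R h) (p : MPair (G × H) A)
    (x : ⨁ q' : X.MPrime H, val F q') : {q : X.MPrime G | term h8 F p q x ≠ 0}.Finite := by
  have hfin : {K : FinGrp V | K ≤ G}.Finite := finite_le G
  have hs : {q' : X.MPrime H | x q' ≠ 0}.Finite := DFinsupp.finite_support x
  have hl : ∀ q ∈ {q : X.MPrime G | term h8 F p q x ≠ 0},
      ∃ q' : X.MPrime H, Links p q q' ∧ x q' ≠ 0 := by
    intro q hq
    by_contra hn
    refine hq ?_
    by_cases hp : p ∈ X.plus.S G H ∧ ∃ q' : X.MPrime H, Links p q q'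
    · obtain ⟨hp, q', hl⟩ := hp
      have h0 : x q' = 0 := by
        by_contra h0
        exact hn ⟨q', hl, h0⟩
      rw [term_of_links h8 F hp hl, h0, map_zero]
    · exact term_of_not h8 F hp x
  refine ((hs.prod hfin).biUnion (t := fun z => {q : X.MPrime G | Links p q z.1 ∧ q.K = z.2})
    fun z _ => Set.Subsingleton.finite ?_).subset ?_
  · rintro q₁ ⟨h₁, e₁⟩ q₂ ⟨h₂, e₂⟩
    exact h₁.left_unique h₂ (e₁.trans e₂.symm)
  · intro q hq
    obtain ⟨q', h₁, h₂⟩ := hl q hq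
    exact Set.mem_biUnion (show (q', q.K) ∈ _ from ⟨h₂, q.le⟩) ⟨h₁, rfl⟩

lemma exists_directSum {ι : Type*} {M : ι → Type*} [∀ i, AddCommMonoid (M i)] (f : ∀ i, M i)
    (hf : {i | f i ≠ 0}.Finite) : ∃ x : ⨁ i, M i, ∀ i, x i = f i := by
  classical
  refine ⟨DFinsupp.mk hf.toFinset fun i => f i, fun i => ?_⟩
  refine (DFinsupp.mk_apply).trans ?_
  by_cases hi : f i = 0
  · simp [hi]
  · rw [dif_pos (hf.mem_toFinset.2 hi)]

variable (h7 : X.AxiomVII) (h8 : X.AxiomVIII) (hI : X.ClosedUnderInter) (hk : X.CondK2)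
  (F : FunctorCat.{u, w, r} X R h)

include hI hk in
lemma term_rightEq (hG : G ∈ X.𝒢) (hH : H ∈ X.𝒢) (U : FibSet (G × H) A) (q : X.MPrime G)
    (x : Fplus h7 F hH) (u t : U) (hu : RightEq U u t) :
    term h8 F (U.stab u) q x.1 = term h8 F (U.stab t) q x.1 := by
  obtain ⟨a, y, rfl⟩ := hu
  rw [stab_smul_A, stab_smul, term_conj_right h7 h8 hI hk F hG hH]

include hI hk in
lemma exists_plusMap (hG : G ∈ X.𝒢) (hH : H ∈ X.𝒢) (U : FibSet (G × H) A) :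
    ∃ f : Fplus h7 F hH →ₗ[R] Fplus h7 F hG, ∀ (T : Finset U) (_ : IsReps U T)
      (x : Fplus h7 F hH) (q : X.MPrime G),
      (f x).1 q = ∑ u ∈ T, term h8 F (U.stab u) q x.1 := by
  obtain ⟨T₀, hT₀⟩ := exists_isReps U
  have hfin : ∀ x : Fplus h7 F hH,
      {q : X.MPrime G | ∑ u ∈ T₀, term h8 F (U.stab u) q x.1 ≠ 0}.Finite := fun x => by
    refine (T₀.finite_toSet.biUnion fun u _ => finite_term h8 F (U.stab u) x.1).subset ?_
    intro q hq
    obtain ⟨u, hu, hu'⟩ := Finset.exists_ne_zero_of_sum_ne_zero hq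
    exact Set.mem_biUnion hu hu'
  choose f hf using fun x => exists_directSum
    (fun q : X.MPrime G => ∑ u ∈ T₀, term h8 F (U.stab u) q x.1) (hfin x)
  have hT : ∀ (T : Finset U), IsReps U T → ∀ (x : Fplus h7 F hH) (q : X.MPrime G),
      f x q = ∑ u ∈ T, term h8 F (U.stab u) q x.1 := fun T hT x q =>
    (hf x q).trans (hT₀.sum_eq hT _ fun u t => term_rightEq h7 h8 hI hk F hG hH U q x u t)
  refine ⟨⟨⟨fun x => ⟨f x, fun q g => ?_⟩, fun x y => ?_⟩, fun c x => ?_⟩, hT⟩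
  · rw [hT _ (hT₀.smul g) x (q.conj h h7 hG g), hf, map_sum, Finset.sum_map]
    refine Finset.sum_congr rfl fun u _ => ?_
    rw [term_conj_left h7 h8 hI hk F hG hH]
    exact congrArg (fun p => term h8 F p _ x.1) (stab_smul U u (g, 1)).symm
  · refine Subtype.ext (DFinsupp.ext fun q => ?_)
    change f (x + y) q = f x q + f y q
    rw [hf, hf, hf, ← Finset.sum_add_distrib]
    exact Finset.sum_congr rfl fun u _ => map_add _ _ _
  · refine Subtype.ext (DFinsupp.ext fun q => ?_)
    change f (c • x) q = c • f x q
    rw [hf, hf, Finset.smul_sum]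
    exact Finset.sum_congr rfl fun u _ => map_smul _ _ _

/-- The map `F⁺(U) : F⁺(H) → F⁺(G)`. It is defined for all `A`-fibered bisets `U`, the orbits
whose stabilizing pairs are not in `𝒮⁺(G, H)` contributing `0`; this makes it extend linearly to
`B^A_R(G, H)`. -/
def plusMap (hG : G ∈ X.𝒢) (hH : H ∈ X.𝒢) (U : FibSet (G × H) A) :
    Fplus h7 F hH →ₗ[R] Fplus h7 F hG :=
  (exists_plusMap h7 h8 hI hk F hG hH U).choose

lemma plusMap_apply (hG : G ∈ X.𝒢) (hH : H ∈ X.𝒢) {U : FibSet (G × H) A} {T : Finset U}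
    (hT : IsReps U T) (x : Fplus h7 F hH) (q : X.MPrime G) :
    (plusMap h7 h8 hI hk F hG hH U x).1 q = ∑ u ∈ T, term h8 F (U.stab u) q x.1 :=
  (exists_plusMap h7 h8 hI hk F hG hH U).choose_spec T hT x q

lemma Fplus_hom_ext {h7 : X.AxiomVII} {F : FunctorCat.{u, w, r} X R h} {hG : G ∈ X.𝒢}
    {M : Type*} [AddCommMonoid M] [Module R M] {f g : M →ₗ[R] Fplus h7 F hG}
    (hfg : ∀ x q, (f x).1 q = (g x).1 q) : f = g :=
  LinearMap.ext fun x => Subtype.ext (DFinsupp.ext (hfg x))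

lemma plusMap_iso (hG : G ∈ X.𝒢) (hH : H ∈ X.𝒢) {U U' : FibSet (G × H) A} (e : U ≈ U') :
    plusMap h7 h8 hI hk F hG hH U = plusMap h7 h8 hI hk F hG hH U' := by
  obtain ⟨e⟩ := e
  obtain ⟨T, hT⟩ := exists_isReps U
  refine Fplus_hom_ext fun x q => ?_
  rw [plusMap_apply h7 h8 hI hk F hG hH hT, plusMap_apply h7 h8 hI hk F hG hH (hT.map e),
    Finset.sum_map]
  exact Finset.sum_congr rfl fun u _ => by rw [Equiv.coe_toEmbedding, stab_iso]

lemma stab_inl {U U' : FibSet (G × H) A} (u : U) :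
    (FibSet.sum U U').stab (FibSet.inl u) = U.stab u :=
  ext_val fun γ a => by rw [val_stab, val_stab, smul_inl, smul_inl_A, inl_inj]

lemma stab_inr {U U' : FibSet (G × H) A} (u : U') :
    (FibSet.sum U U').stab (FibSet.inr u) = U'.stab u :=
  ext_val fun γ a => by rw [val_stab, val_stab, smul_inr, smul_inr_A, inr_inj]

lemma plusMap_sum (hG : G ∈ X.𝒢) (hH : H ∈ X.𝒢) (U U' : FibSet (G × H) A) :
    plusMap h7 h8 hI hk F hG hH (FibSet.sum U U') =
      plusMap h7 h8 hI hk F hG hH U + plusMap h7 h8 hI hk F hG hH U' := by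
  obtain ⟨T, hT⟩ := exists_isReps U
  obtain ⟨T', hT'⟩ := exists_isReps U'
  refine Fplus_hom_ext fun x q => ?_
  refine (plusMap_apply h7 h8 hI hk F hG hH (hT.sum hT') x q).trans ?_
  refine (Finset.sum_disjSum (M := val F q) T T' _).trans ?_
  rw [LinearMap.add_apply]
  refine Eq.trans ?_ (congrArg₂ (· + ·) (plusMap_apply h7 h8 hI hk F hG hH hT x q)
    (plusMap_apply h7 h8 hI hk F hG hH hT' x q)).symm
  refine congrArg₂ (· + ·) (Finset.sum_congr rfl fun u _ => ?_)
    (Finset.sum_congr rfl fun u _ => ?_)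
  · exact congrArg (fun p => term h8 F p q x.1) (stab_inl u)
  · exact congrArg (fun p => term h8 F p q x.1) (stab_inr u)

lemma plusMap_empty (hG : G ∈ X.𝒢) (hH : H ∈ X.𝒢) :
    plusMap h7 h8 hI hk F hG hH (FibSet.empty (G × H) A) = 0 := by
  refine Fplus_hom_ext fun x q => ?_
  exact plusMap_apply h7 h8 hI hk F hG hH (T := ∅) (fun x => PEmpty.elim x) x q

lemma plusMap_diag (hG : G ∈ X.𝒢) :
    plusMap h7 h8 hI hk F hG hG (trans (diag G)) = LinearMap.id := by
  refine Fplus_hom_ext fun x q => ?_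
  have hT : IsReps (trans (diag (A := A) G)) {base _} := by
    intro x
    obtain ⟨⟨y, a, rfl⟩, -⟩ := exists_diag_base x
    refine ⟨base _, ⟨Finset.mem_singleton_self _, a, y, (A_smul_comm _ _ _ _).symm⟩, ?_⟩
    rintro t ⟨ht, -⟩
    exact Finset.mem_singleton.1 ht
  rw [plusMap_apply h7 h8 hI hk F hG hG hT, Finset.sum_singleton, stab_base,
    term_diag h7 h8 hI F hG]
  rfl

lemma plusMap_tensor (hG : G ∈ X.𝒢) (hH : H ∈ X.𝒢) (hK : K ∈ X.𝒢) {U : FibSet (G × H) A}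
    {W : FibSet (H × K) A} (hU : ∀ u, U.stab u ∈ X.plus.S G H)
    (hW : ∀ v, W.stab v ∈ X.plus.S H K) :
    plusMap h7 h8 hI hk F hG hK (FibSet.tensor U W) =
      plusMap h7 h8 hI hk F hG hH U ∘ₗ plusMap h7 h8 hI hk F hH hK W := by
  obtain ⟨T, hT⟩ := exists_isReps U
  obtain ⟨S, hS⟩ := exists_isReps W
  have hk₂ : ∀ u, k₂ (U.stab u).D = ⊥ := fun u => k₂_eq_bot hk (hU u)
  obtain ⟨hinj, hTS⟩ := IsReps.tensor hk₂ hT hS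
  refine Fplus_hom_ext fun x q => ?_
  rw [plusMap_apply h7 h8 hI hk F hG hK hTS, LinearMap.comp_apply,
    plusMap_apply h7 h8 hI hk F hG hH hT, Finset.sum_map, Fintype.sum_prod_type,
    ← Finset.sum_coe_sort T]
  refine Finset.sum_congr rfl fun u _ => ?_
  rw [term_star h7 h8 hI hk F hG hH hK S (hU u) (fun v => W.stab v) hW q x.1 _
    (plusMap_apply h7 h8 hI hk F hH hK hS x), ← Finset.sum_coe_sort S]
  refine Finset.sum_congr rfl fun v _ => ?_
  obtain ⟨c, e⟩ := stab_tmk (free_of_k₂ (hk₂ u.1) v.1)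
  exact congrArg (fun p => term h8 F p q x.1) e

/-! ### Linear extension to `B^A_R(G, H)` -/

/-- The `R`-linear map `B^A_R(G, H) → Hom_R(F⁺(H), F⁺(G))` with `[U] ↦ F⁺(U)`. -/
def plusLin (hG : G ∈ X.𝒢) (hH : H ∈ X.𝒢) :
    BR (G × H) A R →ₗ[R] (Fplus h7 F hH →ₗ[R] Fplus h7 F hG) :=
  LinearMap.liftBaseChange R (AddMonoidHom.toIntLinearMap
    (Algebra.GrothendieckAddGroup.lift
      { toFun := fun c : IsoCls (G × H) A => Quotient.lift (plusMap h7 h8 hI hk F hG hH)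
          (fun _ _ e => plusMap_iso h7 h8 hI hk F hG hH e) c
        map_zero' := by
          change plusMap h7 h8 hI hk F hG hH (FibSet.empty _ A) = 0
          exact plusMap_empty h7 h8 hI hk F hG hH
        map_add' := by
          rintro ⟨U⟩ ⟨U'⟩
          exact plusMap_sum h7 h8 hI hk F hG hH U U' }))

lemma plusLin_cls (hG : G ∈ X.𝒢) (hH : H ∈ X.𝒢) (U : FibSet (G × H) A) :
    plusLin h7 h8 hI hk F hG hH (cls R U) = plusMap h7 h8 hI hk F hG hH U := by
  rw [cls, plusLin, LinearMap.liftBaseChange_tmul, one_smul]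
  exact lift_of _ _

lemma plusLin_tensorR (hG : G ∈ X.𝒢) (hH : H ∈ X.𝒢) (hK : K ∈ X.𝒢) {a : BR (G × H) A R}
    {b : BR (H × K) A R} (ha : a ∈ X.plus.homD R G H) (hb : b ∈ X.plus.homD R H K) :
    plusLin h7 h8 hI hk F hG hK (tensorR R a b) =
      plusLin h7 h8 hI hk F hG hH a ∘ₗ plusLin h7 h8 hI hk F hH hK b := by
  have hax := plus_axioms h h7 h8 hI
  induction ha using Submodule.span_induction with
  | zero => simp
  | add _ _ _ _ h₁ h₂ =>
    rw [map_add, LinearMap.add_apply, map_add, h₁, h₂, map_add, LinearMap.add_comp]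
  | smul _ _ _ h₁ =>
    rw [map_smul, LinearMap.smul_apply, map_smul, h₁, map_smul, LinearMap.smul_comp]
  | mem _ hx =>
    obtain ⟨p, hp, rfl⟩ := hx
    induction hb using Submodule.span_induction with
    | zero => simp
    | add _ _ _ _ h₁ h₂ => rw [map_add, map_add, h₁, h₂, map_add, LinearMap.comp_add]
    | smul _ _ _ h₁ => rw [map_smul, map_smul, h₁, map_smul, LinearMap.comp_smul]
    | mem _ hy =>
      obtain ⟨p', hp', rfl⟩ := hy
      change plusLin h7 h8 hI hk F hG hK (tensorR R (cls R (trans p)) (cls R (trans p'))) =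
        plusLin h7 h8 hI hk F hG hH (cls R (trans p)) ∘ₗ
          plusLin h7 h8 hI hk F hH hK (cls R (trans p'))
      rw [tensorR_cls, plusLin_cls, plusLin_cls, plusLin_cls]
      exact plusMap_tensor h7 h8 hI hk F hG hH hK (stab_mem hax hG hH hp) (stab_mem hax hH hK hp')

/-! ### The functor `-⁺` -/

/-- The functor `F⁺`. -/
def plusObj : FunctorCat.{u, w, r} X.plus R (plus_axioms h h7 h8 hI) where
  obj :=
    { obj := fun G => ModuleCat.of R (Fplus h7 F (G := G.grp) G.mem)
      map := fun {H G} f => ModuleCat.ofHom (plusLin h7 h8 hI hk F G.mem H.mem f.1)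
      map_id := fun G => by
        refine congrArg ModuleCat.ofHom ?_
        exact (plusLin_cls h7 h8 hI hk F G.mem G.mem _).trans (plusMap_diag h7 h8 hI hk F G.mem)
      map_comp := fun {K H G} f g => congrArg ModuleCat.ofHom
        (plusLin_tensorR h7 h8 hI hk F G.mem H.mem K.mem g.2 f.2) }
  property :=
    ⟨⟨fun {H G} f g => congrArg ModuleCat.ofHom
        (map_add (plusLin h7 h8 hI hk F G.mem H.mem) f.1 g.1)⟩,
      ⟨fun {H G} f c => congrArg ModuleCat.ofHom
        (map_smul (plusLin h7 h8 hI hk F G.mem H.mem) c f.1)⟩⟩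

variable {F} {F' : FunctorCat.{u, w, r} X R h}

/-- The map `η⁺_G : F⁺(G) → F'⁺(G)`, `(x_{(K, λ)}) ↦ (η_K(x_{(K, λ)}))`. -/
def plusNat (η : F ⟶ F') (hG : G ∈ X.𝒢) : Fplus h7 F hG →ₗ[R] Fplus h7 F' hG :=
  LinearMap.restrict
    (DirectSum.lmap (fun q : X.MPrime G => (η.hom.app ⟨q.K, q.mem⟩).hom))
    (fun x hx q g => by
      rw [DirectSum.lmap_apply, DirectSum.lmap_apply, ← hx q g]
      exact (congrArg (fun f => f.hom (x q)) (η.hom.naturality (mor (h := h) (R := R)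
        (q.conj h h7 hG g).mem q.mem (graph (conjInv q.le g))
        (conj_mem_aux h h7 hG q.mem q.le g).2))).symm)

lemma plusNat_apply (η : F ⟶ F') (hG : G ∈ X.𝒢) (x : Fplus h7 F hG) (q : X.MPrime G) :
    (plusNat h7 η hG x).1 q = (η.hom.app ⟨q.K, q.mem⟩).hom (x.1 q) :=
  DirectSum.lmap_apply _ _ _

lemma plusNat_plusLin (η : F ⟶ F') (hG : G ∈ X.𝒢) (hH : H ∈ X.𝒢) (a : BR (G × H) A R) :
    plusNat h7 η hG ∘ₗ plusLin h7 h8 hI hk F hG hH a =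
      plusLin h7 h8 hI hk F' hG hH a ∘ₗ plusNat h7 η hH := by
  have ha : a ∈ Submodule.span R (Set.range (cls R : FibSet (G × H) A → _)) := by
    rw [span_cls]
    exact Submodule.mem_top
  induction ha using Submodule.span_induction with
  | zero => simp
  | add _ _ _ _ h₁ h₂ => rw [map_add, map_add, LinearMap.comp_add, LinearMap.add_comp, h₁, h₂]
  | smul _ _ _ h₁ => rw [map_smul, map_smul, LinearMap.comp_smul, LinearMap.smul_comp, h₁]
  | mem _ hx =>
    obtain ⟨U, rfl⟩ := hx
    obtain ⟨T, hT⟩ := exists_isReps U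
    refine Fplus_hom_ext fun x q => ?_
    rw [plusLin_cls, plusLin_cls, LinearMap.comp_apply, LinearMap.comp_apply, plusNat_apply,
      plusMap_apply h7 h8 hI hk F hG hH hT, plusMap_apply h7 h8 hI hk F' hG hH hT, map_sum]
    exact Finset.sum_congr rfl fun u _ =>
      (term_naturality h8 η _ q x.1 _ (plusNat_apply h7 η hH x)).symm

variable (X R h) in
/-- The functor `-⁺ : ℱ_{𝒟,R} → ℱ_{𝒟⁺,R}`. -/
def plusFunctor :
    FunctorCat.{u, w, r} X R h ⥤ FunctorCat.{u, w, r} X.plus R (plus_axioms h h7 h8 hI) where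
  obj F := plusObj h7 h8 hI hk F
  map η := ⟨
    { app := fun G => ModuleCat.ofHom (plusNat h7 η (G := G.grp) G.mem)
      naturality := fun H G f => ModuleCat.hom_ext
        (plusNat_plusLin h7 h8 hI hk η G.mem H.mem f.1) }⟩
  map_id F := by
    refine ObjectProperty.hom_ext _ (NatTrans.ext (funext fun G => ?_))
    refine congrArg ModuleCat.ofHom (Fplus_hom_ext fun x q => ?_)
    exact plusNat_apply _ _ _ _ _
  map_comp η θ := by
    refine ObjectProperty.hom_ext _ (NatTrans.ext (funext fun G => ?_))
    refine congrArg ModuleCat.ofHom (Fplus_hom_ext fun x q => ?_)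
    refine (plusNat_apply _ _ _ _ _).trans ?_
    refine Eq.trans ?_ (plusNat_apply h7 θ _ _ q).symm
    exact congrArg (θ.hom.app ⟨q.K, q.mem⟩).hom (plusNat_apply h7 η _ x q).symm

end Datum

end

end FiberedBiset

open CategoryTheory FiberedBiset FiberedBiset.Datum in
theorem mainTheorem2 {V A : Type u} [CommGroup A] (R : Type r) [CommRing R] (X : Datum V A)
    (h : X.AxiomsItoIII) (h7 : X.AxiomVII) (h8 : X.AxiomVIII) (hk : X.CondK2)
    (hI : X.ClosedUnderInter) :
    ∃ (Φ : FunctorCat.{u, w, r} X R h ⥤ FunctorCat.{u, w, r} X.plus R (plus_axioms h h7 h8 hI))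
      (e : ∀ (F : FunctorCat.{u, w, r} X R h) (G : X.plus.DCat R (plus_axioms h h7 h8 hI)),
        (Φ.obj F).obj.obj G ≃ₗ[R] Fplus h7 F G.mem),
      Φ.Additive ∧ Φ.Linear R ∧
      (∀ (F : FunctorCat.{u, w, r} X R h) (G H : X.plus.DCat R (plus_axioms h h7 h8 hI))
        (U : FibSet (G.grp × H.grp) A) (hU : ∀ u, U.stab u ∈ X.plus.S G.grp H.grp)
        (T : Finset U) (_ : IsReps U T) (x : Fplus h7 F H.mem) (q : X.MPrime G.grp),
        (e F G (((Φ.obj F).obj.map (morU U hU)).hom ((e F H).symm x))).1 q =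
          coordU h8 F U hU T x.1 q) ∧
      (∀ (F F' : FunctorCat.{u, w, r} X R h) (η : F ⟶ F')
        (G : X.plus.DCat R (plus_axioms h h7 h8 hI)) (x : Fplus h7 F G.mem)
        (q : X.MPrime G.grp),
        (e F' G (((Φ.map η).hom.app G).hom ((e F G).symm x))).1 q =
          (η.hom.app ⟨q.K, q.mem⟩).hom (x.1 q)) := by
  refine ⟨plusFunctor X R h h7 h8 hI hk, fun F G => LinearEquiv.refl R _, ⟨?_⟩, ⟨?_⟩, ?_, ?_⟩
  · intro F F' η θ
    refine ObjectProperty.hom_ext _ (NatTrans.ext (funext fun G => ?_))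
    refine congrArg ModuleCat.ofHom (Fplus_hom_ext fun x q => ?_)
    refine (plusNat_apply _ _ _ _ _).trans ?_
    exact (congrArg₂ (· + ·) (plusNat_apply h7 η G.mem x q) (plusNat_apply h7 θ G.mem x q)).symm
  · intro F F' η c
    refine ObjectProperty.hom_ext _ (NatTrans.ext (funext fun G => ?_))
    refine congrArg ModuleCat.ofHom (Fplus_hom_ext fun x q => ?_)
    refine (plusNat_apply _ _ _ _ _).trans ?_
    exact (congrArg (c • ·) (plusNat_apply h7 η G.mem x q)).symm
  · intro F G H U hU T hT x q
    refine (congrArg (fun f => (f x).1 q) (plusLin_cls h7 h8 hI hk F G.mem H.mem U)).trans ?_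
    refine (plusMap_apply h7 h8 hI hk F G.mem H.mem hT x q).trans ?_
    exact Finset.sum_congr rfl fun u _ => (finsum_mapU h8 hk F (hU u) q x.1).symm
  · intro F F' η G x q
    exact plusNat_apply h7 η G.mem x q
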